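/- **Conventions.** All composites are written in diagrammatic order: $fg$ is the composite of $f\colon A\to B$ and $g\colon B\to Z$; $\alpha\cdot\beta$ is the vertical and $\alpha\circ\beta$ the horizontal composite of 2-morphisms, and a 1-morphism $f$ in a horizontal composite stands for $1_f$. $\mathrm{Hom}(A,B)$ is the category of 1-morphisms $A\to B$ and 2-morphisms between them (vertical composition), and $\mathrm{2Hom}(f,g)$ is the set of 2-morphisms $f\Rightarrow g$. All equations between objects, 1- and 2-morphisms are strict and are required whenever both sides are defined. Let $\mathbf F$ be a field. **Semi-strict monoidal 2-category.** A strict 2-category $C$ with an object $I$, a strictly associative tensor product of objects with strict unit $I$, strict 2-functors $A\otimes-$ and $-\otimes A$ for every object $A$, satisfying $I\otimes x=x=x\otimes I$, $A\otimes(B\otimes x)=(A\otimes B)\otimes x$, $A\otimes(x\otimes B)=(A\otimes x)\otimes B$, $(x\otimes A)\otimes B=x\otimes(A\otimes B)$ for 1- and 2-morphisms $x$, and, for all $f\colon A\to C$, $g\colon B\to D$, a 2-isomorphism (tensorator) $$\otimes_{f,g}\colon (f\otimes B)(C\otimes g)\Rightarrow (A\otimes g)(f\otimes D),$$ natural in $f$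 and $g$, with $\otimes_{1_A,g}=1_{A\otimes g}$, $\otimes_{f,1_B}=1_{f\otimes B}$, $\otimes_{A\otimes g,h}=A\otimes\otimes_{g,h}$, $\otimes_{f\otimes B,h}=\otimes_{f,B\otimes h}$, $\otimes_{f,g\otimes X}=\otimes_{f,g}\otimes X$, and, for composable $f,f'$ with $f'\colon C\to C'$ and composable $g,g'$ with $g'\colon D\to D'$, $$\otimes_{ff',g}=\big((f\otimes B)\circ\otimes_{f',g}\big)\cdot\big(\otimes_{f,g}\circ(f'\otimes D)\big),\qquad \otimes_{f,gg'}=\big(\otimes_{f,g}\circ(C\otimes g')\big)\cdot\big((A\otimes g)\circ\otimes_{f,g'}\big).$$ **Duals.** Such a $C$ *has duals* if it is equipped with duals $\alpha^*\colon g\Rightarrow f$ of 2-morphisms $\alpha\colon f\Rightarrow g$; duals $f^*\colon B\to A$ of 1-morphisms $f\colon A\to B$ with $i_f\colon 1_A\Rightarrow ff^*$ and $e_f\colon f^*f\Rightarrow 1_B$; duals $A^*$ of objects with $i_A\colon I\to A\otimes A^*$, $e_A\colon A^*\otimes A\to I$ and $T_A\colon(i_A\otimes A)(A\otimes e_A)\Rightarrow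 1_A$. A 2-morphism $\alpha$ is *unitary* if it is invertible with inverse $\alpha^*$. For $\alpha\colon f\Rightarrow g$ put $$\alpha^\dagger=(g^*\circ i_f)\cdot(g^*\circ\alpha\circ f^*)\cdot(e_g\circ f^*),\qquad {}^\dagger\alpha=(i_{f^*}\circ g^*)\cdot(f^*\circ\alpha\circ g^*)\cdot(f^*\circ e_{g^*}),$$ both $g^*\Rightarrow f^*$. It is required that: 1. $X^{**}=X$ for all objects, 1- and 2-morphisms; $1_X^*=1_X$ for all objects and 1-morphisms $X$; 2. $(\alpha\cdot\beta)^*=\beta^*\cdot\alpha^*$, $(\alpha\circ\beta)^*=\alpha^*\circ\beta^*$, $(fg)^*=g^*f^*$, $(A\otimes x)^*=A\otimes x^*$ and $(x\otimes A)^*=x^*\otimes A$ for 1- and 2-morphisms $x$, $(A\otimes B)^*=B^*\otimes A^*$; 3. all $\otimes_{f,g}$ and all $T_A$ are unitary; 4. $i_{X^*}=e_X^*$ and $e_{X^*}=i_X^*$ for objects and 1-morphisms $X$; 5. $i_{A\otimes B}=i_A(A\otimes i_B\otimes A^*)$, $e_{A\otimes B}=(B^*\otimes e_A\otimes B)e_B$,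 $T_I=1_{1_I}$ and $$T_{A\otimes B}=\big[(i_A\otimes A\otimes B)\circ(A\otimes\otimes_{i_B,e_A}\otimes B)\circ(A\otimes B\otimes e_B)\big]\cdot\big[(T_A\otimes B)\circ(A\otimes T_B)\big];$$ 6. $i_{A\otimes f}=A\otimes i_f$, $i_{f\otimes A}=i_f\otimes A$, $e_{A\otimes f}=A\otimes e_f$, $e_{f\otimes A}=e_f\otimes A$; 7. $i_{fg}=i_f\cdot(f\circ i_g\circ f^*)$, $e_{fg}=(g^*\circ e_f\circ g)\cdot e_g$; 8. $(i_f\circ f)\cdot(f\circ e_f)=1_f$, $(f^*\circ i_f)\cdot(e_f\circ f^*)=1_{f^*}$; 9. $(\alpha^\dagger)^*=(\alpha^*)^\dagger$; 10. $\big[i_A\circ(A\otimes T_{A^*}^\dagger)\big]\cdot\big[\otimes_{i_A,i_A}\circ(A\otimes e_A\otimes A^*)\big]\cdot\big[i_A\circ(T_A\otimes A^*)\big]=1_{i_A}$. **Pivotal.** For $f\colon A\to B$ put $${}^\#f=(i_{A^*}\otimes B^*)(A^*\otimes f\otimes B^*)(A^*\otimes e_{B^*}),\qquad f^\#=(B^*\otimes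 i_A)(B^*\otimes f\otimes A^*)(e_B\otimes A^*),$$ both $B^*\to A^*$, and define ${}^\#\alpha$, $\alpha^\#$ for 2-morphisms by the same formulas. For $f\colon A\to B$, $g\colon B\to Z$ let $\lambda_{f,g}\colon{}^\#(fg)\Rightarrow{}^\#g\,{}^\#f$ be the vertical composite of the four 2-morphisms - $(i_{A^*}\otimes Z^*)(A^*\otimes f\otimes Z^*)\circ(A^*\otimes T_B^\dagger\otimes Z^*)\circ(A^*\otimes g\otimes Z^*)(A^*\otimes e_{Z^*})$, - $(i_{A^*}\otimes Z^*)(A^*\otimes f\otimes Z^*)(A^*\otimes B\otimes i_{B^*}\otimes Z^*)\circ(A^*\otimes\otimes_{e_{B^*},g}\otimes Z^*)\circ(A^*\otimes e_{Z^*})$, - $\otimes_{i_{A^*}(A^*\otimes f),\,q}\circ(A^*\otimes e_{B^*}\otimes Z\otimes Z^*)(A^*\otimes e_{Z^*})$, where $q=(i_{B^*}\otimes Z^*)(B^*\otimes g\otimes Z^*)$, - $q\circ\otimes_{{}^\#f,\,e_{Z^*}}$, and let $\rho_{f,g}\colon(fg)^\#\Rightarrow g^\#f^\#$ be the vertical composite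 of - $(Z^*\otimes i_A)(Z^*\otimes f\otimes A^*)\circ(Z^*\otimes T_B^{-1}\otimes A^*)\circ(Z^*\otimes g\otimes A^*)(e_Z\otimes A^*)$, - $(Z^*\otimes i_A)(Z^*\otimes f\otimes A^*)(Z^*\otimes i_B\otimes B\otimes A^*)\circ(Z^*\otimes\otimes_{g,e_B}^{-1}\otimes A^*)\circ(e_Z\otimes A^*)$, - $\otimes_{p,\,i_A(f\otimes A^*)}^{-1}\circ(Z^*\otimes Z\otimes e_B\otimes A^*)(e_Z\otimes A^*)$, where $p=(Z^*\otimes i_B)(Z^*\otimes g\otimes B^*)$, - $p\circ\otimes_{e_Z,\,f^\#}^{-1}$. A *pivotal structure* is a family of unitary 2-morphisms $\phi_f\colon{}^\#f\Rightarrow f^\#$ (all 1-morphisms $f$) with ${}^\#\alpha\cdot\phi_g=\phi_f\cdot\alpha^\#$ for $\alpha\colon f\Rightarrow g$; $\phi_f^\dagger=\phi_{f^*}$; $\phi_{fg}\cdot\rho_{f,g}=\lambda_{f,g}\cdot(\phi_g\circ\phi_f)$; and ${}^\#(\alpha^\dagger)={}^\dagger(\alpha^\#)$, $({}^\#\alpha)^\dagger=({}^\dagger\alpha)^\#$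 for all 2-morphisms $\alpha$. **Traces, caps, cups, consistency.** For $f\in\mathrm{End}(A)$ put $\mathrm{Tr}_L(f)=i_{A^*}(A^*\otimes f)e_A$ and $\mathrm{Tr}_R(f)=i_A(f\otimes A^*)e_{A^*}$, and similarly on 2-morphisms between endomorphisms of $A$. For $f\colon A\to B$ let $\cap^R_f=i_{i_A(f\otimes A^*)}\colon 1_I\Rightarrow\mathrm{Tr}_R(ff^*)$, $\cap^L_f=i_{i_{A^*}(A^*\otimes f)}\colon 1_I\Rightarrow\mathrm{Tr}_L(ff^*)$, $\cup^R_f=(\cap^R_f)^*$, $\cup^L_f=(\cap^L_f)^*$. For $f\colon A\to B$, $g\colon B\to A$ put $P=i_A(f\otimes A^*)$, $Q=i_B(g\otimes B^*)$, $R=(g\otimes A^*)e_{A^*}$ and let $\theta^R_{f,g}\colon\mathrm{Tr}_R(fg)\Rightarrow\mathrm{Tr}_R(gf)$ be $$\begin{aligned}&\big(P\circ(T_B^\dagger\otimes A^*)\circ R\big)\cdot\big(P(B\otimes i_{B^*}\otimes A^*)\circ\otimes_{e_{B^*},R}\big)\cdot\big(P\circ(B\otimes\phi_g)\circ e_{B^*}\big)\\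 &\cdot\big(\otimes_{P,Q}\circ(B\otimes e_A\otimes B^*)e_{B^*}\big)\cdot\big(Q(i_A\otimes A\otimes B^*)\circ(\otimes_{f,e_A}\otimes B^*)\circ e_{B^*}\big)\cdot\big(Q\circ(T_A\otimes B^*)\circ(f\otimes B^*)e_{B^*}\big).\end{aligned}$$ Let $\theta^L_{f,g}\colon\mathrm{Tr}_L(fg)\Rightarrow\mathrm{Tr}_L(gf)$ be its mirror image: with $P=i_{A^*}(A^*\otimes f)$, $Q=i_{B^*}(B^*\otimes g)$, $R=(A^*\otimes g)e_A$, $$\begin{aligned}&\big(P\circ(A^*\otimes T_B^{-1})\circ R\big)\cdot\big(P(A^*\otimes i_B\otimes B)\circ\otimes^{-1}_{R,e_B}\big)\cdot\big(P\circ(\phi_g^{-1}\otimes B)\circ e_B\big)\\ &\cdot\big(\otimes^{-1}_{Q,P}\circ(B^*\otimes e_{A^*}\otimes B)e_B\big)\cdot\big(Q(B^*\otimes A\otimes i_{A^*})\circ(B^*\otimes\otimes^{-1}_{e_{A^*},f})\circ e_B\big)\cdot\big(Q\circ(B^*\otimes(T_A^\dagger)^{-1})\circ(B^*\otimes f)e_B\big).\end{aligned}$$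 The pivotal structure is *consistent* if for $S=R$ and $S=L$ and every 1-morphism $f$: $\cap^S_f\cdot\theta^S_{f,f^*}=\cap^S_{f^*}$ and $\theta^S_{f,f^*}\cdot\cup^S_{f^*}=\cup^S_f$. **Spherical.** A *semi-strict spherical 2-category* is a semi-strict monoidal 2-category with duals and a consistent pivotal structure, together with unitary 2-morphisms $\sigma_f\colon\mathrm{Tr}_L(f)\Rightarrow\mathrm{Tr}_R(f)$ for all endomorphisms $f$ of objects, such that $\sigma_f\cdot\mathrm{Tr}_R(\alpha)=\mathrm{Tr}_L(\alpha)\cdot\sigma_g$ for $\alpha\colon f\Rightarrow g$, and $\cap^L_{1_A}\cdot\sigma_{1_A}=\cap^R_{1_A}$, $\sigma_{1_A}\cdot\cup^R_{1_A}=\cup^L_{1_A}$ for every object $A$. It is *Vect-linear* (over $\mathbf F$) if every $\mathrm{2Hom}(f,g)$ with $f,g\colon A\to B$ is an $\mathbf F$-vector space, vertical and horizontal composition are $\mathbf F$-bilinear, $A\otimes-$ and $-\otimes A$ are $\mathbf F$-linear on 2-morphisms, and every $\mathrm{Hom}(A,B)$ is a 2-vector space of finite rank, i.e. $\mathbf F$-linearly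 equivalent to $\mathrm{Vect}^n$ for some $n\in\mathbb N$, where $\mathrm{Vect}$ is the category of finite-dimensional $\mathbf F$-vector spaces. **Pairing.** For $f,g\colon A\to B$, $\alpha\in\mathrm{2Hom}(f,g)$ and $\beta\in\mathrm{2Hom}(g,f)$ put $$\langle\alpha,\beta\rangle=\cap^R_f\cdot\mathrm{Tr}_R\big((\alpha\cdot\beta)\circ 1_{f^*}\big)\cdot\cup^R_f\in\mathrm{2End}(1_I).$$ $C$ is *non-degenerate* if for all such $f,g$ no non-zero $\alpha$ pairs to zero with every $\beta$ and no non-zero $\beta$ pairs to zero with every $\alpha$. **Lemma 2.19.** Let $C$ be a Vect-linear semi-strict spherical 2-category over $\mathbf F$, and for $f,g\colon A\to B$ put $$\mathrm{2Hom}_J(f,g)=\{\alpha\in\mathrm{2Hom}_C(f,g)\mid\langle\alpha,\beta\rangle=0\ \text{ for all }\beta\in\mathrm{2Hom}_C(g,f)\}.$$ Then there is a Vect-linear semi-strict spherical 2-category $C/J$ with the same objects and 1-morphisms as $C$, and the same operations on them, whose 2-morphisms $f\Rightarrow g$ are the classes of elements of $\mathrm{2Hom}_C(f,g)$, two of them being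 identified exactly when their difference lies in $\mathrm{2Hom}_J(f,g)$, and in which all operations on 2-morphisms (compositions, tensor products, duals, vector space structure) and all structural 2-morphisms ($\otimes_{f,g}$, $i_f$, $e_f$, $T_A$, $\phi_f$, $\sigma_f$) are induced by those of $C$; and $C/J$ is non-degenerate. Moreover, if $\mathrm{End}_C(I)$ is $\mathbf F$-linearly equivalent to $\mathrm{Vect}$ and $\mathrm{2End}_C(1_I)=\mathbf F\cdot 1_{1_I}\cong\mathbf F$, then the same holds for $C/J$. -/

import Mathlib

/-!  Semi-strict spherical 2-categories, single-sorted: objects, 1-morphisms and 2-morphisms form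
three types, with source and target maps, and strictness is plain equality. Partial operations are
total functions about which nothing is said outside their domain of definition: every axiom on a
composite carries the hypothesis that it is composable. Composites are in diagrammatic order. -/

universe u u₁ u₂ u₃

/-- A strict 2-category with objects `O`, 1-morphisms `M` and 2-morphisms `N`.
`comp` composes 1-morphisms, `vcomp` is the vertical and `hcomp` the horizontal composition. -/
structure Strict2Cat (O : Type u₁) (M : Type u₂) (N : Type u₃) where
  dom : M → O
  cod : M → O
  src : N → M
  tgt : N → M
  id₁ : O → M
  comp : M → M → M
  id₂ : M → N
  vcomp : N → N → N
  hcomp : N → N → N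
  dom_tgt : ∀ α, dom (tgt α) = dom (src α)
  cod_tgt : ∀ α, cod (tgt α) = cod (src α)
  dom_id₁ : ∀ A, dom (id₁ A) = A
  cod_id₁ : ∀ A, cod (id₁ A) = A
  dom_comp : ∀ f g, cod f = dom g → dom (comp f g) = dom f
  cod_comp : ∀ f g, cod f = dom g → cod (comp f g) = cod g
  id₁_comp : ∀ f, comp (id₁ (dom f)) f = f
  comp_id₁ : ∀ f, comp f (id₁ (cod f)) = f
  comp_assoc : ∀ f g h, cod f = dom g → cod g = dom h →
    comp (comp f g) h = comp f (comp g h)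
  src_id₂ : ∀ f, src (id₂ f) = f
  tgt_id₂ : ∀ f, tgt (id₂ f) = f
  src_vcomp : ∀ α β, tgt α = src β → src (vcomp α β) = src α
  tgt_vcomp : ∀ α β, tgt α = src β → tgt (vcomp α β) = tgt β
  id₂_vcomp : ∀ α, vcomp (id₂ (src α)) α = α
  vcomp_id₂ : ∀ α, vcomp α (id₂ (tgt α)) = α
  vcomp_assoc : ∀ α β γ, tgt α = src β → tgt β = src γ →
    vcomp (vcomp α β) γ = vcomp α (vcomp β γ)
  src_hcomp : ∀ α β, cod (src α) = dom (src β) → src (hcomp α β) = comp (src α) (src β)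
  tgt_hcomp : ∀ α β, cod (src α) = dom (src β) → tgt (hcomp α β) = comp (tgt α) (tgt β)
  id₁_hcomp : ∀ α, hcomp (id₂ (id₁ (dom (src α)))) α = α
  hcomp_id₁ : ∀ α, hcomp α (id₂ (id₁ (cod (src α)))) = α
  hcomp_assoc : ∀ α β γ, cod (src α) = dom (src β) → cod (src β) = dom (src γ) →
    hcomp (hcomp α β) γ = hcomp α (hcomp β γ)
  hcomp_id₂ : ∀ f g, cod f = dom g → hcomp (id₂ f) (id₂ g) = id₂ (comp f g)
  interchange : ∀ α α' β β', tgt α = src α' → tgt β = src β' → cod (src α) = dom (src β) →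
    hcomp (vcomp α α') (vcomp β β') = vcomp (hcomp α β) (hcomp α' β')

/-- A semi-strict monoidal 2-category. `lt₁ A f` is `A ⊗ f`, `rt₁ f A` is `f ⊗ A`, and `lt₂`, `rt₂`
are the same for 2-morphisms. For `f : A → C` and `g : B → D` the tensorator is the 2-isomorphism
`ten f g : (f ⊗ B)(C ⊗ g) ⇒ (A ⊗ g)(f ⊗ D)`, with inverse `tenInv f g`. -/
structure SemistrictMonoidal (O : Type u₁) (M : Type u₂) (N : Type u₃)
    extends Strict2Cat O M N where
  I : O
  tensor : O → O → O
  lt₁ : O → M → M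
  rt₁ : M → O → M
  lt₂ : O → N → N
  rt₂ : N → O → N
  ten : M → M → N
  tenInv : M → M → N
  -- `A ⊗ -` and `- ⊗ A` are strict 2-functors
  dom_lt₁ : ∀ A f, dom (lt₁ A f) = tensor A (dom f)
  cod_lt₁ : ∀ A f, cod (lt₁ A f) = tensor A (cod f)
  dom_rt₁ : ∀ f A, dom (rt₁ f A) = tensor (dom f) A
  cod_rt₁ : ∀ f A, cod (rt₁ f A) = tensor (cod f) A
  src_lt₂ : ∀ A α, src (lt₂ A α) = lt₁ A (src α)
  tgt_lt₂ : ∀ A α, tgt (lt₂ A α) = lt₁ A (tgt α)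
  src_rt₂ : ∀ α A, src (rt₂ α A) = rt₁ (src α) A
  tgt_rt₂ : ∀ α A, tgt (rt₂ α A) = rt₁ (tgt α) A
  lt₁_id₁ : ∀ A B, lt₁ A (id₁ B) = id₁ (tensor A B)
  rt₁_id₁ : ∀ A B, rt₁ (id₁ A) B = id₁ (tensor A B)
  lt₁_comp : ∀ A f g, cod f = dom g → lt₁ A (comp f g) = comp (lt₁ A f) (lt₁ A g)
  rt₁_comp : ∀ f g A, cod f = dom g → rt₁ (comp f g) A = comp (rt₁ f A) (rt₁ g A)
  lt₂_id₂ : ∀ A f, lt₂ A (id₂ f) = id₂ (lt₁ A f)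
  rt₂_id₂ : ∀ f A, rt₂ (id₂ f) A = id₂ (rt₁ f A)
  lt₂_vcomp : ∀ A α β, tgt α = src β → lt₂ A (vcomp α β) = vcomp (lt₂ A α) (lt₂ A β)
  rt₂_vcomp : ∀ α β A, tgt α = src β → rt₂ (vcomp α β) A = vcomp (rt₂ α A) (rt₂ β A)
  lt₂_hcomp : ∀ A α β, cod (src α) = dom (src β) →
    lt₂ A (hcomp α β) = hcomp (lt₂ A α) (lt₂ A β)
  rt₂_hcomp : ∀ α β A, cod (src α) = dom (src β) →
    rt₂ (hcomp α β) A = hcomp (rt₂ α A) (rt₂ β A)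
  -- `I` is a strict unit
  I_tensor : ∀ A, tensor I A = A
  tensor_I : ∀ A, tensor A I = A
  I_lt₁ : ∀ f, lt₁ I f = f
  rt₁_I : ∀ f, rt₁ f I = f
  I_lt₂ : ∀ α, lt₂ I α = α
  rt₂_I : ∀ α, rt₂ α I = α
  -- strict associativity
  tensor_assoc : ∀ A B C, tensor (tensor A B) C = tensor A (tensor B C)
  lt₁_lt₁ : ∀ A B f, lt₁ A (lt₁ B f) = lt₁ (tensor A B) f
  lt₁_rt₁ : ∀ A f B, lt₁ A (rt₁ f B) = rt₁ (lt₁ A f) B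
  rt₁_rt₁ : ∀ f A B, rt₁ (rt₁ f A) B = rt₁ f (tensor A B)
  lt₂_lt₂ : ∀ A B α, lt₂ A (lt₂ B α) = lt₂ (tensor A B) α
  lt₂_rt₂ : ∀ A α B, lt₂ A (rt₂ α B) = rt₂ (lt₂ A α) B
  rt₂_rt₂ : ∀ α A B, rt₂ (rt₂ α A) B = rt₂ α (tensor A B)
  -- the tensorator is a 2-isomorphism
  src_ten : ∀ f g, src (ten f g) = comp (rt₁ f (dom g)) (lt₁ (cod f) g)
  tgt_ten : ∀ f g, tgt (ten f g) = comp (lt₁ (dom f) g) (rt₁ f (cod g))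
  src_tenInv : ∀ f g, src (tenInv f g) = comp (lt₁ (dom f) g) (rt₁ f (cod g))
  tgt_tenInv : ∀ f g, tgt (tenInv f g) = comp (rt₁ f (dom g)) (lt₁ (cod f) g)
  ten_tenInv : ∀ f g, vcomp (ten f g) (tenInv f g) = id₂ (src (ten f g))
  tenInv_ten : ∀ f g, vcomp (tenInv f g) (ten f g) = id₂ (tgt (ten f g))
  -- compatibility with the tensor product
  ten_lt₁_left : ∀ A g h, ten (lt₁ A g) h = lt₂ A (ten g h)
  ten_rt₁_left : ∀ f B h, ten (rt₁ f B) h = ten f (lt₁ B h)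
  ten_rt₁_right : ∀ f g C, ten f (rt₁ g C) = rt₂ (ten f g) C
  -- compatibility with identities and composition
  ten_id₁_left : ∀ A g, ten (id₁ A) g = id₂ (lt₁ A g)
  ten_id₁_right : ∀ f B, ten f (id₁ B) = id₂ (rt₁ f B)
  ten_comp_left : ∀ f f' g, cod f = dom f' →
    ten (comp f f') g =
      vcomp (hcomp (id₂ (rt₁ f (dom g))) (ten f' g)) (hcomp (ten f g) (id₂ (rt₁ f' (cod g))))
  ten_comp_right : ∀ f g g', cod g = dom g' →
    ten f (comp g g') =
      vcomp (hcomp (ten f g) (id₂ (lt₁ (cod f) g'))) (hcomp (id₂ (lt₁ (dom f) g)) (ten f g'))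
  -- naturality
  ten_natural_left : ∀ α g,
    vcomp (hcomp (rt₂ α (dom g)) (id₂ (lt₁ (cod (src α)) g))) (ten (tgt α) g) =
      vcomp (ten (src α) g) (hcomp (id₂ (lt₁ (dom (src α)) g)) (rt₂ α (cod g)))
  ten_natural_right : ∀ f β,
    vcomp (hcomp (id₂ (rt₁ f (dom (src β)))) (lt₂ (cod f) β)) (ten f (tgt β)) =
      vcomp (ten f (src β)) (hcomp (lt₂ (dom f) β) (id₂ (rt₁ f (cod (src β)))))

/-- The operations of a semi-strict monoidal 2-category with duals, with their sources and targets.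
`η f : 1_A ⇒ f f*` and `ε f : f* f ⇒ 1_B` are the unit and counit of a 1-morphism `f : A → B`;
`i A : I → A ⊗ A*` and `e A : A* ⊗ A → I` are those of an object, and
`T A : (i_A ⊗ A)(A ⊗ e_A) ⇒ 1_A` is the triangulator. -/
structure DualityData (O : Type u₁) (M : Type u₂) (N : Type u₃)
    extends SemistrictMonoidal O M N where
  star₀ : O → O
  star₁ : M → M
  star₂ : N → N
  η : M → N
  ε : M → N
  i : O → M
  e : O → M
  T : O → N
  dom_star₁ : ∀ f, dom (star₁ f) = cod f
  cod_star₁ : ∀ f, cod (star₁ f) = dom f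
  src_star₂ : ∀ α, src (star₂ α) = tgt α
  tgt_star₂ : ∀ α, tgt (star₂ α) = src α
  src_η : ∀ f, src (η f) = id₁ (dom f)
  tgt_η : ∀ f, tgt (η f) = comp f (star₁ f)
  src_ε : ∀ f, src (ε f) = comp (star₁ f) f
  tgt_ε : ∀ f, tgt (ε f) = id₁ (cod f)
  dom_i : ∀ A, dom (i A) = I
  cod_i : ∀ A, cod (i A) = tensor A (star₀ A)
  dom_e : ∀ A, dom (e A) = tensor (star₀ A) A
  cod_e : ∀ A, cod (e A) = I
  src_T : ∀ A, src (T A) = comp (rt₁ (i A) A) (lt₁ A (e A))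
  tgt_T : ∀ A, tgt (T A) = id₁ A

namespace DualityData

section

variable {O : Type u₁} {M : Type u₂} {N : Type u₃} (C : DualityData O M N)

local infixr:75 " ⨟ " => C.comp
local infixr:75 " ⊚ " => C.hcomp
local infixr:65 " ∙ " => C.vcomp
local infixr:80 " ⊠ " => C.tensor
local infixr:85 " ◁ " => C.lt₁
local infixl:85 " ▷ " => C.rt₁
local infixr:85 " ◀ " => C.lt₂
local infixl:85 " ▶ " => C.rt₂
local notation:max A:max "⋆₀" => C.star₀ A
local notation:max f:max "⋆₁" => C.star₁ f
local notation:max α:max "⋆₂" => C.star₂ α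
local notation:max "𝟏" f:max => C.id₂ f

/-- A 2-morphism is unitary if it is invertible with inverse its dual. -/
def IsUnitary (α : N) : Prop :=
  α ∙ α⋆₂ = 𝟏(C.src α) ∧ α⋆₂ ∙ α = 𝟏(C.tgt α)

/-- The adjoint `α† : g* ⇒ f*` of `α : f ⇒ g`. -/
def dagger (α : N) : N :=
  (𝟏((C.tgt α)⋆₁) ⊚ C.η (C.src α)) ∙
    (𝟏((C.tgt α)⋆₁) ⊚ α ⊚ 𝟏((C.src α)⋆₁)) ∙
    (C.ε (C.tgt α) ⊚ 𝟏((C.src α)⋆₁))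

/-- The other adjoint `†α : g* ⇒ f*` of `α : f ⇒ g`. -/
def ldagger (α : N) : N :=
  (C.η ((C.src α)⋆₁) ⊚ 𝟏((C.tgt α)⋆₁)) ∙
    (𝟏((C.src α)⋆₁) ⊚ α ⊚ 𝟏((C.tgt α)⋆₁)) ∙
    (𝟏((C.src α)⋆₁) ⊚ C.ε ((C.tgt α)⋆₁))

/-- The conditions on duals. In `tensor_T` and `i_T` the orientation of the tensorator is the one
for which the composites exist. -/
structure IsDuality : Prop where
  star₀_star₀ : ∀ A, A⋆₀⋆₀ = A
  star₁_star₁ : ∀ f, f⋆₁⋆₁ = f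
  star₂_star₂ : ∀ α, α⋆₂⋆₂ = α
  star₁_id₁ : ∀ A, (C.id₁ A)⋆₁ = C.id₁ A
  star₂_id₂ : ∀ f, (𝟏 f)⋆₂ = 𝟏 f
  star₂_vcomp : ∀ α β, C.tgt α = C.src β → (α ∙ β)⋆₂ = β⋆₂ ∙ α⋆₂
  star₂_hcomp : ∀ α β, C.cod (C.src α) = C.dom (C.src β) → (α ⊚ β)⋆₂ = α⋆₂ ⊚ β⋆₂
  star₁_comp : ∀ f g, C.cod f = C.dom g → (f ⨟ g)⋆₁ = g⋆₁ ⨟ f⋆₁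
  star₂_lt₂ : ∀ A α, (A ◀ α)⋆₂ = A ◀ α⋆₂
  star₁_lt₁ : ∀ A f, (A ◁ f)⋆₁ = A ◁ f⋆₁
  star₂_rt₂ : ∀ α A, (α ▶ A)⋆₂ = α⋆₂ ▶ A
  star₁_rt₁ : ∀ f A, (f ▷ A)⋆₁ = f⋆₁ ▷ A
  star₀_tensor : ∀ A B, (A ⊠ B)⋆₀ = B⋆₀ ⊠ A⋆₀
  ten_unitary : ∀ f g, C.IsUnitary (C.ten f g)
  i_star₀ : ∀ A, C.i A⋆₀ = (C.e A)⋆₁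
  e_star₀ : ∀ A, C.e A⋆₀ = (C.i A)⋆₁
  η_star₁ : ∀ f, C.η f⋆₁ = (C.ε f)⋆₂
  ε_star₁ : ∀ f, C.ε f⋆₁ = (C.η f)⋆₂
  T_unitary : ∀ A, C.IsUnitary (C.T A)
  tensor_i : ∀ A B, C.i (A ⊠ B) = C.i A ⨟ ((A ◁ C.i B) ▷ A⋆₀)
  tensor_e : ∀ A B, C.e (A ⊠ B) = ((B⋆₀ ◁ C.e A) ▷ B) ⨟ C.e B
  tensor_T : ∀ A B, C.T (A ⊠ B) =
    (𝟏(C.i A ▷ (A ⊠ B)) ⊚ ((A ◀ C.ten (C.i B) (C.e A)) ▶ B) ⊚ 𝟏((A ⊠ B) ◁ C.e B)) ∙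
      ((C.T A ▶ B) ⊚ (A ◀ C.T B))
  T_I : C.T C.I = 𝟏(C.id₁ C.I)
  η_lt₁ : ∀ A f, C.η (A ◁ f) = A ◀ C.η f
  η_rt₁ : ∀ f A, C.η (f ▷ A) = C.η f ▶ A
  ε_lt₁ : ∀ A f, C.ε (A ◁ f) = A ◀ C.ε f
  ε_rt₁ : ∀ f A, C.ε (f ▷ A) = C.ε f ▶ A
  η_comp : ∀ f g, C.cod f = C.dom g →
    C.η (f ⨟ g) = C.η f ∙ (𝟏 f ⊚ C.η g ⊚ 𝟏(f⋆₁))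
  ε_comp : ∀ f g, C.cod f = C.dom g →
    C.ε (f ⨟ g) = (𝟏(g⋆₁) ⊚ C.ε f ⊚ 𝟏 g) ∙ C.ε g
  triangle : ∀ f, (C.η f ⊚ 𝟏 f) ∙ (𝟏 f ⊚ C.ε f) = 𝟏 f
  triangle_star : ∀ f, (𝟏(f⋆₁) ⊚ C.η f) ∙ (C.ε f ⊚ 𝟏(f⋆₁)) = 𝟏(f⋆₁)
  dagger_star : ∀ α, (C.dagger α)⋆₂ = C.dagger (α⋆₂)
  i_T : ∀ A,
    (𝟏(C.i A) ⊚ (A ◀ C.dagger (C.T A⋆₀))) ∙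
      (C.ten (C.i A) (C.i A) ⊚ 𝟏((A ◁ C.e A) ▷ A⋆₀)) ∙
      (𝟏(C.i A) ⊚ (C.T A ▶ A⋆₀)) = 𝟏(C.i A)

/-- `#f : B* → A*` for `f : A → B`. -/
def lsharp₁ (f : M) : M :=
  (C.i (C.dom f)⋆₀ ▷ (C.cod f)⋆₀) ⨟ (((C.dom f)⋆₀ ◁ f) ▷ (C.cod f)⋆₀) ⨟
    ((C.dom f)⋆₀ ◁ C.e (C.cod f)⋆₀)

/-- `f# : B* → A*` for `f : A → B`. -/
def rsharp₁ (f : M) : M :=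
  ((C.cod f)⋆₀ ◁ C.i (C.dom f)) ⨟ (((C.cod f)⋆₀ ◁ f) ▷ (C.dom f)⋆₀) ⨟
    (C.e (C.cod f) ▷ (C.dom f)⋆₀)

/-- `#α : #f ⇒ #g` for `α : f ⇒ g` and `f, g : A → B`. -/
def lsharp₂ (α : N) : N :=
  let A := C.dom (C.src α)
  let B := C.cod (C.src α)
  𝟏(C.i A⋆₀ ▷ B⋆₀) ⊚ ((A⋆₀ ◀ α) ▶ B⋆₀) ⊚ 𝟏(A⋆₀ ◁ C.e B⋆₀)

/-- `α# : f# ⇒ g#` for `α : f ⇒ g` and `f, g : A → B`. -/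
def rsharp₂ (α : N) : N :=
  let A := C.dom (C.src α)
  let B := C.cod (C.src α)
  𝟏(B⋆₀ ◁ C.i A) ⊚ ((B⋆₀ ◀ α) ▶ A⋆₀) ⊚ 𝟏(C.e B ▷ A⋆₀)

/-- The 2-isomorphism `#(fg) ⇒ #g #f` for `f : A → B` and `g : B → Z`. -/
def lsharpComp (f g : M) : N :=
  let A := C.dom f
  let B := C.cod f
  let Z := C.cod g
  (𝟏((C.i A⋆₀ ▷ Z⋆₀) ⨟ ((A⋆₀ ◁ f) ▷ Z⋆₀)) ⊚ ((A⋆₀ ◀ C.dagger (C.T B)) ▶ Z⋆₀) ⊚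
      𝟏(((A⋆₀ ◁ g) ▷ Z⋆₀) ⨟ (A⋆₀ ◁ C.e Z⋆₀))) ∙
    (𝟏((C.i A⋆₀ ▷ Z⋆₀) ⨟ ((A⋆₀ ◁ f) ▷ Z⋆₀) ⨟ (((A⋆₀ ⊠ B) ◁ C.i B⋆₀) ▷ Z⋆₀)) ⊚
      ((A⋆₀ ◀ C.ten (C.e B⋆₀) g) ▶ Z⋆₀) ⊚ 𝟏(A⋆₀ ◁ C.e Z⋆₀)) ∙
    (C.ten (C.i A⋆₀ ⨟ (A⋆₀ ◁ f)) ((C.i B⋆₀ ▷ Z⋆₀) ⨟ ((B⋆₀ ◁ g) ▷ Z⋆₀)) ⊚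
      𝟏(((A⋆₀ ◁ C.e B⋆₀) ▷ (Z ⊠ Z⋆₀)) ⨟ (A⋆₀ ◁ C.e Z⋆₀))) ∙
    (𝟏((C.i B⋆₀ ▷ Z⋆₀) ⨟ ((B⋆₀ ◁ g) ▷ Z⋆₀)) ⊚ C.ten (C.lsharp₁ f) (C.e Z⋆₀))

/-- The 2-isomorphism `(fg)# ⇒ g# f#` for `f : A → B` and `g : B → Z`. -/
def rsharpComp (f g : M) : N :=
  let A := C.dom f
  let B := C.cod f
  let Z := C.cod g
  (𝟏((Z⋆₀ ◁ C.i A) ⨟ ((Z⋆₀ ◁ f) ▷ A⋆₀)) ⊚ ((Z⋆₀ ◀ (C.T B)⋆₂) ▶ A⋆₀) ⊚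
      𝟏(((Z⋆₀ ◁ g) ▷ A⋆₀) ⨟ (C.e Z ▷ A⋆₀))) ∙
    (𝟏((Z⋆₀ ◁ C.i A) ⨟ ((Z⋆₀ ◁ f) ▷ A⋆₀) ⨟ ((Z⋆₀ ◁ C.i B) ▷ (B ⊠ A⋆₀))) ⊚
      ((Z⋆₀ ◀ C.tenInv g (C.e B)) ▶ A⋆₀) ⊚ 𝟏(C.e Z ▷ A⋆₀)) ∙
    (C.tenInv ((Z⋆₀ ◁ C.i B) ⨟ ((Z⋆₀ ◁ g) ▷ B⋆₀)) (C.i A ⨟ (f ▷ A⋆₀)) ⊚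
      𝟏((((Z⋆₀ ⊠ Z) ◁ C.e B) ▷ A⋆₀) ⨟ (C.e Z ▷ A⋆₀))) ∙
    (𝟏((Z⋆₀ ◁ C.i B) ⨟ ((Z⋆₀ ◁ g) ▷ B⋆₀)) ⊚ C.tenInv (C.e Z) (C.rsharp₁ f))

/-- The left trace of an endomorphism `f : A → A`. -/
def ltr₁ (f : M) : M :=
  C.i (C.dom f)⋆₀ ⨟ ((C.dom f)⋆₀ ◁ f) ⨟ C.e (C.dom f)

/-- The right trace of an endomorphism `f : A → A`. -/
def rtr₁ (f : M) : M :=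
  C.i (C.dom f) ⨟ (f ▷ (C.dom f)⋆₀) ⨟ C.e (C.dom f)⋆₀

/-- The left trace of a 2-morphism between endomorphisms of `A`. -/
def ltr₂ (α : N) : N :=
  let A := C.dom (C.src α)
  𝟏(C.i A⋆₀) ⊚ (A⋆₀ ◀ α) ⊚ 𝟏(C.e A)

/-- The right trace of a 2-morphism between endomorphisms of `A`. -/
def rtr₂ (α : N) : N :=
  let A := C.dom (C.src α)
  𝟏(C.i A) ⊚ (α ▶ A⋆₀) ⊚ 𝟏(C.e A⋆₀)

/-- The right cap `1_I ⇒ Tr_R(f f*)`. -/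
def capR (f : M) : N := C.η (C.i (C.dom f) ⨟ (f ▷ (C.dom f)⋆₀))

/-- The right cup `Tr_R(f f*) ⇒ 1_I`. -/
def cupR (f : M) : N := (C.capR f)⋆₂

/-- The left cap `1_I ⇒ Tr_L(f f*)`. -/
def capL (f : M) : N := C.η (C.i (C.dom f)⋆₀ ⨟ ((C.dom f)⋆₀ ◁ f))

/-- The left cup `Tr_L(f f*) ⇒ 1_I`. -/
def cupL (f : M) : N := (C.capL f)⋆₂

/-- The pairing `⟨α, β⟩ : 1_I ⇒ 1_I` of `α : f ⇒ g` and `β : g ⇒ f`. -/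
def pair (α β : N) : N :=
  C.capR (C.src α) ∙ C.rtr₂ ((α ∙ β) ⊚ 𝟏((C.src α)⋆₁)) ∙ C.cupR (C.src α)

/-- The 2-morphism `Tr_R(fg) ⇒ Tr_R(gf)` determined by a family `φ_f : #f ⇒ f#`,
for `f : A → B` and `g : B → A`. -/
def thetaR (φ : M → N) (f g : M) : N :=
  let A := C.dom f
  let B := C.cod f
  let P := C.i A ⨟ (f ▷ A⋆₀)
  let Q := C.i B ⨟ (g ▷ B⋆₀)
  let R := (g ▷ A⋆₀) ⨟ C.e A⋆₀
  (𝟏 P ⊚ (C.dagger (C.T B) ▶ A⋆₀) ⊚ 𝟏 R) ∙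
    (𝟏(P ⨟ ((B ◁ C.i B⋆₀) ▷ A⋆₀)) ⊚ C.ten (C.e B⋆₀) R) ∙
    (𝟏 P ⊚ (B ◀ φ g) ⊚ 𝟏(C.e B⋆₀)) ∙
    (C.ten P Q ⊚ 𝟏(((B ◁ C.e A) ▷ B⋆₀) ⨟ C.e B⋆₀)) ∙
    (𝟏(Q ⨟ (C.i A ▷ (A ⊠ B⋆₀))) ⊚ (C.ten f (C.e A) ▶ B⋆₀) ⊚ 𝟏(C.e B⋆₀)) ∙
    (𝟏 Q ⊚ (C.T A ▶ B⋆₀) ⊚ 𝟏((f ▷ B⋆₀) ⨟ C.e B⋆₀))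

/-- The 2-morphism `Tr_L(fg) ⇒ Tr_L(gf)` for `f : A → B` and `g : B → A`: the mirror image (for
the reversed tensor product) of `thetaR`. All 2-morphisms that occur are unitary, so that `⋆₂`
stands for the inverse. -/
def thetaL (φ : M → N) (f g : M) : N :=
  let A := C.dom f
  let B := C.cod f
  let P := C.i A⋆₀ ⨟ (A⋆₀ ◁ f)
  let Q := C.i B⋆₀ ⨟ (B⋆₀ ◁ g)
  let R := (A⋆₀ ◁ g) ⨟ C.e A
  (𝟏 P ⊚ (A⋆₀ ◀ (C.T B)⋆₂) ⊚ 𝟏 R) ∙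
    (𝟏(P ⨟ (A⋆₀ ◁ (C.i B ▷ B))) ⊚ C.tenInv R (C.e B)) ∙
    (𝟏 P ⊚ ((φ g)⋆₂ ▶ B) ⊚ 𝟏(C.e B)) ∙
    (C.tenInv Q P ⊚ 𝟏((B⋆₀ ◁ (C.e A⋆₀ ▷ B)) ⨟ C.e B)) ∙
    (𝟏(Q ⨟ ((B⋆₀ ⊠ A) ◁ C.i A⋆₀)) ⊚ (B⋆₀ ◀ C.tenInv (C.e A⋆₀) f) ⊚ 𝟏(C.e B)) ∙
    (𝟏 Q ⊚ (B⋆₀ ◀ (C.dagger (C.T A))⋆₂) ⊚ 𝟏((B⋆₀ ◁ f) ⨟ C.e B))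

/-- `φ` is a pivotal structure: unitary 2-morphisms `φ_f : #f ⇒ f#` with the four conditions. -/
structure IsPivotal (φ : M → N) : Prop where
  src_φ : ∀ f, C.src (φ f) = C.lsharp₁ f
  tgt_φ : ∀ f, C.tgt (φ f) = C.rsharp₁ f
  φ_unitary : ∀ f, C.IsUnitary (φ f)
  φ_natural : ∀ α, C.lsharp₂ α ∙ φ (C.tgt α) = φ (C.src α) ∙ C.rsharp₂ α
  φ_dagger : ∀ f, C.dagger (φ f) = φ (f⋆₁)
  φ_comp : ∀ f g, C.cod f = C.dom g →
    φ (f ⨟ g) ∙ C.rsharpComp f g = C.lsharpComp f g ∙ (φ g ⊚ φ f)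
  lsharp_dagger : ∀ α, C.lsharp₂ (C.dagger α) = C.ldagger (C.rsharp₂ α)
  dagger_lsharp : ∀ α, C.dagger (C.lsharp₂ α) = C.rsharp₂ (C.ldagger α)

/-- A pivotal structure is consistent if caps and cups are compatible with `θ`. -/
structure IsConsistent (φ : M → N) : Prop where
  capR_theta : ∀ f, C.capR f ∙ C.thetaR φ f (f⋆₁) = C.capR (f⋆₁)
  theta_cupR : ∀ f, C.thetaR φ f (f⋆₁) ∙ C.cupR (f⋆₁) = C.cupR f
  capL_theta : ∀ f, C.capL f ∙ C.thetaL φ f (f⋆₁) = C.capL (f⋆₁)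
  theta_cupL : ∀ f, C.thetaL φ f (f⋆₁) ∙ C.cupL (f⋆₁) = C.cupL f

/-- `σ` is a spherical structure: unitary natural 2-morphisms `σ_f : Tr_L(f) ⇒ Tr_R(f)`, one for
each endomorphism `f` of an object, compatible with caps and cups. -/
structure IsSpherical (σ : M → N) : Prop where
  src_σ : ∀ f, C.dom f = C.cod f → C.src (σ f) = C.ltr₁ f
  tgt_σ : ∀ f, C.dom f = C.cod f → C.tgt (σ f) = C.rtr₁ f
  σ_unitary : ∀ f, C.dom f = C.cod f → C.IsUnitary (σ f)
  σ_natural : ∀ α, C.dom (C.src α) = C.cod (C.src α) →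
    σ (C.src α) ∙ C.rtr₂ α = C.ltr₂ α ∙ σ (C.tgt α)
  capL_σ : ∀ A, C.capL (C.id₁ A) ∙ σ (C.id₁ A) = C.capR (C.id₁ A)
  σ_cupR : ∀ A, σ (C.id₁ A) ∙ C.cupR (C.id₁ A) = C.cupL (C.id₁ A)

end

end DualityData

/-- A semi-strict spherical 2-category: a semi-strict monoidal 2-category with duals, a consistent
pivotal structure and a spherical structure. -/
structure SemistrictSpherical (O : Type u₁) (M : Type u₂) (N : Type u₃)
    extends DualityData O M N where
  isDuality : toDualityData.IsDuality
  φ : M → N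
  isPivotal : toDualityData.IsPivotal φ
  isConsistent : toDualityData.IsConsistent φ
  σ : M → N
  isSpherical : toDualityData.IsSpherical σ

namespace Strict2Cat

variable {O : Type u₁} {M : Type u₂} {N : Type u₃}

/-- Two 2-morphisms are parallel. -/
def Par (C : Strict2Cat O M N) (α β : N) : Prop := C.src α = C.src β ∧ C.tgt α = C.tgt β

/-- The 1-morphisms from `A` to `B`. -/
def Hom (C : Strict2Cat O M N) (A B : O) : Type u₂ := {f : M // C.dom f = A ∧ C.cod f = B}

/-- The category `Hom(A, B)`: 2-morphisms under vertical composition. -/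
instance homCategory (C : Strict2Cat O M N) (A B : O) : CategoryTheory.Category (C.Hom A B) where
  Hom f g := {α : N // C.src α = f.1 ∧ C.tgt α = g.1}
  id f := ⟨C.id₂ f.1, C.src_id₂ _, C.tgt_id₂ _⟩
  comp α β := ⟨C.vcomp α.1 β.1,
    (C.src_vcomp _ _ (α.2.2.trans β.2.1.symm)).trans α.2.1,
    (C.tgt_vcomp _ _ (α.2.2.trans β.2.1.symm)).trans β.2.2⟩
  id_comp {f g} α := by
    apply Subtype.ext
    have h := C.id₂_vcomp α.1
    rwa [α.2.1] at h
  comp_id {f g} α := by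
    apply Subtype.ext
    have h := C.vcomp_id₂ α.1
    rwa [α.2.2] at h
  assoc α β γ := Subtype.ext
    (C.vcomp_assoc _ _ _ (α.2.2.trans β.2.1.symm) (β.2.2.trans γ.2.1.symm))

end Strict2Cat

/-- An `F`-linear structure on a semi-strict monoidal 2-category: each `2Hom(f, g)`, for `f` and `g`
with the same source and target, is an `F`-vector space, and all compositions and the tensor
product are (bi)linear. -/
structure LinearStructure (F : Type u) [Field F] {O : Type u₁} {M : Type u₂} {N : Type u₃}
    (C : SemistrictMonoidal O M N) where
  zero : M → M → N
  add : N → N → N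
  neg : N → N
  smul : F → N → N
  src_zero : ∀ f g, C.dom f = C.dom g → C.cod f = C.cod g → C.src (zero f g) = f
  tgt_zero : ∀ f g, C.dom f = C.dom g → C.cod f = C.cod g → C.tgt (zero f g) = g
  src_add : ∀ α β, C.Par α β → C.src (add α β) = C.src α
  tgt_add : ∀ α β, C.Par α β → C.tgt (add α β) = C.tgt α
  src_neg : ∀ α, C.src (neg α) = C.src α
  tgt_neg : ∀ α, C.tgt (neg α) = C.tgt α
  src_smul : ∀ c α, C.src (smul c α) = C.src α
  tgt_smul : ∀ c α, C.tgt (smul c α) = C.tgt α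
  add_assoc : ∀ α β γ, C.Par α β → C.Par β γ → add (add α β) γ = add α (add β γ)
  add_comm : ∀ α β, C.Par α β → add α β = add β α
  zero_add : ∀ α, add (zero (C.src α) (C.tgt α)) α = α
  neg_add : ∀ α, add (neg α) α = zero (C.src α) (C.tgt α)
  one_smul : ∀ α, smul 1 α = α
  mul_smul : ∀ c d α, smul (c * d) α = smul c (smul d α)
  smul_add : ∀ c α β, C.Par α β → smul c (add α β) = add (smul c α) (smul c β)
  add_smul : ∀ c d α, smul (c + d) α = add (smul c α) (smul d α)
  add_vcomp : ∀ α α' β, C.Par α α' → C.tgt α = C.src β →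
    C.vcomp (add α α') β = add (C.vcomp α β) (C.vcomp α' β)
  vcomp_add : ∀ α β β', C.Par β β' → C.tgt α = C.src β →
    C.vcomp α (add β β') = add (C.vcomp α β) (C.vcomp α β')
  smul_vcomp : ∀ c α β, C.tgt α = C.src β → C.vcomp (smul c α) β = smul c (C.vcomp α β)
  vcomp_smul : ∀ c α β, C.tgt α = C.src β → C.vcomp α (smul c β) = smul c (C.vcomp α β)
  add_hcomp : ∀ α α' β, C.Par α α' → C.cod (C.src α) = C.dom (C.src β) →
    C.hcomp (add α α') β = add (C.hcomp α β) (C.hcomp α' β)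
  hcomp_add : ∀ α β β', C.Par β β' → C.cod (C.src α) = C.dom (C.src β) →
    C.hcomp α (add β β') = add (C.hcomp α β) (C.hcomp α β')
  smul_hcomp : ∀ c α β, C.cod (C.src α) = C.dom (C.src β) →
    C.hcomp (smul c α) β = smul c (C.hcomp α β)
  hcomp_smul : ∀ c α β, C.cod (C.src α) = C.dom (C.src β) →
    C.hcomp α (smul c β) = smul c (C.hcomp α β)
  lt₂_add : ∀ A α β, C.Par α β → C.lt₂ A (add α β) = add (C.lt₂ A α) (C.lt₂ A β)
  rt₂_add : ∀ α β A, C.Par α β → C.rt₂ (add α β) A = add (C.rt₂ α A) (C.rt₂ β A)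
  lt₂_smul : ∀ c A α, C.lt₂ A (smul c α) = smul c (C.lt₂ A α)
  rt₂_smul : ∀ c α A, C.rt₂ (smul c α) A = smul c (C.rt₂ α A)

namespace LinearStructure

open CategoryTheory

variable {F : Type u} [Field F] {O : Type u₁} {M : Type u₂} {N : Type u₃}
  {C : SemistrictMonoidal O M N} (L : LinearStructure F C)

/-- The abelian group `2Hom(f, g)`. -/
@[reducible] def homGroup {A B : O} (f g : C.Hom A B) : AddCommGroup (f ⟶ g) :=
  letI : Zero (f ⟶ g) := ⟨⟨L.zero f.1 g.1,
    L.src_zero _ _ (f.2.1.trans g.2.1.symm) (f.2.2.trans g.2.2.symm),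
    L.tgt_zero _ _ (f.2.1.trans g.2.1.symm) (f.2.2.trans g.2.2.symm)⟩⟩
  have par (α β : f ⟶ g) : C.Par α.1 β.1 :=
    ⟨α.2.1.trans β.2.1.symm, α.2.2.trans β.2.2.symm⟩
  letI : Add (f ⟶ g) := ⟨fun α β => ⟨L.add α.1 β.1,
    (L.src_add _ _ (par α β)).trans α.2.1, (L.tgt_add _ _ (par α β)).trans α.2.2⟩⟩
  letI : Neg (f ⟶ g) := ⟨fun α => ⟨L.neg α.1,
    (L.src_neg _).trans α.2.1, (L.tgt_neg _).trans α.2.2⟩⟩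
  have comm (α β : f ⟶ g) : α + β = β + α := Subtype.ext (L.add_comm _ _ (par α β))
  have zadd (α : f ⟶ g) : 0 + α = α := by
    apply Subtype.ext
    have h := L.zero_add α.1
    rwa [α.2.1, α.2.2] at h
  { add_assoc := fun α β γ => Subtype.ext (L.add_assoc _ _ _ (par α β) (par β γ))
    zero_add := zadd
    add_zero := fun α => (comm α 0).trans (zadd α)
    add_comm := comm
    nsmul := nsmulRec
    zsmul := zsmulRec
    neg_add_cancel := fun α => by
      apply Subtype.ext
      have h := L.neg_add α.1
      rwa [α.2.1, α.2.2] at h }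

/-- `Hom(A, B)` as a preadditive category. -/
@[reducible] def preadditive (A B : O) : Preadditive (C.Hom A B) where
  homGroup f g := L.homGroup f g
  add_comp _ _ _ α α' β := Subtype.ext (L.add_vcomp _ _ _
    ⟨α.2.1.trans α'.2.1.symm, α.2.2.trans α'.2.2.symm⟩ (α.2.2.trans β.2.1.symm))
  comp_add _ _ _ α β β' := Subtype.ext (L.vcomp_add _ _ _
    ⟨β.2.1.trans β'.2.1.symm, β.2.2.trans β'.2.2.symm⟩ (α.2.2.trans β.2.1.symm))

/-- `Hom(A, B)` as an `F`-linear category. -/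
@[reducible] def linear (A B : O) :
    letI := L.preadditive A B
    Linear F (C.Hom A B) :=
  letI := L.preadditive A B
  { homModule := fun f g =>
      letI : SMul F (f ⟶ g) := ⟨fun c α => ⟨L.smul c α.1,
        (L.src_smul _ _).trans α.2.1, (L.tgt_smul _ _).trans α.2.2⟩⟩
      Module.ofMinimalAxioms
        (fun c α β => Subtype.ext (L.smul_add c _ _
          ⟨α.2.1.trans β.2.1.symm, α.2.2.trans β.2.2.symm⟩))
        (fun c d _ => Subtype.ext (L.add_smul c d _))
        (fun c d _ => Subtype.ext (L.mul_smul c d _))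
        (fun _ => Subtype.ext (L.one_smul _))
    smul_comp := fun _ _ _ c α β => Subtype.ext (L.smul_vcomp c _ _ (α.2.2.trans β.2.1.symm))
    comp_smul := fun _ _ _ α c β => Subtype.ext (L.vcomp_smul c _ _ (α.2.2.trans β.2.1.symm)) }

end LinearStructure

section TwoVectorSpaces

open CategoryTheory

/-- An `F`-linear category is a 2-vector space of finite rank if for some `n` there is an `F`-linear
equivalence to the category `Vectⁿ` of `n`-tuples of finite-dimensional vector spaces. (Linearity of
a functor to `Vectⁿ` is linearity of its components.) -/
def IsTwoVectorSpace (F : Type u) [Field F] (D : Type u₁) [Category.{u₂} D] [Preadditive D]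
    [Linear F D] : Prop :=
  ∃ (n : ℕ) (E : D ≌ (Fin n → FGModuleCat.{u} F)), ∀ k : Fin n,
    (E.functor ⋙ Pi.eval (fun _ => FGModuleCat.{u} F) k).Additive ∧
      Functor.Linear F (E.functor ⋙ Pi.eval (fun _ => FGModuleCat.{u} F) k)

/-- An `F`-linear category is `F`-linearly equivalent to `Vect`. -/
def IsEquivVect (F : Type u) [Field F] (D : Type u₁) [Category.{u₂} D] [Preadditive D]
    [Linear F D] : Prop :=
  ∃ E : D ≌ FGModuleCat.{u} F, E.functor.Additive ∧ Functor.Linear F E.functor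

end TwoVectorSpaces

/-- A Vect-linear semi-strict spherical 2-category over `F`. -/
structure VectLinearSpherical (F : Type u) [Field F] (O : Type u₁) (M : Type u₂) (N : Type u₃)
    extends SemistrictSpherical O M N where
  lin : LinearStructure F toSemistrictMonoidal
  isTwoVectorSpace : ∀ A B : O,
    letI := lin.preadditive A B
    letI := lin.linear A B
    IsTwoVectorSpace F (toStrict2Cat.Hom A B)

namespace VectLinearSpherical

variable {F : Type u} [Field F] {O : Type u₁} {M : Type u₂} {N : Type u₃}

/-- `End(I)` is equivalent to `Vect`, and `2End(1_I)` is the field `F` (acting by scalars). -/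
def UnitIsVect (C : VectLinearSpherical F O M N) : Prop :=
  (letI := C.lin.preadditive C.I C.I
   letI := C.lin.linear C.I C.I
   IsEquivVect F (C.toStrict2Cat.Hom C.I C.I)) ∧
  ∀ α, C.src α = C.id₁ C.I → C.tgt α = C.id₁ C.I →
    ∃! c : F, α = C.lin.smul c (C.id₂ (C.id₁ C.I))

/-- `α : f ⇒ g` belongs to `J`: `⟨α, β⟩ = 0` for all `β : g ⇒ f`. -/
def InJ (C : VectLinearSpherical F O M N) (α : N) : Prop :=
  ∀ β, C.src β = C.tgt α → C.tgt β = C.src α →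
    C.pair α β = C.lin.zero (C.id₁ C.I) (C.id₁ C.I)

/-- Two parallel 2-morphisms are identified in `C/J` if their difference belongs to `J`. -/
def JRel (C : VectLinearSpherical F O M N) (α β : N) : Prop :=
  C.Par α β ∧ C.InJ (C.lin.add α (C.lin.neg β))

/-- The 2-morphisms of `C/J`. -/
def QuotCell (C : VectLinearSpherical F O M N) : Type u₃ := Quot C.JRel

/-- The class in `C/J` of a 2-morphism of `C`. -/
def proj (C : VectLinearSpherical F O M N) (α : N) : C.QuotCell := Quot.mk C.JRel α

/-- The pairing `2Hom(f, g) ⊗ 2Hom(g, f) → 2End(1_I)` is non-degenerate for all parallel `f`, `g`. -/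
structure IsNondegenerate (C : VectLinearSpherical F O M N) : Prop where
  left : ∀ α, (∀ β, C.src β = C.tgt α → C.tgt β = C.src α →
    C.pair α β = C.lin.zero (C.id₁ C.I) (C.id₁ C.I)) → α = C.lin.zero (C.src α) (C.tgt α)
  right : ∀ β, (∀ α, C.src α = C.tgt β → C.tgt α = C.src β →
    C.pair α β = C.lin.zero (C.id₁ C.I) (C.id₁ C.I)) → β = C.lin.zero (C.src β) (C.tgt β)

/-- `Q` is the quotient `C/J`: its objects and 1-morphisms with all their operations are those of
`C`, its 2-morphisms are the classes of the 2-morphisms of `C`, the kernel of the projection is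
exactly `J`, and all operations on 2-morphisms and all structural 2-morphisms are the images of
those of `C`. -/
structure IsQuotient (C : VectLinearSpherical F O M N)
    (Q : VectLinearSpherical F O M C.QuotCell) : Prop where
  dom_eq : Q.dom = C.dom
  cod_eq : Q.cod = C.cod
  id₁_eq : Q.id₁ = C.id₁
  comp_eq : Q.comp = C.comp
  I_eq : Q.I = C.I
  tensor_eq : Q.tensor = C.tensor
  lt₁_eq : Q.lt₁ = C.lt₁
  rt₁_eq : Q.rt₁ = C.rt₁
  star₀_eq : Q.star₀ = C.star₀
  star₁_eq : Q.star₁ = C.star₁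
  i_eq : Q.i = C.i
  e_eq : Q.e = C.e
  src_proj : ∀ α, Q.src (C.proj α) = C.src α
  tgt_proj : ∀ α, Q.tgt (C.proj α) = C.tgt α
  proj_eq_proj : ∀ α β, C.proj α = C.proj β ↔ C.JRel α β
  id₂_eq : ∀ f, Q.id₂ f = C.proj (C.id₂ f)
  vcomp_proj : ∀ α β, C.tgt α = C.src β →
    Q.vcomp (C.proj α) (C.proj β) = C.proj (C.vcomp α β)
  hcomp_proj : ∀ α β, C.cod (C.src α) = C.dom (C.src β) →
    Q.hcomp (C.proj α) (C.proj β) = C.proj (C.hcomp α β)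
  lt₂_proj : ∀ A α, Q.lt₂ A (C.proj α) = C.proj (C.lt₂ A α)
  rt₂_proj : ∀ α A, Q.rt₂ (C.proj α) A = C.proj (C.rt₂ α A)
  ten_eq : ∀ f g, Q.ten f g = C.proj (C.ten f g)
  tenInv_eq : ∀ f g, Q.tenInv f g = C.proj (C.tenInv f g)
  star₂_proj : ∀ α, Q.star₂ (C.proj α) = C.proj (C.star₂ α)
  η_eq : ∀ f, Q.η f = C.proj (C.η f)
  ε_eq : ∀ f, Q.ε f = C.proj (C.ε f)
  T_eq : ∀ A, Q.T A = C.proj (C.T A)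
  φ_eq : ∀ f, Q.φ f = C.proj (C.φ f)
  σ_eq : ∀ f, C.dom f = C.cod f → Q.σ f = C.proj (C.σ f)
  zero_eq : ∀ f g, C.dom f = C.dom g → C.cod f = C.cod g →
    Q.lin.zero f g = C.proj (C.lin.zero f g)
  add_proj : ∀ α β, C.Par α β →
    Q.lin.add (C.proj α) (C.proj β) = C.proj (C.lin.add α β)
  smul_proj : ∀ c α, Q.lin.smul c (C.proj α) = C.proj (C.lin.smul c α)

end VectLinearSpherical

-- The pairing is a trace, `⟨α, β⟩ = tr (α · β)`. By bilinearity two parallel 2-morphisms have the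
-- same class in `C/J` exactly when they pair equally with every test 2-morphism (`TrEquiv`,
-- `jRel_iff`). The main claim is that this relation is a congruence for all operations. In each
-- case the operation is moved off the given 2-morphism and onto the test 2-morphism:
--
-- Vertical composition on the right is associativity; on the left it is cyclicity of the trace
-- (`tr_vcomp_comm`), which holds because a 2-morphism slides over units and counits as its adjoint.
-- For duals, `⟨α, β⟩* = ⟨β*, α*⟩`. Whiskering on the right replaces the test 2-morphism by its
-- partial trace (`tr_hcomp_id₂`). Whiskering on the left is whiskering on the right conjugated by
-- `†`, so it is enough that `†` preserves the trace (`tr_dagger`); this is where consistency of the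
-- pivotal structure enters, through naturality of `θ` (`thetaR_natural`). For the tensor product
-- with an object `X`, the trace over `f ⊗ X` is a trace over `f ⊗ X ⊗ X*` whiskered by `A ⊗ i_X`,
-- and naturality of the tensorator turns `α ⊗ X ⊗ X*`, so whiskered, into a whiskering of `α`
-- itself. The tensor product on the other side is treated with the left trace, which equals the
-- right one by sphericity (`tr_eq_left`).
--
-- Given the congruence, every equation of `C` descends to classes. The categories `Hom(A, B)` of
-- `C/J` are images of those of `C` under linear functors that are full and the identity on objects.
-- A nonzero morphism of `Vect` generates all identities as an ideal, so an ideal of `Vectⁿ` kills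
-- some of the factors and leaves the others untouched, and the quotient is some `Vectᵐ`.
--
-- Finally `⟨α, 1⟩ = α` for `α` in `2End(1_I)`, so nothing is identified there. Together with
-- symmetry of the pairing this gives non-degeneracy, and, if `End(I)` is `Vect`, it forces the
-- projection to be faithful on `End(I)`.

attribute [simp] Strict2Cat.dom_tgt Strict2Cat.cod_tgt Strict2Cat.dom_id₁ Strict2Cat.cod_id₁
  Strict2Cat.dom_comp Strict2Cat.cod_comp Strict2Cat.comp_assoc Strict2Cat.src_id₂
  Strict2Cat.tgt_id₂ Strict2Cat.src_vcomp Strict2Cat.tgt_vcomp Strict2Cat.src_hcomp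
  Strict2Cat.tgt_hcomp Strict2Cat.vcomp_assoc Strict2Cat.hcomp_assoc Strict2Cat.hcomp_id₂
  SemistrictMonoidal.dom_lt₁ SemistrictMonoidal.cod_lt₁ SemistrictMonoidal.dom_rt₁
  SemistrictMonoidal.cod_rt₁ SemistrictMonoidal.src_lt₂ SemistrictMonoidal.tgt_lt₂
  SemistrictMonoidal.src_rt₂ SemistrictMonoidal.tgt_rt₂ SemistrictMonoidal.lt₁_id₁
  SemistrictMonoidal.rt₁_id₁ SemistrictMonoidal.lt₁_comp SemistrictMonoidal.rt₁_comp
  SemistrictMonoidal.I_tensor SemistrictMonoidal.tensor_I SemistrictMonoidal.I_lt₁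
  SemistrictMonoidal.rt₁_I SemistrictMonoidal.I_lt₂ SemistrictMonoidal.rt₂_I
  SemistrictMonoidal.tensor_assoc SemistrictMonoidal.lt₁_lt₁ SemistrictMonoidal.lt₁_rt₁
  SemistrictMonoidal.rt₁_rt₁ SemistrictMonoidal.lt₂_lt₂
  SemistrictMonoidal.lt₂_rt₂ SemistrictMonoidal.rt₂_rt₂ SemistrictMonoidal.lt₂_id₂
  SemistrictMonoidal.rt₂_id₂ SemistrictMonoidal.lt₂_vcomp SemistrictMonoidal.rt₂_vcomp
  SemistrictMonoidal.lt₂_hcomp SemistrictMonoidal.rt₂_hcomp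
 SemistrictMonoidal.src_ten SemistrictMonoidal.tgt_ten
  SemistrictMonoidal.src_tenInv SemistrictMonoidal.tgt_tenInv
  DualityData.dom_star₁ DualityData.cod_star₁ DualityData.src_star₂ DualityData.tgt_star₂
  DualityData.src_η DualityData.tgt_η DualityData.src_ε DualityData.tgt_ε DualityData.dom_i
  DualityData.cod_i DualityData.dom_e DualityData.cod_e DualityData.src_T DualityData.tgt_T

/-! ### Whiskering calculus in a strict 2-category -/

namespace Strict2Cat

variable {O : Type u₁} {M : Type u₂} {N : Type u₃} (C : Strict2Cat O M N)

-- In these forms of the unit laws the boundary is a variable tied by an equation, so they apply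
-- when the boundary of a composite agrees with the identity only after computation.
@[simp] theorem id₁_comp_of_eq {A : O} {f : M} (h : C.dom f = A) : C.comp (C.id₁ A) f = f := by
  rw [← h, C.id₁_comp]

@[simp] theorem comp_id₁_of_eq {A : O} {f : M} (h : C.cod f = A) : C.comp f (C.id₁ A) = f := by
  rw [← h, C.comp_id₁]

@[simp] theorem id₂_vcomp_of_eq {f : M} {α : N} (h : C.src α = f) :
    C.vcomp (C.id₂ f) α = α := by rw [← h, C.id₂_vcomp]

@[simp] theorem vcomp_id₂_of_eq {f : M} {α : N} (h : C.tgt α = f) :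
    C.vcomp α (C.id₂ f) = α := by rw [← h, C.vcomp_id₂]

@[simp] theorem id₁_hcomp_of_eq {A : O} {α : N} (h : C.dom (C.src α) = A) :
    C.hcomp (C.id₂ (C.id₁ A)) α = α := by rw [← h, C.id₁_hcomp]

@[simp] theorem hcomp_id₁_of_eq {A : O} {α : N} (h : C.cod (C.src α) = A) :
    C.hcomp α (C.id₂ (C.id₁ A)) = α := by rw [← h, C.hcomp_id₁]

@[simp] theorem hcomp_id₂_assoc {f g : M} {α : N} (h : C.cod f = C.dom g)
    (h' : C.cod g = C.dom (C.src α)) :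
    C.hcomp (C.id₂ f) (C.hcomp (C.id₂ g) α) = C.hcomp (C.id₂ (C.comp f g)) α := by
  rw [← C.hcomp_assoc _ _ _ (by simpa) (by simpa), C.hcomp_id₂ _ _ h]

-- Together with `vcomp_hcomp_id₂` this distributes whiskerings over vertical composites, so that
-- pasting diagrams become vertical strings of whiskered cells.
@[simp] theorem id₂_hcomp_vcomp {f : M} {α β : N} (h : C.tgt α = C.src β)
    (h' : C.cod f = C.dom (C.src α)) :
    C.hcomp (C.id₂ f) (C.vcomp α β) =
      C.vcomp (C.hcomp (C.id₂ f) α) (C.hcomp (C.id₂ f) β) := by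
  rw [← C.interchange _ _ _ _ (by simp) h (by simpa), C.id₂_vcomp_of_eq (by simp)]

@[simp] theorem vcomp_hcomp_id₂ {f : M} {α β : N} (h : C.tgt α = C.src β)
    (h' : C.cod (C.src α) = C.dom f) :
    C.hcomp (C.vcomp α β) (C.id₂ f) =
      C.vcomp (C.hcomp α (C.id₂ f)) (C.hcomp β (C.id₂ f)) := by
  rw [← C.interchange _ _ _ _ h (by simp) (by simpa), C.id₂_vcomp_of_eq (by simp)]

/-- Whiskered 2-morphisms slide past each other. -/
theorem exchange {α β : N} {f f' g g' : M} (hf : C.src α = f) (hf' : C.tgt α = f')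
    (hg : C.src β = g) (hg' : C.tgt β = g') (h : C.cod f = C.dom g) :
    C.vcomp (C.hcomp α (C.id₂ g)) (C.hcomp (C.id₂ f') β) =
      C.vcomp (C.hcomp (C.id₂ f) β) (C.hcomp α (C.id₂ g')) := by
  subst hf hf' hg hg'
  rw [← C.interchange _ _ _ _ (by simp) (by simp) (by simpa),
    ← C.interchange _ _ _ _ (by simp) (by simp) (by simpa)]
  simp

end Strict2Cat

/-! ### Adjoints of 2-morphisms -/

namespace SemistrictSpherical

variable {O : Type u₁} {M : Type u₂} {N : Type u₃} (C : SemistrictSpherical O M N)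

@[simp] theorem star₀_star₀ (A : O) : C.star₀ (C.star₀ A) = A := C.isDuality.star₀_star₀ A

@[simp] theorem star₁_star₁ (f : M) : C.star₁ (C.star₁ f) = f := C.isDuality.star₁_star₁ f

@[simp] theorem star₂_star₂ (α : N) : C.star₂ (C.star₂ α) = α := C.isDuality.star₂_star₂ α

@[simp] theorem star₁_id₁ (A : O) : C.star₁ (C.id₁ A) = C.id₁ A := C.isDuality.star₁_id₁ A

@[simp] theorem star₂_id₂ (f : M) : C.star₂ (C.id₂ f) = C.id₂ f := C.isDuality.star₂_id₂ f

@[simp] theorem star₂_vcomp {α β : N} (h : C.tgt α = C.src β) :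
    C.star₂ (C.vcomp α β) = C.vcomp (C.star₂ β) (C.star₂ α) := C.isDuality.star₂_vcomp α β h

@[simp] theorem star₂_hcomp {α β : N} (h : C.cod (C.src α) = C.dom (C.src β)) :
    C.star₂ (C.hcomp α β) = C.hcomp (C.star₂ α) (C.star₂ β) := C.isDuality.star₂_hcomp α β h

@[simp] theorem star₁_comp {f g : M} (h : C.cod f = C.dom g) :
    C.star₁ (C.comp f g) = C.comp (C.star₁ g) (C.star₁ f) := C.isDuality.star₁_comp f g h

@[simp] theorem star₁_lt₁ (A : O) (f : M) : C.star₁ (C.lt₁ A f) = C.lt₁ A (C.star₁ f) :=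
  C.isDuality.star₁_lt₁ A f

@[simp] theorem star₁_rt₁ (f : M) (A : O) : C.star₁ (C.rt₁ f A) = C.rt₁ (C.star₁ f) A :=
  C.isDuality.star₁_rt₁ f A

@[simp] theorem star₂_lt₂ (A : O) (α : N) : C.star₂ (C.lt₂ A α) = C.lt₂ A (C.star₂ α) :=
  C.isDuality.star₂_lt₂ A α

@[simp] theorem star₂_rt₂ (α : N) (A : O) : C.star₂ (C.rt₂ α A) = C.rt₂ (C.star₂ α) A :=
  C.isDuality.star₂_rt₂ α A

@[simp] theorem star₀_tensor (A B : O) :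
    C.star₀ (C.tensor A B) = C.tensor (C.star₀ B) (C.star₀ A) := C.isDuality.star₀_tensor A B

@[simp] theorem star₁_e (A : O) : C.star₁ (C.e A) = C.i (C.star₀ A) := (C.isDuality.i_star₀ A).symm

@[simp] theorem star₁_i (A : O) : C.star₁ (C.i A) = C.e (C.star₀ A) := (C.isDuality.e_star₀ A).symm

@[simp] theorem star₂_ε (f : M) : C.star₂ (C.ε f) = C.η (C.star₁ f) :=
  (C.isDuality.η_star₁ f).symm

@[simp] theorem star₂_η (f : M) : C.star₂ (C.η f) = C.ε (C.star₁ f) :=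
  (C.isDuality.ε_star₁ f).symm

@[simp] theorem src_dagger (α : N) : C.src (C.dagger α) = C.star₁ (C.tgt α) := by
  simp (maxDischargeDepth := 30) [DualityData.dagger]

@[simp] theorem tgt_dagger (α : N) : C.tgt (C.dagger α) = C.star₁ (C.src α) := by
  simp (maxDischargeDepth := 30) [DualityData.dagger]

@[simp] theorem src_ldagger (α : N) : C.src (C.ldagger α) = C.star₁ (C.tgt α) := by
  simp (maxDischargeDepth := 30) [DualityData.ldagger]

@[simp] theorem tgt_ldagger (α : N) : C.tgt (C.ldagger α) = C.star₁ (C.src α) := by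
  simp (maxDischargeDepth := 30) [DualityData.ldagger]

@[simp] theorem src_φ (f : M) : C.src (C.φ f) = C.lsharp₁ f := C.isPivotal.src_φ f

@[simp] theorem tgt_φ (f : M) : C.tgt (C.φ f) = C.rsharp₁ f := C.isPivotal.tgt_φ f

@[simp] theorem dom_lsharp₁ (f : M) : C.dom (C.lsharp₁ f) = C.star₀ (C.cod f) := by
  simp (maxDischargeDepth := 30) [DualityData.lsharp₁]

@[simp] theorem cod_lsharp₁ (f : M) : C.cod (C.lsharp₁ f) = C.star₀ (C.dom f) := by
  simp (maxDischargeDepth := 30) [DualityData.lsharp₁]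

@[simp] theorem dom_rsharp₁ (f : M) : C.dom (C.rsharp₁ f) = C.star₀ (C.cod f) := by
  simp (maxDischargeDepth := 30) [DualityData.rsharp₁]

@[simp] theorem cod_rsharp₁ (f : M) : C.cod (C.rsharp₁ f) = C.star₀ (C.dom f) := by
  simp (maxDischargeDepth := 30) [DualityData.rsharp₁]


theorem triangle (f : M) :
    C.vcomp (C.hcomp (C.η f) (C.id₂ f)) (C.hcomp (C.id₂ f) (C.ε f)) = C.id₂ f :=
  C.isDuality.triangle f

theorem triangle_star (f : M) :
    C.vcomp (C.hcomp (C.id₂ (C.star₁ f)) (C.η f)) (C.hcomp (C.ε f) (C.id₂ (C.star₁ f))) =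
      C.id₂ (C.star₁ f) :=
  C.isDuality.triangle_star f

/-- A 2-morphism slides over the unit as its adjoint. -/
theorem η_dagger (α : N) :
    C.vcomp (C.η (C.tgt α)) (C.hcomp (C.id₂ (C.tgt α)) (C.dagger α)) =
      C.vcomp (C.η (C.src α)) (C.hcomp α (C.id₂ (C.star₁ (C.src α)))) := by
  -- The unit of the target and the 2-morphism on the right-hand side are created in either order;
  -- closing with the counit leaves a zigzag of the target, removed by the triangle identity.
  have ex := C.exchange (α := C.η (C.tgt α))
    (β := C.vcomp (C.η (C.src α)) (C.hcomp α (C.id₂ (C.star₁ (C.src α)))))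
    (C.src_η _) (C.tgt_η _) (g := C.id₁ (C.dom (C.src α)))
    (g' := C.comp (C.tgt α) (C.star₁ (C.src α)))
    (by simp) (by simp (maxDischargeDepth := 9)) (by simp)
  replace ex := congrArg (C.vcomp · (C.hcomp (C.id₂ (C.tgt α))
    (C.hcomp (C.ε (C.tgt α)) (C.id₂ (C.star₁ (C.src α)))))) ex
  have tr := congrArg (C.hcomp · (C.id₂ (C.star₁ (C.src α)))) (C.triangle (C.tgt α))
  simp (maxDischargeDepth := 9) at ex tr
  simp (maxDischargeDepth := 9) [DualityData.dagger, ex, tr]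

/-- A 2-morphism slides over the counit as its adjoint. -/
theorem dagger_ε (α : N) :
    C.vcomp (C.hcomp (C.dagger α) (C.id₂ (C.src α))) (C.ε (C.src α)) =
      C.vcomp (C.hcomp (C.id₂ (C.star₁ (C.tgt α))) α) (C.ε (C.tgt α)) := by
  -- The counit of the source is moved up past the counit of the target, then past `α`, until it
  -- meets the unit inside `α†` and cancels by the triangle identity.
  have ex := C.exchange (α := C.ε (C.tgt α)) (β := C.ε (C.src α)) rfl rfl rfl rfl (by simp)
  have ex' := congrArg (C.vcomp · (C.ε (C.tgt α)))
    (congrArg (C.hcomp (C.id₂ (C.star₁ (C.tgt α))))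
      (C.exchange (α := α) (β := C.ε (C.src α)) rfl rfl rfl rfl (by simp)))
  have tr := congrArg (C.vcomp · (C.vcomp (C.hcomp (C.id₂ (C.star₁ (C.tgt α))) α) (C.ε (C.tgt α))))
    (congrArg (C.hcomp (C.id₂ (C.star₁ (C.tgt α)))) (C.triangle (C.src α)))
  simp (maxDischargeDepth := 9) at ex ex' tr
  simp (maxDischargeDepth := 9) [DualityData.dagger, ex, ex', tr]

theorem star₂_dagger (α : N) : C.star₂ (C.dagger α) = C.dagger (C.star₂ α) :=
  C.isDuality.dagger_star α

/-- The dual of `η_dagger` for `α*`. Since `*` commutes with `†`, the result is again about `α†`,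
now on the other side of the 1-morphisms; this two-sidedness is what makes `†` involutive and the
trace cyclic. -/
theorem dagger_ε_star (α : N) :
    C.vcomp (C.hcomp (C.id₂ (C.src α)) (C.dagger α)) (C.ε (C.star₁ (C.src α))) =
      C.vcomp (C.hcomp α (C.id₂ (C.star₁ (C.tgt α)))) (C.ε (C.star₁ (C.tgt α))) := by
  have h := congrArg C.star₂ (C.η_dagger (C.star₂ α))
  simpa (maxDischargeDepth := 9) [star₂_dagger] using h

theorem η_star_dagger (α : N) :
    C.vcomp (C.η (C.star₁ (C.tgt α))) (C.hcomp (C.dagger α) (C.id₂ (C.tgt α))) =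
      C.vcomp (C.η (C.star₁ (C.src α))) (C.hcomp (C.id₂ (C.star₁ (C.src α))) α) := by
  have h := congrArg C.star₂ (C.dagger_ε (C.star₂ α))
  simpa (maxDischargeDepth := 9) [star₂_dagger] using h

/-- The triangle identity recovers `β` from its composite with the unit of `g`, so sliding over the
unit characterises the adjoint. Later identities for `†` are proved by checking this property. -/
theorem eq_dagger {f g : M} {α β : N} (hs : C.src α = f) (ht : C.tgt α = g)
    (hs' : C.src β = C.star₁ g) (ht' : C.tgt β = C.star₁ f)
    (h : C.vcomp (C.η g) (C.hcomp (C.id₂ g) β) =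
      C.vcomp (C.η f) (C.hcomp α (C.id₂ (C.star₁ f)))) :
    β = C.dagger α := by
  subst hs ht
  have tr := congrArg (C.vcomp · β) (C.triangle_star (C.tgt α))
  have ex := C.exchange (α := C.ε (C.tgt α)) (β := β) rfl rfl rfl rfl
    (by rw [← C.dom_tgt β]; simp [ht'])
  have hd : C.dom (C.src β) = C.cod (C.src α) := by simp [hs']
  replace h := congrArg (C.vcomp · (C.hcomp (C.ε (C.tgt α)) (C.id₂ (C.star₁ (C.src α)))))
    (congrArg (C.hcomp (C.id₂ (C.star₁ (C.tgt α)))) h)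
  simp (maxDischargeDepth := 9) [hs', ht'] at tr ex h
  rw [← tr, ex, h]
  simp (maxDischargeDepth := 9) [DualityData.dagger]

-- `η_star_dagger`, read from right to left, is the property that characterises the adjoint of `α†`.
@[simp] theorem dagger_dagger (α : N) : C.dagger (C.dagger α) = α := by
  refine (C.eq_dagger (C.src_dagger α) (C.tgt_dagger α) (by simp) (by simp) ?_).symm
  simpa using (C.η_star_dagger α).symm

theorem dagger_vcomp {α β : N} (h : C.tgt α = C.src β) :
    C.dagger (C.vcomp α β) = C.vcomp (C.dagger β) (C.dagger α) := by
  refine (C.eq_dagger (C.src_vcomp _ _ h) (C.tgt_vcomp _ _ h) (by simp [h]) (by simp [h]) ?_).symm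
  have hd : C.cod (C.src β) = C.cod (C.src α) := by rw [← h]; simp
  have e₁ := congrArg (C.vcomp · (C.hcomp (C.id₂ (C.tgt β)) (C.dagger α))) (C.η_dagger β)
  have e₂ := congrArg (C.vcomp · (C.hcomp β (C.id₂ (C.star₁ (C.src α))))) (C.η_dagger α)
  have ex := C.exchange (α := β) (β := C.dagger α) rfl rfl rfl rfl (by simp [hd])
  simp (maxDischargeDepth := 9) [h, hd] at e₁ e₂ ex ⊢
  rw [e₁, ex, e₂]

/-- The unit of a composite is nested, with that of `f` outermost, so `α` slides over the inner unit
alone. This is what reduces left whiskering to right whiskering. -/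
theorem dagger_id₂_hcomp {f : M} {α : N} (h : C.cod f = C.dom (C.src α)) :
    C.dagger (C.hcomp (C.id₂ f) α) = C.hcomp (C.dagger α) (C.id₂ (C.star₁ f)) := by
  refine (C.eq_dagger (f := C.comp f (C.src α)) (g := C.comp f (C.tgt α))
    (by simp [h]) (by simp [h]) (by simp [h]) (by simp [h]) ?_).symm
  have e := congrArg (C.vcomp (C.η f)) (congrArg (C.hcomp (C.id₂ f))
    (congrArg (C.hcomp · (C.id₂ (C.star₁ f))) (C.η_dagger α)))
  have h₁ := C.isDuality.η_comp f (C.tgt α) (by simp [h])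
  have h₂ := C.isDuality.η_comp f (C.src α) (by simp [h])
  simp (maxDischargeDepth := 9) [h, h₁, h₂] at e ⊢
  exact e

end SemistrictSpherical

namespace Strict2Cat

variable {O : Type u₁} {M : Type u₂} {N : Type u₃} (C : Strict2Cat O M N)

/-- Vertical pasting of commutative squares. -/
theorem vcomp_square {s s' t t' x y z : N} (h₁ : C.vcomp x s' = C.vcomp s y)
    (h₂ : C.vcomp y t' = C.vcomp t z) (hx : C.tgt x = C.src s') (hs' : C.tgt s' = C.src t')
    (hs : C.tgt s = C.src y) (hy : C.tgt y = C.src t') (ht : C.tgt s = C.src t)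
    (hz : C.tgt t = C.src z) :
    C.vcomp x (C.vcomp s' t') = C.vcomp (C.vcomp s t) z := by
  rw [← C.vcomp_assoc _ _ _ hx hs', h₁, C.vcomp_assoc _ _ _ hs hy, h₂, C.vcomp_assoc _ _ _ ht hz]

end Strict2Cat

/-! ### Traces, cyclicity, and naturality of `θ` -/

namespace SemistrictSpherical

variable {O : Type u₁} {M : Type u₂} {N : Type u₃} (C : SemistrictSpherical O M N)

/-- The trace `1_A ⇒ 1_A` of a 2-endomorphism of `f : A → B`. -/
def tr₁ (f : M) (α : N) : N :=
  C.vcomp (C.η f) (C.vcomp (C.hcomp α (C.id₂ (C.star₁ f))) (C.ε (C.star₁ f)))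

/-- The trace `1_I ⇒ 1_I` of a 2-endomorphism of `f : A → B`. -/
def tr (f : M) (α : N) : N :=
  C.vcomp (C.capR f) (C.vcomp (C.rtr₂ (C.hcomp α (C.id₂ (C.star₁ f)))) (C.cupR f))

theorem pair_eq_tr (α β : N) : C.pair α β = C.tr (C.src α) (C.vcomp α β) := rfl

theorem capR_eq (f : M) :
    C.capR f = C.vcomp (C.η (C.i (C.dom f))) (C.rtr₂ (C.η f)) := by
  simp (maxDischargeDepth := 9) [DualityData.capR, DualityData.rtr₂, C.isDuality.η_comp,
    C.isDuality.η_rt₁]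

theorem cupR_eq (f : M) :
    C.cupR f = C.vcomp (C.rtr₂ (C.ε (C.star₁ f))) (C.ε (C.star₁ (C.i (C.dom f)))) := by
  simp (maxDischargeDepth := 9) [DualityData.cupR, capR_eq, DualityData.rtr₂]

theorem capL_eq (f : M) :
    C.capL f = C.vcomp (C.η (C.i (C.star₀ (C.dom f)))) (C.ltr₂ (C.η f)) := by
  simp (maxDischargeDepth := 9) [DualityData.capL, DualityData.ltr₂, C.isDuality.η_comp,
    C.isDuality.η_lt₁]

theorem cupL_eq (f : M) :
    C.cupL f = C.vcomp (C.ltr₂ (C.ε (C.star₁ f))) (C.ε (C.star₁ (C.i (C.star₀ (C.dom f))))) := by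
  simp (maxDischargeDepth := 9) [DualityData.cupL, capL_eq, DualityData.ltr₂]

/-- Units and counits of composites are nested, so the trace can be taken in two stages: first down
to `1_A`, then along `i_A`. Statements about `tr` thereby reduce to statements about `tr₁`. -/
theorem tr_eq {f : M} {α : N} (hs : C.src α = f) (ht : C.tgt α = f) :
    C.tr f α = C.vcomp (C.η (C.i (C.dom f)))
      (C.vcomp (C.rtr₂ (C.tr₁ f α)) (C.ε (C.star₁ (C.i (C.dom f))))) := by
  subst hs
  simp (maxDischargeDepth := 9) [tr, tr₁, capR_eq, cupR_eq, DualityData.rtr₂, ht]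

theorem tr_eq_tr₁ {f : M} {α : N} (hs : C.src α = f) :
    C.tr f α = C.tr₁ (C.comp (C.i (C.dom f)) (C.rt₁ f (C.star₀ (C.dom f))))
      (C.hcomp (C.id₂ (C.i (C.dom f))) (C.rt₂ α (C.star₀ (C.dom f)))) := by
  subst hs
  simp (maxDischargeDepth := 9) [tr, tr₁, DualityData.capR, DualityData.cupR, DualityData.rtr₂]

/-- `α` slides over the unit as `α†`, is exchanged with `β`, and slides back over the counit below
`β`. No pivotal structure is involved, because the loop never changes sides. -/
theorem tr₁_vcomp_comm {α β : N} (h : C.tgt α = C.src β) (h' : C.tgt β = C.src α) :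
    C.tr₁ (C.src α) (C.vcomp α β) = C.tr₁ (C.src β) (C.vcomp β α) := by
  have hd : C.cod (C.src β) = C.cod (C.src α) := by rw [← h]; simp
  have e₁ := congrArg (C.vcomp · (C.vcomp (C.hcomp β (C.id₂ (C.star₁ (C.src α))))
    (C.ε (C.star₁ (C.src α))))) (C.η_dagger α)
  have e₂ := C.dagger_ε_star α
  have ex := congrArg (C.vcomp · (C.ε (C.star₁ (C.src α))))
    (C.exchange (α := β) (β := C.dagger α) rfl rfl rfl rfl (by simp [hd]))
  simp (maxDischargeDepth := 9) [h, h', hd] at e₁ e₂ ex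
  simp (maxDischargeDepth := 9) [tr₁, h, h', hd, ← e₁, ← e₂, ex]

theorem tr_vcomp_comm {α β : N} (h : C.tgt α = C.src β) (h' : C.tgt β = C.src α) :
    C.tr (C.src α) (C.vcomp α β) = C.tr (C.src β) (C.vcomp β α) := by
  rw [C.tr_eq (by simp [h]) (by simp [h, h']), C.tr_eq (by simp [h']) (by simp [h, h']),
    C.tr₁_vcomp_comm h h', ← h]
  simp

theorem pair_comm {α β : N} (h : C.tgt α = C.src β) (h' : C.tgt β = C.src α) :
    C.pair α β = C.pair β α := C.tr_vcomp_comm h h'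

theorem src_thetaR {f g : M} (h : C.cod f = C.dom g) (h' : C.cod g = C.dom f) :
    C.src (C.thetaR C.φ f g) = C.rtr₁ (C.comp f g) := by
  simp (maxDischargeDepth := 15) [DualityData.thetaR, DualityData.rtr₁, h, h',
    DualityData.lsharp₁, DualityData.rsharp₁]

theorem tgt_thetaR {f g : M} (h : C.cod f = C.dom g) (h' : C.cod g = C.dom f) :
    C.tgt (C.thetaR C.φ f g) = C.rtr₁ (C.comp g f) := by
  simp (maxDischargeDepth := 15) [DualityData.thetaR, DualityData.rtr₁, h, h',
    DualityData.lsharp₁, DualityData.rsharp₁]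

theorem star₂_pair {α β : N} (h : C.tgt α = C.src β) (h' : C.tgt β = C.src α) :
    C.star₂ (C.pair α β) = C.pair (C.star₂ β) (C.star₂ α) := by
  have hd : C.cod (C.src β) = C.cod (C.src α) := by rw [← h]; simp
  have hd' : C.dom (C.src β) = C.dom (C.src α) := by rw [← h]; simp
  simp (maxDischargeDepth := 9) [DualityData.pair, DualityData.capR, DualityData.cupR,
    DualityData.rtr₂, h, h', hd, hd']

theorem pair_vcomp_left {α β γ : N} (h : C.tgt α = C.src β) (h' : C.tgt β = C.src γ) :
    C.pair (C.vcomp α β) γ = C.pair α (C.vcomp β γ) := by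
  rw [pair_eq_tr, pair_eq_tr, C.src_vcomp _ _ h, C.vcomp_assoc _ _ _ h h']

/-- The partial trace `f' ⇒ f` over `h` of a 2-morphism `f'h ⇒ fh`. -/
def partialTr (f' f h : M) (β : N) : N :=
  C.vcomp (C.hcomp (C.id₂ f') (C.η h)) (C.vcomp (C.hcomp β (C.id₂ (C.star₁ h)))
    (C.hcomp (C.id₂ f) (C.ε (C.star₁ h))))

/-- The loop of `h` lies inside the loop of the other factor. Moving `α` above the creation of the
inner loop leaves `β` alone inside it, which is the partial trace. -/
theorem tr_hcomp_id₂ {α β : N} {h : M} (hh : C.cod (C.src α) = C.dom h)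
    (hs : C.src β = C.comp (C.tgt α) h) (ht : C.tgt β = C.comp (C.src α) h) :
    C.tr (C.comp (C.src α) h) (C.vcomp (C.hcomp α (C.id₂ h)) β) =
      C.tr (C.src α) (C.vcomp α (C.partialTr (C.tgt α) (C.src α) h β)) := by
  have hε := C.isDuality.ε_comp (C.star₁ h) (C.star₁ (C.src α)) (by simp [hh])
  have ex := congrArg (C.hcomp · (C.id₂ (C.star₁ (C.src α))))
    (C.exchange (α := α) (β := C.η h) rfl rfl rfl rfl (by simp [hh]))
  replace ex := congrArg (C.vcomp · (C.vcomp (C.hcomp β (C.id₂ (C.star₁ (C.comp (C.src α) h))))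
    (C.ε (C.star₁ (C.comp (C.src α) h))))) ex
  rw [C.tr_eq (by simp [hh, hs]) (by simp [hh, hs, ht]),
    C.tr_eq (by simp (maxDischargeDepth := 9) [partialTr, hh, hs, ht])
      (by simp (maxDischargeDepth := 9) [partialTr, hh, hs, ht])]
  simp (maxDischargeDepth := 9) [hh, hs, ht, hε] at ex
  simp (maxDischargeDepth := 9) [tr₁, partialTr, hh, hs, ht, hε, C.isDuality.η_comp, ex]

-- The 2-morphism `α` is carried through the six layers of `θ` one at a time. The component of `φ`
-- is taken at `g`, which is fixed, so naturality of `φ` plays no role.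
set_option maxHeartbeats 1000000 in
theorem thetaR_natural {α : N} {g : M} (h : C.cod (C.src α) = C.dom g)
    (h' : C.cod g = C.dom (C.src α)) :
    C.vcomp (C.rtr₂ (C.hcomp α (C.id₂ g))) (C.thetaR C.φ (C.tgt α) g) =
      C.vcomp (C.thetaR C.φ (C.src α) g) (C.rtr₂ (C.hcomp (C.id₂ g) α)) := by
  let A := C.dom (C.src α)
  let B := C.dom g
  let X := C.hcomp (C.id₂ (C.i A)) (C.rt₂ α (C.star₀ A))
  let Q := C.comp (C.i B) (C.rt₁ g (C.star₀ B))
  let R := C.comp (C.rt₁ g (C.star₀ A)) (C.e (C.star₀ A))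
  -- Layers one, two, three and six act beside `α` and are crossed by exchange; layers four and five
  -- are tensorators with `α` in their first argument and are crossed by naturality.
  have e₁ := C.exchange (α := X) (β := C.hcomp (C.rt₂ (C.dagger (C.T B)) (C.star₀ A)) (C.id₂ R))
    rfl rfl rfl rfl (by simp (maxDischargeDepth := 9) [X, R, A, B, h, h'])
  have e₂ := C.exchange (α := X) (β := C.hcomp (C.id₂ (C.rt₁ (C.lt₁ B (C.i (C.star₀ B)))
    (C.star₀ A))) (C.ten (C.e (C.star₀ B)) R))
    rfl rfl rfl rfl (by simp (maxDischargeDepth := 9) [X, R, A, B, h, h'])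
  have e₃ := C.exchange (α := X) (β := C.hcomp (C.lt₂ B (C.φ g)) (C.id₂ (C.e (C.star₀ B))))
    rfl rfl rfl rfl (by simp (maxDischargeDepth := 9) [X, A, B, h, h'])
  have e₄ := congrArg (C.hcomp · (C.id₂ (C.comp (C.rt₁ (C.lt₁ B (C.e A)) (C.star₀ B))
    (C.e (C.star₀ B))))) (C.ten_natural_left X Q)
  have e₅ := congrArg (C.hcomp (C.id₂ (C.comp Q (C.rt₁ (C.i A) (C.tensor A (C.star₀ B))))))
    (congrArg (C.hcomp · (C.id₂ (C.e (C.star₀ B))))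
      (congrArg (C.rt₂ · (C.star₀ B)) (C.ten_natural_left α (C.e A))))
  have e₆ := congrArg (C.hcomp (C.id₂ Q)) (congrArg (C.hcomp · (C.id₂ (C.e (C.star₀ B))))
    (C.exchange (α := C.rt₂ (C.T A) (C.star₀ B)) (β := C.rt₂ α (C.star₀ B)) rfl rfl rfl rfl
      (by simp (maxDischargeDepth := 9) [A, B])))
  simp (maxDischargeDepth := 15) [X, Q, R, A, B, h, h', DualityData.lsharp₁,
    DualityData.rsharp₁] at e₁ e₂ e₃ e₄ e₅ e₆
  -- Each `y` is `α` whiskered by the 1-morphisms on the common boundary of two consecutive layers.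
  refine C.vcomp_square
      (y := C.hcomp X (C.id₂ (C.comp (C.rt₁ (C.lt₁ B (C.i (C.star₀ B))) (C.star₀ A))
        (C.comp (C.rt₁ (C.e (C.star₀ B)) (C.tensor B (C.star₀ A))) R)))) ?_
    (C.vcomp_square
      (y := C.hcomp X (C.id₂ (C.comp (C.rt₁ (C.lt₁ B (C.i (C.star₀ B))) (C.star₀ A))
        (C.comp (C.lt₁ (C.tensor B (C.star₀ B)) R) (C.e (C.star₀ B)))))) ?_
    (C.vcomp_square
      (y := C.hcomp X (C.id₂ (C.comp (C.lt₁ B (C.rsharp₁ g)) (C.e (C.star₀ B))))) ?_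
    (C.vcomp_square
      (y := C.hcomp (C.id₂ Q) (C.hcomp (C.rt₂ X (C.tensor A (C.star₀ B)))
        (C.id₂ (C.comp (C.rt₁ (C.lt₁ B (C.e A)) (C.star₀ B)) (C.e (C.star₀ B)))))) ?_
    (C.vcomp_square
      (y := C.hcomp (C.id₂ (C.comp Q (C.comp (C.rt₁ (C.i A) (C.tensor A (C.star₀ B)))
        (C.rt₁ (C.lt₁ A (C.e A)) (C.star₀ B)))))
        (C.hcomp (C.rt₂ α (C.star₀ B)) (C.id₂ (C.e (C.star₀ B))))) ?_ ?_
      ?_ ?_ ?_ ?_ ?_ ?_) ?_ ?_ ?_ ?_ ?_ ?_) ?_ ?_ ?_ ?_ ?_ ?_) ?_ ?_ ?_ ?_ ?_ ?_) ?_ ?_ ?_ ?_ ?_ ?_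
  on_goal 1 => simpa (maxDischargeDepth := 15) [X, Q, R, A, B, h, h', DualityData.rtr₂] using e₁
  on_goal 1 => simpa (maxDischargeDepth := 15) [X, Q, R, A, B, h, h'] using e₂
  on_goal 1 => simpa (maxDischargeDepth := 15) [X, Q, R, A, B, h, h', DualityData.rsharp₁] using e₃
  on_goal 1 => simpa (maxDischargeDepth := 15) [X, Q, R, A, B, h, h', DualityData.rsharp₁] using e₄
  on_goal 1 => simpa (maxDischargeDepth := 15) [X, Q, R, A, B, h, h'] using e₅
  on_goal 1 => simpa (maxDischargeDepth := 15) [X, Q, R, A, B, h, h', DualityData.rtr₂] using e₆.symm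
  all_goals
    simp (maxDischargeDepth := 15) [X, Q, R, A, B, h, h', DualityData.rtr₂, DualityData.lsharp₁,
      DualityData.rsharp₁]

end SemistrictSpherical

/-! ### Invariance of the trace under adjoints, sides and tensor products -/

namespace SemistrictSpherical

variable {O : Type u₁} {M : Type u₂} {N : Type u₃} (C : SemistrictSpherical O M N)

/-- Consistency writes the cap of `f*` and the cup of `f` through `θ`; naturality of `θ` then turns
the loop of `α ∘ f*` into the loop of `f* ∘ α`, and there `α` slides over the unit of `f*` as `α†`.
-/
theorem tr_dagger {α : N} (h : C.tgt α = C.src α) :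
    C.tr (C.star₁ (C.src α)) (C.dagger α) = C.tr (C.src α) α := by
  have hn := C.thetaR_natural (α := α) (g := C.star₁ (C.src α)) (by simp) (by simp)
  have h₁ := C.isConsistent.capR_theta (C.src α)
  have h₂ := C.isConsistent.theta_cupR (C.src α)
  have hη := C.η_star_dagger α
  rw [h] at hη hn
  have hs := C.src_thetaR (f := C.src α) (g := C.star₁ (C.src α)) (by simp) (by simp)
  have ht := C.tgt_thetaR (f := C.src α) (g := C.star₁ (C.src α)) (by simp) (by simp)
  have key : C.tr (C.src α) α = C.vcomp (C.capR (C.star₁ (C.src α)))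
      (C.vcomp (C.rtr₂ (C.hcomp (C.id₂ (C.star₁ (C.src α))) α))
        (C.cupR (C.star₁ (C.src α)))) := by
    rw [tr, ← h₂, ← C.vcomp_assoc (C.rtr₂ _), hn, ← h₁, C.vcomp_assoc, C.vcomp_assoc]
    all_goals simp (maxDischargeDepth := 9) [hs, ht, DualityData.rtr₁, DualityData.rtr₂,
      DualityData.capR, DualityData.cupR, h]
  have e := congrArg (fun β => C.vcomp (C.η (C.i (C.cod (C.src α)))) (C.vcomp (C.rtr₂ β)
    (C.cupR (C.star₁ (C.src α))))) hη
  simp (maxDischargeDepth := 9) [DualityData.rtr₂, h, cupR_eq] at e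
  rw [key, tr]
  simp (maxDischargeDepth := 9) [capR_eq, cupR_eq, DualityData.rtr₂, h]
  exact e

/-- Both traces factor through the same 2-endomorphism `tr₁ f α` of `1_A`. The spherical structure
is therefore needed only at `1_A`, where it is compatible with the caps and cups. -/
theorem tr_eq_left {f : M} {α : N} (hs : C.src α = f) (ht : C.tgt α = f) :
    C.tr f α = C.vcomp (C.capL f)
      (C.vcomp (C.ltr₂ (C.hcomp α (C.id₂ (C.star₁ f)))) (C.cupL f)) := by
  subst hs
  have hy : C.src (C.tr₁ (C.src α) α) = C.id₁ (C.dom (C.src α)) := by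
    simp (maxDischargeDepth := 9) [tr₁, ht]
  have hy' : C.tgt (C.tr₁ (C.src α) α) = C.id₁ (C.dom (C.src α)) := by
    simp (maxDischargeDepth := 9) [tr₁, ht]
  have hn := C.isSpherical.σ_natural (C.tr₁ (C.src α) α) (by simp [hy])
  have h₁ := C.isSpherical.capL_σ (C.dom (C.src α))
  have h₂ := C.isSpherical.σ_cupR (C.dom (C.src α))
  have hσ := C.isSpherical.src_σ (C.id₁ (C.dom (C.src α))) (by simp)
  have hσ' := C.isSpherical.tgt_σ (C.id₁ (C.dom (C.src α))) (by simp)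
  rw [hy, hy'] at hn
  have e : C.vcomp (C.capR (C.id₁ (C.dom (C.src α)))) (C.vcomp (C.rtr₂ (C.tr₁ (C.src α) α))
      (C.cupR (C.id₁ (C.dom (C.src α))))) =
      C.vcomp (C.capL (C.id₁ (C.dom (C.src α)))) (C.vcomp (C.ltr₂ (C.tr₁ (C.src α) α))
      (C.cupL (C.id₁ (C.dom (C.src α))))) := by
    rw [← h₁, ← h₂, C.vcomp_assoc, ← C.vcomp_assoc (C.σ _), hn, C.vcomp_assoc]
    all_goals simp (maxDischargeDepth := 9) [hσ, hσ', DualityData.rtr₁, DualityData.rtr₂,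
      DualityData.ltr₁, DualityData.ltr₂, DualityData.capR, DualityData.cupR,
      DualityData.capL, hy, hy']
  rw [C.tr_eq rfl ht, star₁_i]
  simp (maxDischargeDepth := 9) [DualityData.capR, DualityData.cupR,
    DualityData.capL, DualityData.cupL] at e
  rw [e]
  simp (maxDischargeDepth := 9) [capL_eq, cupL_eq, DualityData.ltr₂, tr₁, ht]

theorem tr_eq_left_tr₁ {f : M} {α : N} (hs : C.src α = f) (ht : C.tgt α = f) :
    C.tr f α = C.tr₁ (C.comp (C.i (C.star₀ (C.dom f))) (C.lt₁ (C.star₀ (C.dom f)) f))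
      (C.hcomp (C.id₂ (C.i (C.star₀ (C.dom f)))) (C.lt₂ (C.star₀ (C.dom f)) α)) := by
  rw [C.tr_eq_left hs ht]
  subst hs
  simp (maxDischargeDepth := 9) [tr₁, DualityData.capL, DualityData.cupL, DualityData.ltr₂]

/-- Since `i_{A ⊗ X} = i_A (A ⊗ i_X ⊗ A*)`, both sides are the trace over the same composite
1-morphism out of `I`. -/
theorem tr_rt₁ {f : M} {X : O} {α : N} (hs : C.src α = C.rt₁ f X) :
    C.tr (C.rt₁ f X) α =
      C.tr (C.comp (C.lt₁ (C.dom f) (C.i X)) (C.rt₁ f (C.tensor X (C.star₀ X))))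
        (C.hcomp (C.id₂ (C.lt₁ (C.dom f) (C.i X))) (C.rt₂ α (C.star₀ X))) := by
  rw [C.tr_eq_tr₁ hs, C.tr_eq_tr₁ (by simp [hs])]
  simp (maxDischargeDepth := 9) [C.isDuality.tensor_i, hs]

/-- The mirror image of `tr_rt₁`. Tensoring on the left nests inside the left trace, hence the
detour through `tr_eq_left_tr₁`. -/
theorem tr_lt₁ {f : M} {X : O} {α : N} (hs : C.src α = C.lt₁ X f) (ht : C.tgt α = C.lt₁ X f) :
    C.tr (C.lt₁ X f) α =
      C.tr (C.comp (C.rt₁ (C.i (C.star₀ X)) (C.dom f)) (C.lt₁ (C.tensor (C.star₀ X) X) f))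
        (C.hcomp (C.id₂ (C.rt₁ (C.i (C.star₀ X)) (C.dom f))) (C.lt₂ (C.star₀ X) α)) := by
  rw [C.tr_eq_left_tr₁ hs ht, C.tr_eq_left_tr₁ (by simp [hs]) (by simp [hs, ht])]
  simp (maxDischargeDepth := 9) [C.isDuality.tensor_i, hs]

/-- Two parallel 2-morphisms are equivalent if they pair equally with all 2-morphisms. -/
def TrEquiv (α β : N) : Prop :=
  C.Par α β ∧ ∀ γ, C.src γ = C.tgt α → C.tgt γ = C.src α → C.pair α γ = C.pair β γ

/-! ### The trace equivalence is a congruence -/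

namespace TrEquiv

variable {C}

theorem refl (α : N) : C.TrEquiv α α := ⟨⟨rfl, rfl⟩, fun _ _ _ => rfl⟩

theorem symm {α β : N} (h : C.TrEquiv α β) : C.TrEquiv β α :=
  ⟨⟨h.1.1.symm, h.1.2.symm⟩, fun γ hs ht =>
    (h.2 γ (hs.trans h.1.2.symm) (ht.trans h.1.1.symm)).symm⟩

theorem trans {α β γ : N} (h : C.TrEquiv α β) (h' : C.TrEquiv β γ) : C.TrEquiv α γ :=
  ⟨⟨h.1.1.trans h'.1.1, h.1.2.trans h'.1.2⟩, fun δ hs ht =>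
    (h.2 δ hs ht).trans (h'.2 δ (hs.trans h.1.2) (ht.trans h.1.1))⟩

theorem vcomp_right {α α' β : N} (h : C.TrEquiv α α') (hβ : C.tgt α = C.src β) :
    C.TrEquiv (C.vcomp α β) (C.vcomp α' β) := by
  have hβ' : C.tgt α' = C.src β := h.1.2.symm.trans hβ
  refine ⟨⟨by simp [hβ, hβ', h.1.1], by simp [hβ, hβ']⟩, fun γ hs ht => ?_⟩
  simp only [hβ, C.src_vcomp, C.tgt_vcomp] at hs ht
  rw [C.pair_vcomp_left hβ hs.symm, C.pair_vcomp_left hβ' hs.symm]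
  exact h.2 _ (by simp [hs, hβ]) (by simp [hs, ht])

theorem vcomp_left {α β β' : N} (h : C.TrEquiv β β') (hα : C.tgt α = C.src β) :
    C.TrEquiv (C.vcomp α β) (C.vcomp α β') := by
  have hα' : C.tgt α = C.src β' := hα.trans h.1.1
  refine ⟨⟨by rw [C.src_vcomp _ _ hα, C.src_vcomp _ _ hα'],
    by rw [C.tgt_vcomp _ _ hα, C.tgt_vcomp _ _ hα', h.1.2]⟩, fun γ hs ht => ?_⟩
  rw [C.tgt_vcomp _ _ hα] at hs
  rw [C.src_vcomp _ _ hα] at ht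
  -- By cyclicity `α` passes from the left of `β` to the right of the test 2-morphism.
  have comm (β : N) (hα : C.tgt α = C.src β) (hs : C.src γ = C.tgt β) :
      C.pair (C.vcomp α β) γ = C.pair β (C.vcomp γ α) := by
    rw [C.pair_comm (by simp [hα, hs]) (by simp [hα, ht]), ← C.pair_vcomp_left ht hα,
      C.pair_comm (by simp [ht, hα]) (by simp [ht, hs])]
  rw [comm β hα hs, comm β' hα' (hs.trans h.1.2)]
  exact h.2 _ (by simp [ht, hs]) (by simp [ht, hα])

theorem star₂ {α β : N} (h : C.TrEquiv α β) : C.TrEquiv (C.star₂ α) (C.star₂ β) := by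
  refine ⟨⟨by simp [h.1.2], by simp [h.1.1]⟩, fun γ hs ht => ?_⟩
  simp only [C.src_star₂, C.tgt_star₂] at hs ht
  have comm (α : N) (hs : C.src γ = C.src α) (ht : C.tgt γ = C.tgt α) :
      C.pair (C.star₂ α) γ = C.star₂ (C.pair α (C.star₂ γ)) := by
    rw [C.star₂_pair (by simp [ht]) (by simp [hs]), C.star₂_star₂,
      C.pair_comm (by simp [hs]) (by simp [ht])]
  rw [comm α hs ht, comm β (hs.trans h.1.1) (ht.trans h.1.2),
    h.2 _ (by simp [ht]) (by simp [hs])]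

theorem dagger {α β : N} (h : C.TrEquiv α β) : C.TrEquiv (C.dagger α) (C.dagger β) := by
  -- `†` is self-adjoint for the pairing: `α† · γ` is the adjoint of `γ† · α`, and the trace does
  -- not see adjoints.
  have key (α γ : N) (hs : C.src γ = C.star₁ (C.src α)) (ht : C.tgt γ = C.star₁ (C.tgt α)) :
      C.pair (C.dagger α) γ = C.pair α (C.dagger γ) := by
    rw [C.pair_comm (β := C.dagger γ) (by simp [ht]) (by simp [hs]), pair_eq_tr, pair_eq_tr]
    conv_lhs => rw [← C.dagger_dagger γ, ← C.dagger_vcomp (by simp [hs])]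
    have e := C.tr_dagger (α := C.vcomp (C.dagger γ) α) (by simp [hs, ht])
    simpa [hs, ht] using e
  refine ⟨⟨by simp [h.1.2], by simp [h.1.1]⟩, fun γ hs ht => ?_⟩
  simp only [src_dagger, tgt_dagger] at hs ht
  rw [key α γ hs ht, key β γ (by rw [hs, h.1.1]) (by rw [ht, h.1.2])]
  exact h.2 _ (by simp [ht]) (by simp [hs])

/-- A test 2-morphism for the whiskered pair becomes, after partial trace over `f`, a test
2-morphism for the original pair. -/
theorem hcomp_id₂ {α β : N} {f : M} (h : C.TrEquiv α β) (hf : C.cod (C.src α) = C.dom f) :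
    C.TrEquiv (C.hcomp α (C.id₂ f)) (C.hcomp β (C.id₂ f)) := by
  have hf' : C.cod (C.src β) = C.dom f := by rw [← h.1.1, hf]
  refine ⟨⟨by simp [hf', h.1.1], by simp [hf, hf', h.1.2]⟩, fun γ hs ht => ?_⟩
  have e₁ : C.src (C.hcomp α (C.id₂ f)) = C.comp (C.src α) f := by simp [hf]
  have e₂ : C.src (C.hcomp β (C.id₂ f)) = C.comp (C.src β) f := by simp [hf']
  rw [e₁] at ht
  rw [C.tgt_hcomp _ _ (by simp [hf]), C.tgt_id₂] at hs
  rw [pair_eq_tr, pair_eq_tr, e₁, e₂, C.tr_hcomp_id₂ hf hs ht,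
    C.tr_hcomp_id₂ hf' (by rw [hs, h.1.2]) (by rw [ht, h.1.1]), ← h.1.1, ← h.1.2]
  have := h.2 (C.partialTr (C.tgt α) (C.src α) f γ)
    (by simp (maxDischargeDepth := 9) [partialTr, hf, hs, ht])
    (by simp (maxDischargeDepth := 9) [partialTr, hf, hs, ht])
  rwa [pair_eq_tr, pair_eq_tr, ← h.1.1] at this

/-- Conjugation by `†` exchanges the two sides of whiskering, and `†` respects the equivalence. -/
theorem id₂_hcomp {α β : N} {f : M} (h : C.TrEquiv α β) (hf : C.cod f = C.dom (C.src α)) :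
    C.TrEquiv (C.hcomp (C.id₂ f) α) (C.hcomp (C.id₂ f) β) := by
  have hf' : C.cod f = C.dom (C.src β) := by rw [← h.1.1, hf]
  rw [← C.dagger_dagger (C.hcomp (C.id₂ f) α), ← C.dagger_dagger (C.hcomp (C.id₂ f) β),
    C.dagger_id₂_hcomp hf, C.dagger_id₂_hcomp hf']
  exact (h.dagger.hcomp_id₂ (by simp [hf])).dagger

theorem vcomp {α α' β β' : N} (h : C.TrEquiv α α') (h' : C.TrEquiv β β')
    (hc : C.tgt α = C.src β) : C.TrEquiv (C.vcomp α β) (C.vcomp α' β') :=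
  (h.vcomp_right hc).trans (h'.vcomp_left (h.1.2.symm.trans hc))

theorem hcomp {α α' β β' : N} (h : C.TrEquiv α α') (h' : C.TrEquiv β β')
    (hc : C.cod (C.src α) = C.dom (C.src β)) : C.TrEquiv (C.hcomp α β) (C.hcomp α' β') := by
  have e (α β : N) (hc : C.cod (C.src α) = C.dom (C.src β)) : C.hcomp α β =
      C.vcomp (C.hcomp α (C.id₂ (C.src β))) (C.hcomp (C.id₂ (C.tgt α)) β) := by
    rw [← C.interchange _ _ _ _ (by simp) (by simp) (by simp [hc]), C.vcomp_id₂, C.id₂_vcomp]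
  rw [e α β hc, e α' β' (by rw [← h.1.1, ← h'.1.1, hc]), ← h'.1.1, ← h.1.2]
  exact (h.hcomp_id₂ hc).vcomp (h'.id₂_hcomp (by simp [hc])) (by simp [hc])

theorem rt₂ {α α' : N} (h : C.TrEquiv α α') (X : O) :
    C.TrEquiv (C.rt₂ α X) (C.rt₂ α' X) := by
  -- Naturality of the tensorator at `i_X`: as `i_X` starts at `I`, one side of the square contains
  -- `α` itself, not a tensor product of it. The closure properties already proved then apply.
  have e (α : N) : C.hcomp (C.id₂ (C.lt₁ (C.dom (C.src α)) (C.i X)))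
        (C.rt₂ α (C.tensor X (C.star₀ X))) =
      C.vcomp (C.tenInv (C.src α) (C.i X)) (C.vcomp (C.hcomp α
        (C.id₂ (C.lt₁ (C.cod (C.src α)) (C.i X)))) (C.ten (C.tgt α) (C.i X))) := by
    have n := C.ten_natural_left α (C.i X)
    simp only [C.dom_i, C.cod_i, C.rt₂_I] at n
    rw [n, ← C.vcomp_assoc _ _ _ (by simp) (by simp), C.tenInv_ten]
    simp
  have hw : C.TrEquiv (C.hcomp (C.id₂ (C.lt₁ (C.dom (C.src α)) (C.i X)))
        (C.rt₂ α (C.tensor X (C.star₀ X))))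
      (C.hcomp (C.id₂ (C.lt₁ (C.dom (C.src α)) (C.i X)))
        (C.rt₂ α' (C.tensor X (C.star₀ X)))) := by
    have e' := e α'
    rw [← h.1.1, ← h.1.2] at e'
    rw [e α, e']
    exact ((h.hcomp_id₂ (by simp)).vcomp_right (by simp)).vcomp_left (by simp)
  refine ⟨⟨by simp [h.1.1], by simp [h.1.2]⟩, fun γ hs ht => ?_⟩
  simp only [C.src_rt₂, C.tgt_rt₂] at hs ht
  -- By `tr_rt₁` the pairing of `α ⊗ X` with `γ` is the pairing of the whiskered 2-morphisms, so `γ`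
  -- is tensored with `X*` and whiskered likewise.
  have key := hw.2 (C.hcomp (C.id₂ (C.lt₁ (C.dom (C.src α)) (C.i X))) (C.rt₂ γ (C.star₀ X)))
    (by simp [hs]) (by simp [hs, ht])
  have hs' := hs
  rw [h.1.2] at hs'
  rw [pair_eq_tr, pair_eq_tr, C.src_rt₂, C.src_rt₂, ← h.1.1, C.tr_rt₁ (by simp [hs]),
    C.tr_rt₁ (by simp [hs', h.1.1])]
  simpa (maxDischargeDepth := 9) [pair_eq_tr, hs, hs', h.1.2, ← h.1.1] using key

theorem lt₂ {α α' : N} (h : C.TrEquiv α α') (X : O) :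
    C.TrEquiv (C.lt₂ X α) (C.lt₂ X α') := by
  -- The same argument on the other side, with `i_{X*} : I → X* ⊗ X` and the tensorator natural in
  -- its second argument.
  have e (α : N) : C.hcomp (C.id₂ (C.rt₁ (C.i (C.star₀ X)) (C.dom (C.src α))))
        (C.lt₂ (C.tensor (C.star₀ X) X) α) =
      C.vcomp (C.ten (C.i (C.star₀ X)) (C.src α)) (C.vcomp (C.hcomp α
        (C.id₂ (C.rt₁ (C.i (C.star₀ X)) (C.cod (C.src α)))))
        (C.tenInv (C.i (C.star₀ X)) (C.tgt α))) := by
    have n := C.ten_natural_right (C.i (C.star₀ X)) α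
    simp only [C.dom_i, C.cod_i, C.I_lt₂, star₀_star₀] at n
    rw [← C.vcomp_assoc _ _ _ (by simp) (by simp), ← n,
      C.vcomp_assoc _ _ _ (by simp) (by simp), C.ten_tenInv]
    simp
  have hw : C.TrEquiv (C.hcomp (C.id₂ (C.rt₁ (C.i (C.star₀ X)) (C.dom (C.src α))))
        (C.lt₂ (C.tensor (C.star₀ X) X) α))
      (C.hcomp (C.id₂ (C.rt₁ (C.i (C.star₀ X)) (C.dom (C.src α))))
        (C.lt₂ (C.tensor (C.star₀ X) X) α')) := by
    have e' := e α'
    rw [← h.1.1, ← h.1.2] at e'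
    rw [e α, e']
    exact ((h.hcomp_id₂ (by simp)).vcomp_right (by simp)).vcomp_left (by simp)
  refine ⟨⟨by simp [h.1.1], by simp [h.1.2]⟩, fun γ hs ht => ?_⟩
  simp only [C.src_lt₂, C.tgt_lt₂] at hs ht
  have key := hw.2 (C.hcomp (C.id₂ (C.rt₁ (C.i (C.star₀ X)) (C.dom (C.src α))))
    (C.lt₂ (C.star₀ X) γ)) (by simp [hs]) (by simp [hs, ht])
  have hs' := hs
  rw [h.1.2] at hs'
  rw [pair_eq_tr, pair_eq_tr, C.src_lt₂, C.src_lt₂, ← h.1.1, C.tr_lt₁ (by simp [hs])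
    (by simp [hs, ht]), C.tr_lt₁ (by simp [hs', h.1.1]) (by simp [hs', ht])]
  simpa (maxDischargeDepth := 9) [pair_eq_tr, hs, hs', h.1.2, ← h.1.1] using key

end TrEquiv

end SemistrictSpherical

/-! ### Linearity of the pairing, and `J` as its kernel -/

namespace LinearStructure

variable {F : Type u} [Field F] {O : Type u₁} {M : Type u₂} {N : Type u₃}
  {C : SemistrictMonoidal O M N} (L : LinearStructure F C)

theorem add_left_cancel {α β γ : N} (h : C.Par α β) (h' : C.Par β γ)
    (e : L.add α γ = L.add β γ) : α = β := by
  have cancel (α : N) (h : C.Par α γ) : L.add (L.add α γ) (L.neg γ) = α := by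
    rw [L.add_assoc _ _ _ h ⟨(L.src_neg γ).symm, (L.tgt_neg γ).symm⟩,
      L.add_comm _ _ ⟨(L.src_neg γ).symm, (L.tgt_neg γ).symm⟩, L.neg_add, ← h.1, ← h.2,
      L.add_comm, L.zero_add]
    exact ⟨(L.src_zero _ _ (by simp) (by simp)).symm, (L.tgt_zero _ _ (by simp) (by simp)).symm⟩
  rw [← cancel α ⟨h.1.trans h'.1, h.2.trans h'.2⟩, e, cancel β h']

end LinearStructure

namespace VectLinearSpherical

variable {F : Type u} [Field F] {O : Type u₁} {M : Type u₂} {N : Type u₃}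
  (C : VectLinearSpherical F O M N)

theorem rtr₂_add {α β : N} (h : C.Par α β) (he : C.cod (C.src α) = C.dom (C.src α)) :
    C.rtr₂ (C.lin.add α β) = C.lin.add (C.rtr₂ α) (C.rtr₂ β) := by
  simp only [DualityData.rtr₂, C.lin.src_add _ _ h, ← h.1]
  have h' : C.Par (C.rt₂ α (C.star₀ (C.dom (C.src α)))) (C.rt₂ β (C.star₀ (C.dom (C.src α)))) :=
    ⟨by simp [h.1], by simp [h.2]⟩
  rw [C.lin.rt₂_add _ _ _ h, C.lin.add_hcomp _ _ _ h' (by simp [he]), C.lin.hcomp_add]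
  · have hd : C.dom (C.src β) = C.dom (C.src α) := by rw [h.1]
    have hc : C.cod (C.src β) = C.dom (C.src α) := by rw [← h.1, he]
    exact ⟨by simp [hd, hc, h.1], by simp [hc, he, h.2]⟩
  · simp [he]

theorem rtr₂_smul {c : F} {α : N} (he : C.cod (C.src α) = C.dom (C.src α)) :
    C.rtr₂ (C.lin.smul c α) = C.lin.smul c (C.rtr₂ α) := by
  simp only [DualityData.rtr₂, C.lin.src_smul]
  rw [C.lin.rt₂_smul, C.lin.smul_hcomp _ _ _ (by simp [he]), C.lin.hcomp_smul]
  simp [he]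

/-- Linearity of vertical composition is available only for composable factors; this supplies the
two conditions for the three factors of the pairing. -/
theorem rtr₂_composable {α γ : N} {f : M} (h : C.src α = f) (h' : C.tgt α = C.src γ)
    (h'' : C.tgt γ = f) :
    C.src (C.rtr₂ (C.hcomp (C.vcomp α γ) (C.id₂ (C.star₁ f)))) = C.tgt (C.capR f) ∧
      C.tgt (C.rtr₂ (C.hcomp (C.vcomp α γ) (C.id₂ (C.star₁ f)))) = C.src (C.cupR f) := by
  subst h
  have hc : C.cod (C.src γ) = C.cod (C.src α) := by rw [← h', C.cod_tgt]
  have hd : C.dom (C.src γ) = C.dom (C.src α) := by rw [← h', C.dom_tgt]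
  constructor <;>
    simp (maxDischargeDepth := 9) [h', h'', hc, hd, DualityData.capR, DualityData.cupR,
      DualityData.rtr₂]

theorem pair_add {α β γ : N} (h : C.Par α β) (hs : C.src γ = C.tgt α) (ht : C.tgt γ = C.src α) :
    C.pair (C.lin.add α β) γ = C.lin.add (C.pair α γ) (C.pair β γ) := by
  have hβ : C.tgt β = C.src γ := h.2.symm.trans hs.symm
  simp only [DualityData.pair, C.lin.src_add _ _ h, h.1.symm]
  have h₁ : C.Par (C.vcomp α γ) (C.vcomp β γ) :=
    ⟨by rw [C.src_vcomp _ _ hs.symm, C.src_vcomp _ _ hβ, h.1],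
      by rw [C.tgt_vcomp _ _ hs.symm, C.tgt_vcomp _ _ hβ]⟩
  have h₂ : C.Par (C.hcomp (C.vcomp α γ) (C.id₂ (C.star₁ (C.src α))))
      (C.hcomp (C.vcomp β γ) (C.id₂ (C.star₁ (C.src α)))) := by
    have hd : C.cod (C.src (C.vcomp α γ)) = C.cod (C.src α) := by rw [C.src_vcomp _ _ hs.symm]
    have hd' : C.cod (C.src (C.vcomp β γ)) = C.cod (C.src α) := by rw [← h₁.1, hd]
    constructor
    · rw [C.src_hcomp _ _ (by simp [hd]), C.src_hcomp _ _ (by simp [hd']), h₁.1]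
    · rw [C.tgt_hcomp _ _ (by simp [hd]), C.tgt_hcomp _ _ (by simp [hd']), h₁.2]
  obtain ⟨a₁, a₂⟩ := C.rtr₂_composable rfl hs.symm ht
  obtain ⟨b₁, b₂⟩ := C.rtr₂_composable h.1.symm hβ ht
  rw [C.lin.add_vcomp _ _ _ h hs.symm, C.lin.add_hcomp _ _ _ h₁ (by simp [hs]),
    C.rtr₂_add h₂ (by simp [hs]), C.lin.add_vcomp _ _ _ ⟨a₁.trans b₁.symm, a₂.trans b₂.symm⟩ a₂,
    C.lin.vcomp_add]
  · exact ⟨by rw [C.src_vcomp _ _ a₂, C.src_vcomp _ _ b₂, a₁, b₁],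
      by rw [C.tgt_vcomp _ _ a₂, C.tgt_vcomp _ _ b₂]⟩
  · rw [C.src_vcomp _ _ a₂, a₁]

theorem pair_smul {c : F} {α γ : N} (hs : C.src γ = C.tgt α) (ht : C.tgt γ = C.src α) :
    C.pair (C.lin.smul c α) γ = C.lin.smul c (C.pair α γ) := by
  simp only [DualityData.pair, C.lin.src_smul]
  rw [C.lin.smul_vcomp _ _ _ hs.symm, C.lin.smul_hcomp, rtr₂_smul, C.lin.smul_vcomp,
    C.lin.vcomp_smul]
  all_goals
    simp (maxDischargeDepth := 9) [hs, ht, DualityData.capR, DualityData.cupR, DualityData.rtr₂]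

theorem src_pair {α γ : N} (hs : C.src γ = C.tgt α) (ht : C.tgt γ = C.src α) :
    C.src (C.pair α γ) = C.id₁ C.I := by
  simp (maxDischargeDepth := 9) [DualityData.pair, hs, ht, DualityData.capR, DualityData.cupR,
    DualityData.rtr₂]

theorem tgt_pair {α γ : N} (hs : C.src γ = C.tgt α) (ht : C.tgt γ = C.src α) :
    C.tgt (C.pair α γ) = C.id₁ C.I := by
  simp (maxDischargeDepth := 9) [DualityData.pair, hs, ht, DualityData.capR, DualityData.cupR,
    DualityData.rtr₂]

/-- Additivity gives `⟨0, γ⟩ = ⟨0, γ⟩ + ⟨0, γ⟩`, from which one summand is cancelled. -/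
theorem pair_zero {f g : M} {γ : N} (h : C.dom f = C.dom g) (h' : C.cod f = C.cod g)
    (hs : C.src γ = g) (ht : C.tgt γ = f) :
    C.pair (C.lin.zero f g) γ = C.lin.zero (C.id₁ C.I) (C.id₁ C.I) := by
  have a := C.lin.src_zero f g h h'
  have b := C.lin.tgt_zero f g h h'
  have e := C.pair_add (α := C.lin.zero f g) (β := C.lin.zero f g) (γ := γ) ⟨rfl, rfl⟩
    (by rw [hs, b]) (by rw [ht, a])
  have z := C.lin.zero_add (C.lin.zero f g)
  have p := C.src_pair (α := C.lin.zero f g) (γ := γ) (by rw [hs, b]) (by rw [ht, a])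
  have q := C.tgt_pair (α := C.lin.zero f g) (γ := γ) (by rw [hs, b]) (by rw [ht, a])
  have z' := C.lin.zero_add (C.pair (C.lin.zero f g) γ)
  have par : C.Par (C.pair (C.lin.zero f g) γ) (C.lin.zero (C.id₁ C.I) (C.id₁ C.I)) :=
    ⟨by rw [p, C.lin.src_zero _ _ rfl rfl], by rw [q, C.lin.tgt_zero _ _ rfl rfl]⟩
  rw [a, b] at z
  rw [p, q] at z'
  rw [z] at e
  refine C.lin.add_left_cancel par ⟨par.1.symm, par.2.symm⟩ (e.symm.trans z'.symm)

/-- Two 2-morphisms are identified in `C/J` if and only if they pair equally with all others. -/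
theorem jRel_iff {α β : N} : C.JRel α β ↔ C.TrEquiv α β := by
  refine and_congr_right fun h => ?_
  have hn : C.Par α (C.lin.neg β) := ⟨by rw [C.lin.src_neg, h.1], by rw [C.lin.tgt_neg, h.2]⟩
  -- `⟨-β, γ⟩` is the additive inverse of `⟨β, γ⟩`; hence `α - β` pairs to zero with `γ` exactly
  -- when `α` and `β` pair equally with it.
  have key (γ : N) (hs : C.src γ = C.tgt α) (ht : C.tgt γ = C.src α) :
      C.lin.add (C.pair β γ) (C.pair (C.lin.neg β) γ) = C.lin.zero (C.id₁ C.I) (C.id₁ C.I) := by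
    rw [← C.pair_add ⟨(C.lin.src_neg β).symm, (C.lin.tgt_neg β).symm⟩ (hs.trans h.2)
        (ht.trans h.1), C.lin.add_comm _ _ ⟨(C.lin.src_neg β).symm, (C.lin.tgt_neg β).symm⟩,
      C.lin.neg_add, C.pair_zero (by simp) (by simp) (hs.trans h.2) (ht.trans h.1)]
  constructor
  · intro hJ γ hs ht
    have e := hJ γ (by rw [C.lin.tgt_add _ _ hn, hs]) (by rw [C.lin.src_add _ _ hn, ht])
    rw [C.pair_add hn hs ht, ← key γ hs ht] at e
    refine C.lin.add_left_cancel ?_ ?_ e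
    · exact ⟨by rw [C.src_pair hs ht, C.src_pair (hs.trans h.2) (ht.trans h.1)],
        by rw [C.tgt_pair hs ht, C.tgt_pair (hs.trans h.2) (ht.trans h.1)]⟩
    · have hs' := hs.trans hn.2
      have ht' := ht.trans hn.1
      exact ⟨by rw [C.src_pair (hs.trans h.2) (ht.trans h.1), C.src_pair hs' ht'],
        by rw [C.tgt_pair (hs.trans h.2) (ht.trans h.1), C.tgt_pair hs' ht']⟩
  · intro hT γ hs ht
    rw [C.lin.tgt_add _ _ hn] at hs
    rw [C.lin.src_add _ _ hn] at ht
    rw [C.pair_add hn hs ht, hT γ hs ht, key γ hs ht]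

theorem trEquiv_add {α α' β β' : N} (h : C.TrEquiv α α') (h' : C.TrEquiv β β')
    (hp : C.Par α β) : C.TrEquiv (C.lin.add α β) (C.lin.add α' β') := by
  have hp' : C.Par α' β' :=
    ⟨h.1.1.symm.trans (hp.1.trans h'.1.1), h.1.2.symm.trans (hp.2.trans h'.1.2)⟩
  refine ⟨⟨by rw [C.lin.src_add _ _ hp, C.lin.src_add _ _ hp', h.1.1],
    by rw [C.lin.tgt_add _ _ hp, C.lin.tgt_add _ _ hp', h.1.2]⟩, fun γ hs ht => ?_⟩
  rw [C.lin.tgt_add _ _ hp] at hs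
  rw [C.lin.src_add _ _ hp] at ht
  rw [C.pair_add hp hs ht, C.pair_add hp' (hs.trans h.1.2) (ht.trans h.1.1), h.2 γ hs ht,
    h'.2 γ (hs.trans hp.2) (ht.trans hp.1)]

theorem trEquiv_smul {α α' : N} (c : F) (h : C.TrEquiv α α') :
    C.TrEquiv (C.lin.smul c α) (C.lin.smul c α') := by
  refine ⟨⟨by rw [C.lin.src_smul, C.lin.src_smul, h.1.1],
    by rw [C.lin.tgt_smul, C.lin.tgt_smul, h.1.2]⟩, fun γ hs ht => ?_⟩
  rw [C.lin.tgt_smul] at hs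
  rw [C.lin.src_smul] at ht
  rw [C.pair_smul hs ht, C.pair_smul (hs.trans h.1.2) (ht.trans h.1.1), h.2 γ hs ht]

theorem zero_smul (α : N) : C.lin.smul 0 α = C.lin.zero (C.src α) (C.tgt α) := by
  have p₀ : C.Par (C.lin.smul 0 α) (C.lin.zero (C.src α) (C.tgt α)) :=
    ⟨by rw [C.lin.src_smul, C.lin.src_zero _ _ (by simp) (by simp)],
      by rw [C.lin.tgt_smul, C.lin.tgt_zero _ _ (by simp) (by simp)]⟩
  refine C.lin.add_left_cancel p₀ ⟨p₀.1.symm, p₀.2.symm⟩ ?_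
  have z := C.lin.zero_add (C.lin.smul 0 α)
  rw [C.lin.src_smul, C.lin.tgt_smul] at z
  rw [z, ← C.lin.add_smul, zero_add]

/-- Compatibility of negation with the congruence thus follows from that of scalar multiplication.
-/
theorem neg_eq_smul (α : N) : C.lin.neg α = C.lin.smul (-1) α := by
  have par : C.Par (C.lin.neg α) α := ⟨C.lin.src_neg α, C.lin.tgt_neg α⟩
  have par' : C.Par (C.lin.smul (-1) α) α := ⟨C.lin.src_smul _ α, C.lin.tgt_smul _ α⟩
  refine C.lin.add_left_cancel ⟨par.1.trans par'.1.symm, par.2.trans par'.2.symm⟩ par' ?_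
  have e := C.lin.add_smul (-1) 1 α
  rw [C.lin.one_smul, neg_add_cancel, zero_smul] at e
  rw [C.lin.neg_add, e]

theorem trEquiv_neg {α α' : N} (h : C.TrEquiv α α') :
    C.TrEquiv (C.lin.neg α) (C.lin.neg α') := by
  rw [neg_eq_smul, neg_eq_smul]
  exact C.trEquiv_smul _ h

end VectLinearSpherical

/-! ### The quotient as a monoidal 2-category with duals -/

namespace VectLinearSpherical

variable {F : Type u} [Field F] {O : Type u₁} {M : Type u₂} {N : Type u₃}
  (C : VectLinearSpherical F O M N)

theorem jRel_equivalence : Equivalence C.JRel where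
  refl α := C.jRel_iff.2 (.refl α)
  symm h := C.jRel_iff.2 (C.jRel_iff.1 h).symm
  trans h h' := C.jRel_iff.2 ((C.jRel_iff.1 h).trans (C.jRel_iff.1 h'))

theorem proj_eq_proj {α β : N} : C.proj α = C.proj β ↔ C.JRel α β :=
  C.jRel_equivalence.quot_mk_eq_iff α β

theorem proj_eq {α β : N} (h : C.TrEquiv α β) : C.proj α = C.proj β :=
  C.proj_eq_proj.2 (C.jRel_iff.2 h)

theorem forall_quotCell {p : C.QuotCell → Prop} : (∀ x, p x) ↔ ∀ α, p (C.proj α) :=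
  ⟨fun h _ => h _, fun h x => Quot.ind h x⟩

/-- A representative of a 2-morphism of `C/J`. -/
noncomputable def rep (x : C.QuotCell) : N := Quot.out x

@[simp] theorem proj_rep (x : C.QuotCell) : C.proj (C.rep x) = x := Quot.out_eq x

/-- The operations on classes are those of `C` on chosen representatives. This lemma and the
congruence properties make the choice immaterial on composable arguments, the only ones the axioms
speak about. -/
theorem rep_proj (α : N) : C.TrEquiv (C.rep (C.proj α)) α :=
  C.jRel_iff.1 (C.proj_eq_proj.1 (Quot.out_eq (C.proj α)))

@[simp] theorem src_rep (α : N) : C.src (C.rep (C.proj α)) = C.src α := (C.rep_proj α).1.1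

@[simp] theorem tgt_rep (α : N) : C.tgt (C.rep (C.proj α)) = C.tgt α := (C.rep_proj α).1.2

@[simp] theorem proj_vcomp_rep {α β : N} (h : C.tgt α = C.src β) :
    C.proj (C.vcomp (C.rep (C.proj α)) (C.rep (C.proj β))) = C.proj (C.vcomp α β) :=
  C.proj_eq ((C.rep_proj α).vcomp (C.rep_proj β) (by simp [h]))

@[simp] theorem proj_hcomp_rep {α β : N} (h : C.cod (C.src α) = C.dom (C.src β)) :
    C.proj (C.hcomp (C.rep (C.proj α)) (C.rep (C.proj β))) = C.proj (C.hcomp α β) :=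
  C.proj_eq ((C.rep_proj α).hcomp (C.rep_proj β) (by simp [h]))

@[simp] theorem proj_lt₂_rep (A : O) (α : N) :
    C.proj (C.lt₂ A (C.rep (C.proj α))) = C.proj (C.lt₂ A α) :=
  C.proj_eq ((C.rep_proj α).lt₂ A)

@[simp] theorem proj_rt₂_rep (α : N) (A : O) :
    C.proj (C.rt₂ (C.rep (C.proj α)) A) = C.proj (C.rt₂ α A) :=
  C.proj_eq ((C.rep_proj α).rt₂ A)

@[simp] theorem proj_star₂_rep (α : N) :
    C.proj (C.star₂ (C.rep (C.proj α))) = C.proj (C.star₂ α) :=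
  C.proj_eq (C.rep_proj α).star₂

/-- The strict 2-category underlying `C/J`. -/
noncomputable def quotCat : Strict2Cat O M C.QuotCell where
  dom := C.dom
  cod := C.cod
  src x := C.src (C.rep x)
  tgt x := C.tgt (C.rep x)
  id₁ := C.id₁
  comp := C.comp
  id₂ f := C.proj (C.id₂ f)
  vcomp x y := C.proj (C.vcomp (C.rep x) (C.rep y))
  hcomp x y := C.proj (C.hcomp (C.rep x) (C.rep y))
  dom_tgt x := C.dom_tgt _
  cod_tgt x := C.cod_tgt _
  dom_id₁ := C.dom_id₁
  cod_id₁ := C.cod_id₁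
  dom_comp := C.dom_comp
  cod_comp := C.cod_comp
  id₁_comp := C.id₁_comp
  comp_id₁ := C.comp_id₁
  comp_assoc := C.comp_assoc
  src_id₂ f := by simp
  tgt_id₂ f := by simp
  src_vcomp := by simp +contextual
  tgt_vcomp := by simp +contextual
  id₂_vcomp := by simp [forall_quotCell]
  vcomp_id₂ := by simp [forall_quotCell]
  vcomp_assoc := by
    simp only [forall_quotCell, src_rep, tgt_rep]
    intro α β γ h h'
    rw [C.proj_vcomp_rep h, C.proj_vcomp_rep h', C.proj_vcomp_rep (by simp [h, h']),
      C.proj_vcomp_rep (by simp [h, h']), C.vcomp_assoc _ _ _ h h']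
  src_hcomp := by simp +contextual
  tgt_hcomp := by simp +contextual
  id₁_hcomp := by simp [forall_quotCell]
  hcomp_id₁ := by simp [forall_quotCell]
  hcomp_assoc := by
    simp only [forall_quotCell, src_rep]
    intro α β γ h h'
    rw [C.proj_hcomp_rep h, C.proj_hcomp_rep h', C.proj_hcomp_rep (by simp [h, h']),
      C.proj_hcomp_rep (by simp [h, h']), C.hcomp_assoc _ _ _ h h']
  hcomp_id₂ f g h := by simp [h]
  interchange := by
    simp only [forall_quotCell, src_rep, tgt_rep]
    intro α α' β β' h h' h''
    have hα : C.cod (C.src α') = C.cod (C.src α) := by rw [← h]; simp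
    have hβ : C.dom (C.src β') = C.dom (C.src β) := by rw [← h']; simp
    rw [C.proj_vcomp_rep h, C.proj_vcomp_rep h', C.proj_hcomp_rep (by simp [h, h', h'']),
      C.proj_hcomp_rep h'', C.proj_hcomp_rep (by rw [hα, hβ, h'']),
      C.proj_vcomp_rep (by simp [h, h', h'', hα, hβ]), C.interchange _ _ _ _ h h' h'']

@[simp] theorem quotCat_dom : C.quotCat.dom = C.dom := rfl

@[simp] theorem quotCat_cod : C.quotCat.cod = C.cod := rfl

@[simp] theorem quotCat_id₁ : C.quotCat.id₁ = C.id₁ := rfl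

@[simp] theorem quotCat_comp : C.quotCat.comp = C.comp := rfl

@[simp] theorem quotCat_id₂ (f : M) : C.quotCat.id₂ f = C.proj (C.id₂ f) := rfl

@[simp] theorem quotCat_src (α : N) : C.quotCat.src (C.proj α) = C.src α := C.src_rep α

@[simp] theorem quotCat_tgt (α : N) : C.quotCat.tgt (C.proj α) = C.tgt α := C.tgt_rep α

@[simp] theorem quotCat_vcomp {α β : N} (h : C.tgt α = C.src β) :
    C.quotCat.vcomp (C.proj α) (C.proj β) = C.proj (C.vcomp α β) := C.proj_vcomp_rep h

@[simp] theorem quotCat_hcomp {α β : N} (h : C.cod (C.src α) = C.dom (C.src β)) :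
    C.quotCat.hcomp (C.proj α) (C.proj β) = C.proj (C.hcomp α β) := C.proj_hcomp_rep h

/-- The semi-strict monoidal 2-category underlying `C/J`. -/
noncomputable def quotMonoidal : SemistrictMonoidal O M C.QuotCell where
  toStrict2Cat := C.quotCat
  I := C.I
  tensor := C.tensor
  lt₁ := C.lt₁
  rt₁ := C.rt₁
  lt₂ A x := C.proj (C.lt₂ A (C.rep x))
  rt₂ x A := C.proj (C.rt₂ (C.rep x) A)
  ten f g := C.proj (C.ten f g)
  tenInv f g := C.proj (C.tenInv f g)
  dom_lt₁ := C.dom_lt₁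
  cod_lt₁ := C.cod_lt₁
  dom_rt₁ := C.dom_rt₁
  cod_rt₁ := C.cod_rt₁
  src_lt₂ := by simp [quotCat]
  tgt_lt₂ := by simp [quotCat]
  src_rt₂ := by simp [quotCat]
  tgt_rt₂ := by simp [quotCat]
  lt₁_id₁ := C.lt₁_id₁
  rt₁_id₁ := C.rt₁_id₁
  lt₁_comp := C.lt₁_comp
  rt₁_comp := C.rt₁_comp
  lt₂_id₂ := by simp
  rt₂_id₂ := by simp
  lt₂_vcomp := by simp +contextual [forall_quotCell]
  rt₂_vcomp := by simp +contextual [forall_quotCell]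
  lt₂_hcomp := by simp +contextual [forall_quotCell]
  rt₂_hcomp := by simp +contextual [forall_quotCell]
  I_tensor := C.I_tensor
  tensor_I := C.tensor_I
  I_lt₁ := C.I_lt₁
  rt₁_I := C.rt₁_I
  I_lt₂ := by simp
  rt₂_I := by simp
  tensor_assoc := C.tensor_assoc
  lt₁_lt₁ := C.lt₁_lt₁
  lt₁_rt₁ := C.lt₁_rt₁
  rt₁_rt₁ := C.rt₁_rt₁
  lt₂_lt₂ := by simp
  lt₂_rt₂ := by simp
  rt₂_rt₂ := by simp
  src_ten := by simp
  tgt_ten := by simp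
  src_tenInv := by simp
  tgt_tenInv := by simp
  ten_tenInv f g := by simp [C.ten_tenInv]
  tenInv_ten f g := by simp [C.tenInv_ten]
  ten_lt₁_left := by simp [C.ten_lt₁_left]
  ten_rt₁_left := by simp [C.ten_rt₁_left]
  ten_rt₁_right := by simp [C.ten_rt₁_right]
  ten_id₁_left := by simp [C.ten_id₁_left]
  ten_id₁_right := by simp [C.ten_id₁_right]
  ten_comp_left f f' g h := by
    have := congrArg C.proj (C.ten_comp_left f f' g h)
    simpa (maxDischargeDepth := 9) [show C.cod f = C.dom f' from h] using this
  ten_comp_right f g g' h := by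
    have := congrArg C.proj (C.ten_comp_right f g g' h)
    simpa (maxDischargeDepth := 9) [show C.cod g = C.dom g' from h] using this
  ten_natural_left := by
    simp only [forall_quotCell]
    intro α g
    have := congrArg C.proj (C.ten_natural_left α g)
    simpa using this
  ten_natural_right f := by
    simp only [forall_quotCell]
    intro α
    have := congrArg C.proj (C.ten_natural_right f α)
    simpa using this

@[simp] theorem quotMonoidal_toStrict2Cat : C.quotMonoidal.toStrict2Cat = C.quotCat := rfl

@[simp] theorem quotMonoidal_I : C.quotMonoidal.I = C.I := rfl

@[simp] theorem quotMonoidal_tensor : C.quotMonoidal.tensor = C.tensor := rfl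

@[simp] theorem quotMonoidal_lt₁ : C.quotMonoidal.lt₁ = C.lt₁ := rfl

@[simp] theorem quotMonoidal_rt₁ : C.quotMonoidal.rt₁ = C.rt₁ := rfl

@[simp] theorem quotMonoidal_lt₂ (A : O) (α : N) :
    C.quotMonoidal.lt₂ A (C.proj α) = C.proj (C.lt₂ A α) := C.proj_lt₂_rep A α

@[simp] theorem quotMonoidal_rt₂ (α : N) (A : O) :
    C.quotMonoidal.rt₂ (C.proj α) A = C.proj (C.rt₂ α A) := C.proj_rt₂_rep α A

@[simp] theorem quotMonoidal_ten (f g : M) : C.quotMonoidal.ten f g = C.proj (C.ten f g) := rfl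

@[simp] theorem quotMonoidal_tenInv (f g : M) :
    C.quotMonoidal.tenInv f g = C.proj (C.tenInv f g) := rfl

/-- The duality operations of `C/J`. -/
noncomputable def quotData : DualityData O M C.QuotCell where
  toSemistrictMonoidal := C.quotMonoidal
  star₀ := C.star₀
  star₁ := C.star₁
  star₂ x := C.proj (C.star₂ (C.rep x))
  η f := C.proj (C.η f)
  ε f := C.proj (C.ε f)
  i := C.i
  e := C.e
  T A := C.proj (C.T A)
  dom_star₁ := C.dom_star₁
  cod_star₁ := C.cod_star₁
  src_star₂ := by simp [forall_quotCell]
  tgt_star₂ := by simp [forall_quotCell]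
  src_η := by simp
  tgt_η := by simp
  src_ε := by simp
  tgt_ε := by simp
  dom_i := C.dom_i
  cod_i := C.cod_i
  dom_e := C.dom_e
  cod_e := C.cod_e
  src_T := by simp
  tgt_T := by simp

@[simp] theorem quotData_toSemistrictMonoidal :
    C.quotData.toSemistrictMonoidal = C.quotMonoidal := rfl

@[simp] theorem quotData_star₀ : C.quotData.star₀ = C.star₀ := rfl

@[simp] theorem quotData_star₁ : C.quotData.star₁ = C.star₁ := rfl

@[simp] theorem quotData_star₂ (α : N) : C.quotData.star₂ (C.proj α) = C.proj (C.star₂ α) :=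
  C.proj_star₂_rep α

@[simp] theorem quotData_η (f : M) : C.quotData.η f = C.proj (C.η f) := rfl

@[simp] theorem quotData_ε (f : M) : C.quotData.ε f = C.proj (C.ε f) := rfl

@[simp] theorem quotData_i : C.quotData.i = C.i := rfl

@[simp] theorem quotData_e : C.quotData.e = C.e := rfl

@[simp] theorem quotData_T (A : O) : C.quotData.T A = C.proj (C.T A) := rfl

theorem isUnitary_proj {α : N} (h : C.IsUnitary α) : C.quotData.IsUnitary (C.proj α) := by
  simp [DualityData.IsUnitary, h.1, h.2]

@[simp] theorem quotData_dagger (α : N) :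
    C.quotData.dagger (C.proj α) = C.proj (C.dagger α) := by
  simp (maxDischargeDepth := 9) [DualityData.dagger]

@[simp] theorem quotData_ldagger (α : N) :
    C.quotData.ldagger (C.proj α) = C.proj (C.ldagger α) := by
  simp (maxDischargeDepth := 9) [DualityData.ldagger]

theorem quotData_isDuality : C.quotData.IsDuality where
  star₀_star₀ := C.isDuality.star₀_star₀
  star₁_star₁ := C.isDuality.star₁_star₁
  star₂_star₂ := by simp [forall_quotCell]
  star₁_id₁ := C.isDuality.star₁_id₁
  star₂_id₂ := by simp
  star₂_vcomp := by simp +contextual [forall_quotCell]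
  star₂_hcomp := by simp +contextual [forall_quotCell]
  star₁_comp := C.isDuality.star₁_comp
  star₂_lt₂ := by simp [forall_quotCell]
  star₁_lt₁ := C.isDuality.star₁_lt₁
  star₂_rt₂ := by simp [forall_quotCell]
  star₁_rt₁ := C.isDuality.star₁_rt₁
  star₀_tensor := C.isDuality.star₀_tensor
  ten_unitary f g := C.isUnitary_proj (C.isDuality.ten_unitary f g)
  i_star₀ := C.isDuality.i_star₀
  e_star₀ := C.isDuality.e_star₀
  η_star₁ := by simp
  ε_star₁ := by simp
  T_unitary A := C.isUnitary_proj (C.isDuality.T_unitary A)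
  tensor_i := C.isDuality.tensor_i
  tensor_e := C.isDuality.tensor_e
  tensor_T A B := by
    have := congrArg C.proj (C.isDuality.tensor_T A B)
    simpa (maxDischargeDepth := 9) using this
  T_I := congrArg C.proj C.isDuality.T_I
  η_lt₁ := by simp [C.isDuality.η_lt₁]
  η_rt₁ := by simp [C.isDuality.η_rt₁]
  ε_lt₁ := by simp [C.isDuality.ε_lt₁]
  ε_rt₁ := by simp [C.isDuality.ε_rt₁]
  η_comp f g h := by
    have := congrArg C.proj (C.isDuality.η_comp f g h)
    simpa (maxDischargeDepth := 9) [show C.cod f = C.dom g from h] using this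
  ε_comp f g h := by
    have := congrArg C.proj (C.isDuality.ε_comp f g h)
    simpa (maxDischargeDepth := 9) [show C.cod f = C.dom g from h] using this
  triangle f := by
    have := congrArg C.proj (C.isDuality.triangle f)
    simpa (maxDischargeDepth := 9) using this
  triangle_star f := by
    have := congrArg C.proj (C.isDuality.triangle_star f)
    simpa (maxDischargeDepth := 9) using this
  dagger_star := by simp [forall_quotCell, C.isDuality.dagger_star]
  i_T A := by
    have := congrArg C.proj (C.isDuality.i_T A)
    simpa (maxDischargeDepth := 9) using this

@[simp] theorem quotData_lsharp₁ : C.quotData.lsharp₁ = C.lsharp₁ := rfl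

@[simp] theorem quotData_rsharp₁ : C.quotData.rsharp₁ = C.rsharp₁ := rfl

@[simp] theorem quotData_ltr₁ : C.quotData.ltr₁ = C.ltr₁ := rfl

@[simp] theorem quotData_rtr₁ : C.quotData.rtr₁ = C.rtr₁ := rfl

@[simp] theorem quotData_lsharp₂ (α : N) :
    C.quotData.lsharp₂ (C.proj α) = C.proj (C.lsharp₂ α) := by
  simp (maxDischargeDepth := 9) [DualityData.lsharp₂]

@[simp] theorem quotData_rsharp₂ (α : N) :
    C.quotData.rsharp₂ (C.proj α) = C.proj (C.rsharp₂ α) := by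
  simp (maxDischargeDepth := 9) [DualityData.rsharp₂]

@[simp] theorem quotData_ltr₂ {α : N} (h : C.cod (C.src α) = C.dom (C.src α)) :
    C.quotData.ltr₂ (C.proj α) = C.proj (C.ltr₂ α) := by
  simp (maxDischargeDepth := 9) [DualityData.ltr₂, h]

@[simp] theorem quotData_rtr₂ {α : N} (h : C.cod (C.src α) = C.dom (C.src α)) :
    C.quotData.rtr₂ (C.proj α) = C.proj (C.rtr₂ α) := by
  simp (maxDischargeDepth := 9) [DualityData.rtr₂, h]

@[simp] theorem quotData_capR (f : M) : C.quotData.capR f = C.proj (C.capR f) := rfl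

@[simp] theorem quotData_capL (f : M) : C.quotData.capL f = C.proj (C.capL f) := rfl

@[simp] theorem quotData_cupR (f : M) : C.quotData.cupR f = C.proj (C.cupR f) := by
  simp [DualityData.cupR]

@[simp] theorem quotData_cupL (f : M) : C.quotData.cupL f = C.proj (C.cupL f) := by
  simp [DualityData.cupL]

theorem quotData_lsharpComp {f g : M} (h : C.cod f = C.dom g) :
    C.quotData.lsharpComp f g = C.proj (C.lsharpComp f g) := by
  simp (maxDischargeDepth := 15) [DualityData.lsharpComp, h, DualityData.lsharp₁]

theorem quotData_rsharpComp {f g : M} (h : C.cod f = C.dom g) :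
    C.quotData.rsharpComp f g = C.proj (C.rsharpComp f g) := by
  simp (maxDischargeDepth := 15) [DualityData.rsharpComp, h, DualityData.rsharp₁]

theorem quotData_thetaR {f g : M} (h : C.cod f = C.dom g) (h' : C.cod g = C.dom f) :
    C.quotData.thetaR (fun f => C.proj (C.φ f)) f g = C.proj (C.thetaR C.φ f g) := by
  simp (maxDischargeDepth := 15) [DualityData.thetaR, h, h', DualityData.lsharp₁,
    DualityData.rsharp₁]

theorem quotData_thetaL {f g : M} (h : C.cod f = C.dom g) (h' : C.cod g = C.dom f) :
    C.quotData.thetaL (fun f => C.proj (C.φ f)) f g = C.proj (C.thetaL C.φ f g) := by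
  simp (maxDischargeDepth := 15) [DualityData.thetaL, h, h', DualityData.lsharp₁,
    DualityData.rsharp₁]

end VectLinearSpherical

/-! ### Pivotal, spherical and linear structure on the quotient -/

namespace VectLinearSpherical

variable {F : Type u} [Field F] {O : Type u₁} {M : Type u₂} {N : Type u₃}
  (C : VectLinearSpherical F O M N)

theorem quotData_isPivotal : C.quotData.IsPivotal (fun f => C.proj (C.φ f)) where
  src_φ := by simp
  tgt_φ := by simp
  φ_unitary f := C.isUnitary_proj (C.isPivotal.φ_unitary f)
  φ_natural := by
    simp only [forall_quotCell]
    intro α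
    have h₁ : C.tgt (C.lsharp₂ α) = C.lsharp₁ (C.tgt α) := by
      simp (maxDischargeDepth := 9) [DualityData.lsharp₂, DualityData.lsharp₁]
    have h₂ : C.src (C.rsharp₂ α) = C.rsharp₁ (C.src α) := by
      simp (maxDischargeDepth := 9) [DualityData.rsharp₂, DualityData.rsharp₁]
    simpa [h₁, h₂] using congrArg C.proj (C.isPivotal.φ_natural α)
  φ_dagger f := by simp [C.isPivotal.φ_dagger f]
  φ_comp f g h := by
    have h' : C.cod f = C.dom g := h
    have e := congrArg C.proj (C.isPivotal.φ_comp f g h')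
    have h₁ : C.src (C.rsharpComp f g) = C.rsharp₁ (C.comp f g) := by
      simp (maxDischargeDepth := 15) [DualityData.rsharpComp, h', DualityData.rsharp₁]
    have h₂ : C.tgt (C.lsharpComp f g) = C.comp (C.lsharp₁ g) (C.lsharp₁ f) := by
      simp (maxDischargeDepth := 15) [DualityData.lsharpComp, h', DualityData.lsharp₁]
    rw [C.quotData_rsharpComp h', C.quotData_lsharpComp h']
    simpa [h₁, h₂, h'] using e
  lsharp_dagger := by simp [forall_quotCell, C.isPivotal.lsharp_dagger]
  dagger_lsharp := by simp [forall_quotCell, C.isPivotal.dagger_lsharp]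

theorem quotData_isConsistent : C.quotData.IsConsistent (fun f => C.proj (C.φ f)) where
  capR_theta f := by
    have e := congrArg C.proj (C.isConsistent.capR_theta f)
    have h := C.src_thetaR (f := f) (g := C.star₁ f) (by simp) (by simp)
    simp only [quotData_star₁, quotData_capR, C.quotData_thetaR (f := f) (g := C.star₁ f)
      (by simp) (by simp)]
    rw [← e]
    simp (maxDischargeDepth := 9) [h, DualityData.capR, DualityData.rtr₁]
  theta_cupR f := by
    have e := congrArg C.proj (C.isConsistent.theta_cupR f)
    have h := C.tgt_thetaR (f := f) (g := C.star₁ f) (by simp) (by simp)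
    simp only [quotData_star₁, quotData_cupR, C.quotData_thetaR (f := f) (g := C.star₁ f)
      (by simp) (by simp)]
    rw [← e]
    simp (maxDischargeDepth := 9) [h, DualityData.cupR, DualityData.capR, DualityData.rtr₁]
  capL_theta f := by
    have e := congrArg C.proj (C.isConsistent.capL_theta f)
    have h : C.src (C.thetaL C.φ f (C.star₁ f)) = C.ltr₁ (C.comp f (C.star₁ f)) := by
      simp (maxDischargeDepth := 15) [DualityData.thetaL, DualityData.ltr₁, DualityData.lsharp₁,
        DualityData.rsharp₁]
    simp only [quotData_star₁, quotData_capL, C.quotData_thetaL (f := f) (g := C.star₁ f)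
      (by simp) (by simp)]
    rw [← e]
    simp (maxDischargeDepth := 9) [h, DualityData.capL, DualityData.ltr₁]
  theta_cupL f := by
    have e := congrArg C.proj (C.isConsistent.theta_cupL f)
    have h : C.tgt (C.thetaL C.φ f (C.star₁ f)) = C.ltr₁ (C.comp (C.star₁ f) f) := by
      simp (maxDischargeDepth := 15) [DualityData.thetaL, DualityData.ltr₁, DualityData.lsharp₁,
        DualityData.rsharp₁]
    simp only [quotData_star₁, quotData_cupL, C.quotData_thetaL (f := f) (g := C.star₁ f)
      (by simp) (by simp)]
    rw [← e]
    simp (maxDischargeDepth := 9) [h, DualityData.cupL, DualityData.capL, DualityData.ltr₁]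

theorem quotData_isSpherical : C.quotData.IsSpherical (fun f => C.proj (C.σ f)) where
  src_σ f h := by simp [C.isSpherical.src_σ f h]
  tgt_σ f h := by simp [C.isSpherical.tgt_σ f h]
  σ_unitary f h := C.isUnitary_proj (C.isSpherical.σ_unitary f h)
  σ_natural := by
    simp only [forall_quotCell]
    intro α h
    simp only [quotData_toSemistrictMonoidal, quotMonoidal_toStrict2Cat, quotCat_dom, quotCat_cod,
      quotCat_src] at h
    have h' : C.dom (C.tgt α) = C.cod (C.tgt α) := by simpa using h
    have e := congrArg C.proj (C.isSpherical.σ_natural α h)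
    simp only [quotData_toSemistrictMonoidal, quotMonoidal_toStrict2Cat, quotCat_src, quotCat_tgt,
      quotData_ltr₂ C h.symm, quotData_rtr₂ C h.symm]
    rw [quotCat_vcomp, quotCat_vcomp, e]
    · rw [C.isSpherical.src_σ _ h']
      simp (maxDischargeDepth := 9) [DualityData.ltr₁, DualityData.ltr₂, h]
    · rw [C.isSpherical.tgt_σ _ h]
      simp (maxDischargeDepth := 9) [DualityData.rtr₁, DualityData.rtr₂, h]
  capL_σ A := by
    have e := congrArg C.proj (C.isSpherical.capL_σ A)
    have h := C.isSpherical.src_σ (C.id₁ A) (by simp)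
    simp only [quotData_toSemistrictMonoidal, quotMonoidal_toStrict2Cat, quotCat_id₁,
      quotData_capL, quotData_capR]
    rw [← e, quotCat_vcomp]
    simp (maxDischargeDepth := 9) [h, DualityData.capL, DualityData.ltr₁]
  σ_cupR A := by
    have e := congrArg C.proj (C.isSpherical.σ_cupR A)
    have h := C.isSpherical.tgt_σ (C.id₁ A) (by simp)
    simp only [quotData_toSemistrictMonoidal, quotMonoidal_toStrict2Cat, quotCat_id₁,
      quotData_cupL, quotData_cupR]
    rw [← e, quotCat_vcomp]
    simp (maxDischargeDepth := 9) [h, DualityData.cupR, DualityData.capR, DualityData.rtr₁]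

/-- The spherical 2-category underlying `C/J`. -/
noncomputable def quotSpherical : SemistrictSpherical O M C.QuotCell where
  toDualityData := C.quotData
  isDuality := C.quotData_isDuality
  φ f := C.proj (C.φ f)
  isPivotal := C.quotData_isPivotal
  isConsistent := C.quotData_isConsistent
  σ f := C.proj (C.σ f)
  isSpherical := C.quotData_isSpherical

@[simp] theorem proj_add_rep {α β : N} (h : C.Par α β) :
    C.proj (C.lin.add (C.rep (C.proj α)) (C.rep (C.proj β))) = C.proj (C.lin.add α β) :=
  C.proj_eq (C.trEquiv_add (C.rep_proj α) (C.rep_proj β) (by simpa [Strict2Cat.Par] using h))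

@[simp] theorem proj_neg_rep (α : N) :
    C.proj (C.lin.neg (C.rep (C.proj α))) = C.proj (C.lin.neg α) :=
  C.proj_eq (C.trEquiv_neg (C.rep_proj α))

@[simp] theorem proj_smul_rep (c : F) (α : N) :
    C.proj (C.lin.smul c (C.rep (C.proj α))) = C.proj (C.lin.smul c α) :=
  C.proj_eq (C.trEquiv_smul c (C.rep_proj α))

@[simp] theorem quotCat_par {α β : N} : C.quotCat.Par (C.proj α) (C.proj β) ↔ C.Par α β := by
  simp [Strict2Cat.Par]

/-- The linear structure of `C/J`. -/
noncomputable def quotLin : LinearStructure F C.quotMonoidal where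
  zero f g := C.proj (C.lin.zero f g)
  add x y := C.proj (C.lin.add (C.rep x) (C.rep y))
  neg x := C.proj (C.lin.neg (C.rep x))
  smul c x := C.proj (C.lin.smul c (C.rep x))
  src_zero f g h h' := by
    simp only [quotMonoidal_toStrict2Cat, quotCat_src, C.lin.src_zero f g h h']
  tgt_zero f g h h' := by
    simp only [quotMonoidal_toStrict2Cat, quotCat_tgt, C.lin.tgt_zero f g h h']
  src_add := by
    simp only [forall_quotCell, quotMonoidal_toStrict2Cat, quotCat_par]
    intro α β h
    simp [h, C.lin.src_add]
  tgt_add := by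
    simp only [forall_quotCell, quotMonoidal_toStrict2Cat, quotCat_par]
    intro α β h
    simp [h, C.lin.tgt_add]
  src_neg := by simp [forall_quotCell, C.lin.src_neg]
  tgt_neg := by simp [forall_quotCell, C.lin.tgt_neg]
  src_smul := by simp [forall_quotCell, C.lin.src_smul]
  tgt_smul := by simp [forall_quotCell, C.lin.tgt_smul]
  add_assoc := by
    simp only [forall_quotCell, quotMonoidal_toStrict2Cat, quotCat_par]
    intro α β γ h h'
    rw [C.proj_add_rep h, C.proj_add_rep h', C.proj_add_rep, C.proj_add_rep,
      C.lin.add_assoc _ _ _ h h']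
    · exact ⟨by rw [C.lin.src_add _ _ h', h.1], by rw [C.lin.tgt_add _ _ h', h.2]⟩
    · exact ⟨by rw [C.lin.src_add _ _ h, h.1, h'.1], by rw [C.lin.tgt_add _ _ h, h.2, h'.2]⟩
  add_comm := by
    simp only [forall_quotCell, quotMonoidal_toStrict2Cat, quotCat_par]
    intro α β h
    rw [C.proj_add_rep h, C.proj_add_rep ⟨h.1.symm, h.2.symm⟩, C.lin.add_comm _ _ h]
  zero_add := by
    simp only [forall_quotCell, quotMonoidal_toStrict2Cat, quotCat_src, quotCat_tgt]
    intro α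
    rw [C.proj_add_rep ⟨C.lin.src_zero _ _ (by simp) (by simp),
      C.lin.tgt_zero _ _ (by simp) (by simp)⟩, C.lin.zero_add]
  neg_add := by
    simp only [forall_quotCell, quotMonoidal_toStrict2Cat, quotCat_src, quotCat_tgt]
    intro α
    rw [proj_neg_rep, C.proj_add_rep ⟨C.lin.src_neg α, C.lin.tgt_neg α⟩, C.lin.neg_add]
  one_smul := by simp [C.lin.one_smul]
  mul_smul := by simp [C.lin.mul_smul]
  smul_add := by
    simp only [forall_quotCell, quotMonoidal_toStrict2Cat, quotCat_par]
    intro c α β h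
    rw [C.proj_add_rep h, proj_smul_rep, proj_smul_rep, proj_smul_rep, C.proj_add_rep,
      C.lin.smul_add _ _ _ h]
    exact ⟨by rw [C.lin.src_smul, C.lin.src_smul, h.1], by rw [C.lin.tgt_smul, C.lin.tgt_smul, h.2]⟩
  add_smul := by
    simp only [forall_quotCell]
    intro c d α
    rw [proj_smul_rep, proj_smul_rep, proj_smul_rep, C.proj_add_rep, C.lin.add_smul]
    exact ⟨by rw [C.lin.src_smul, C.lin.src_smul], by rw [C.lin.tgt_smul, C.lin.tgt_smul]⟩
  add_vcomp := by
    simp only [forall_quotCell, quotMonoidal_toStrict2Cat, quotCat_par, quotCat_src, quotCat_tgt]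
    intro α α' β h hβ
    have hβ' : C.tgt α' = C.src β := h.2.symm.trans hβ
    rw [C.proj_add_rep h, C.quotCat_vcomp hβ, C.quotCat_vcomp hβ', C.quotCat_vcomp,
      C.lin.add_vcomp _ _ _ h hβ, C.proj_add_rep]
    · exact ⟨by simp [hβ, hβ', h.1], by simp [hβ, hβ']⟩
    · rw [C.lin.tgt_add _ _ h, hβ]
  vcomp_add := by
    simp only [forall_quotCell, quotMonoidal_toStrict2Cat, quotCat_par, quotCat_src, quotCat_tgt]
    intro α β β' h hα
    have hα' : C.tgt α = C.src β' := hα.trans h.1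
    rw [C.proj_add_rep h, C.quotCat_vcomp hα, C.quotCat_vcomp hα', C.quotCat_vcomp,
      C.lin.vcomp_add _ _ _ h hα, C.proj_add_rep]
    · exact ⟨by rw [C.src_vcomp _ _ hα, C.src_vcomp _ _ hα'],
        by rw [C.tgt_vcomp _ _ hα, C.tgt_vcomp _ _ hα', h.2]⟩
    · rw [C.lin.src_add _ _ h, hα]
  smul_vcomp := by
    simp only [forall_quotCell, quotMonoidal_toStrict2Cat, quotCat_src, quotCat_tgt]
    intro c α β h
    rw [proj_smul_rep, C.quotCat_vcomp h, C.quotCat_vcomp (by rw [C.lin.tgt_smul, h]),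
      proj_smul_rep, C.lin.smul_vcomp _ _ _ h]
  vcomp_smul := by
    simp only [forall_quotCell, quotMonoidal_toStrict2Cat, quotCat_src, quotCat_tgt]
    intro c α β h
    rw [proj_smul_rep, C.quotCat_vcomp h, C.quotCat_vcomp (by rw [C.lin.src_smul, h]),
      proj_smul_rep, C.lin.vcomp_smul _ _ _ h]
  add_hcomp := by
    simp only [forall_quotCell, quotMonoidal_toStrict2Cat, quotCat_par, quotCat_src, quotCat_cod,
      quotCat_dom]
    intro α α' β h hβ
    have hβ' : C.cod (C.src α') = C.dom (C.src β) := by rw [← h.1, hβ]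
    rw [C.proj_add_rep h, C.quotCat_hcomp hβ, C.quotCat_hcomp hβ', C.quotCat_hcomp,
      C.lin.add_hcomp _ _ _ h hβ, C.proj_add_rep]
    · exact ⟨by simp [hβ', h.1], by simp [hβ, hβ', h.2]⟩
    · rw [C.lin.src_add _ _ h, hβ]
  hcomp_add := by
    simp only [forall_quotCell, quotMonoidal_toStrict2Cat, quotCat_par, quotCat_src, quotCat_cod,
      quotCat_dom]
    intro α β β' h hα
    have hα' : C.cod (C.src α) = C.dom (C.src β') := by rw [← h.1, hα]
    rw [C.proj_add_rep h, C.quotCat_hcomp hα, C.quotCat_hcomp hα', C.quotCat_hcomp,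
      C.lin.hcomp_add _ _ _ h hα, C.proj_add_rep]
    · exact ⟨by rw [C.src_hcomp _ _ hα, C.src_hcomp _ _ hα', h.1],
        by rw [C.tgt_hcomp _ _ hα, C.tgt_hcomp _ _ hα', h.2]⟩
    · rw [C.lin.src_add _ _ h, hα]
  smul_hcomp := by
    simp only [forall_quotCell, quotMonoidal_toStrict2Cat, quotCat_src, quotCat_cod, quotCat_dom]
    intro c α β h
    rw [proj_smul_rep, C.quotCat_hcomp h, C.quotCat_hcomp (by rw [C.lin.src_smul, h]),
      proj_smul_rep, C.lin.smul_hcomp _ _ _ h]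
  hcomp_smul := by
    simp only [forall_quotCell, quotMonoidal_toStrict2Cat, quotCat_src, quotCat_cod, quotCat_dom]
    intro c α β h
    rw [proj_smul_rep, C.quotCat_hcomp h, C.quotCat_hcomp (by rw [C.lin.src_smul, h]),
      proj_smul_rep, C.lin.hcomp_smul _ _ _ h]
  lt₂_add := by
    simp only [forall_quotCell, quotMonoidal_toStrict2Cat, quotCat_par]
    intro A α β h
    rw [C.proj_add_rep h, quotMonoidal_lt₂, quotMonoidal_lt₂, quotMonoidal_lt₂,
      C.proj_add_rep ⟨by simp [h.1], by simp [h.2]⟩, C.lin.lt₂_add _ _ _ h]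
  rt₂_add := by
    simp only [forall_quotCell, quotMonoidal_toStrict2Cat, quotCat_par]
    intro α β A h
    rw [C.proj_add_rep h, quotMonoidal_rt₂, quotMonoidal_rt₂, quotMonoidal_rt₂,
      C.proj_add_rep ⟨by simp [h.1], by simp [h.2]⟩, C.lin.rt₂_add _ _ _ h]
  lt₂_smul := by
    simp only [forall_quotCell]
    intro c A α
    rw [proj_smul_rep, quotMonoidal_lt₂, quotMonoidal_lt₂, proj_smul_rep, C.lin.lt₂_smul]
  rt₂_smul := by
    simp only [forall_quotCell]
    intro c α A
    rw [proj_smul_rep, quotMonoidal_rt₂, quotMonoidal_rt₂, proj_smul_rep, C.lin.rt₂_smul]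

end VectLinearSpherical

/-! ### Ideals and quotients of `Vectⁿ` -/

section TwoVectorSpaceQuotients

open CategoryTheory

universe v w v₁ v₂ v₃ w₁ w₂ w₃

/-- A nonzero linear map between vector spaces generates the identity of every
finite-dimensional space. -/
theorem FGModuleCat.exists_sum_comp_comp {F : Type u} [Field F] {V W : FGModuleCat.{u} F}
    (f : V ⟶ W) (hf : f ≠ 0) (U : FGModuleCat.{u} F) :
    ∃ (n : ℕ) (a : Fin n → (U ⟶ V)) (b : Fin n → (W ⟶ U)), ∑ i, a i ≫ f ≫ b i = 𝟙 U := by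
  obtain ⟨v, hv⟩ : ∃ v : V, f.hom.hom v ≠ 0 := by
    by_contra! h
    exact hf (by ext x; exact h x)
  obtain ⟨ψ, hψ⟩ := Module.Projective.exists_dual_eq_one F hv
  let B := Module.finBasis F U
  -- As `ψ (f v) = 1`, the composite `a i ≫ f ≫ b i` is the projection of `U` onto its `i`-th basis
  -- line, and these projections sum to the identity.
  let a (i : Fin (Module.finrank F U)) : U ⟶ V := FGModuleCat.ofHom ((B.coord i).smulRight v)
  let b (i : Fin (Module.finrank F U)) : W ⟶ U := FGModuleCat.ofHom (ψ.smulRight (B i))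
  refine ⟨_, a, b, ?_⟩
  have key (x : U) (s : Finset (Fin (Module.finrank F U))) :
      (∑ i ∈ s, a i ≫ f ≫ b i).hom.hom x = ∑ i ∈ s, B.repr x i • B i := by
    classical
    induction s using Finset.induction_on with
    | empty => simp
    | insert i s hi ih =>
      rw [Finset.sum_insert hi, Finset.sum_insert hi, ← ih]
      have : (a i ≫ f ≫ b i).hom.hom x = B.repr x i • B i := by
        change ψ (f.hom.hom (B.coord i x • v)) • B i = _
        simp [hψ]
      rw [← this]
      rfl
  ext x
  rw [key]
  exact B.sum_repr x

variable {A : Type v₁} [Category.{w₁} A] {B : Type v₂} [Category.{w₂} B]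
  {D : Type v₃} [Category.{w₃} D]

/-- Of two functors identifying the same morphisms, the first being full and essentially surjective,
the second factors through the first. -/
noncomputable def CategoryTheory.Functor.factorThrough (P : A ⥤ B) (R : A ⥤ D) [P.Full] [P.EssSurj]
    (h : ∀ {X Y : A} (f g : X ⟶ Y), P.map f = P.map g → R.map f = R.map g) : B ⥤ D where
  obj X := R.obj (P.objPreimage X)
  map f := R.map (P.preimage
    ((P.objObjPreimageIso _).hom ≫ f ≫ (P.objObjPreimageIso _).inv))
  map_id X := by rw [← R.map_id]; exact h _ _ (by simp)
  map_comp f g := by rw [← R.map_comp]; exact h _ _ (by simp)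

section

variable (P : A ⥤ B) (R : A ⥤ D) [P.Full] [P.EssSurj] [R.Full] [R.EssSurj]
  (h : ∀ {X Y : A} (f g : X ⟶ Y), P.map f = P.map g ↔ R.map f = R.map g)

/-- `P` and `R` identify the same morphisms, so their targets are, up to equivalence, the same
quotient of `A`. -/
theorem CategoryTheory.Functor.isEquivalence_factorThrough :
    (P.factorThrough R fun f g => (h f g).1).IsEquivalence where
  faithful := ⟨fun {X Y} f g e => by
    have e' := (h _ _).2 e
    simpa using e'⟩
  full := ⟨fun {X Y} g => by
    refine ⟨(P.objObjPreimageIso _).inv ≫ P.map (R.preimage g) ≫ (P.objObjPreimageIso _).hom, ?_⟩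
    conv_rhs => rw [← R.map_preimage g]
    exact (h _ _).1 (by simp)⟩
  essSurj := ⟨fun Y => by
    let X := R.objPreimage Y
    let i := P.objObjPreimageIso (P.obj X)
    -- The lifts of `i.hom` and `i.inv` along `P` need not be inverse in `A`; they are so after
    -- applying `P`, hence also after applying `R`.
    let j : R.obj (P.objPreimage (P.obj X)) ≅ R.obj X :=
      { hom := R.map (P.preimage i.hom)
        inv := R.map (P.preimage i.inv)
        hom_inv_id := by rw [← R.map_comp, ← R.map_id]; exact (h _ _).1 (by simp)
        inv_hom_id := by rw [← R.map_comp, ← R.map_id]; exact (h _ _).1 (by simp) }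
    exact ⟨P.obj X, ⟨j ≪≫ R.objObjPreimageIso Y⟩⟩⟩

end

/-- A full and essentially surjective linear functor maps a 2-vector space of finite rank onto a
2-vector space of finite rank. -/
theorem IsTwoVectorSpace.of_full {F : Type u} [Field F] [Preadditive A] [Linear F A]
    [Preadditive B] [Linear F B] (hA : IsTwoVectorSpace F A) (P : A ⥤ B) [P.Full] [P.EssSurj]
    [P.Additive] [P.Linear F] : IsTwoVectorSpace F B := by
  classical
  obtain ⟨n, E, hE⟩ := hA
  have map_add {X Y : A} (f g : X ⟶ Y) (k : Fin n) :
      E.functor.map (f + g) k = E.functor.map f k + E.functor.map g k :=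
    (hE k).1.map_add
  have map_smul {X Y : A} (c : F) (f : X ⟶ Y) (k : Fin n) :
      E.functor.map (c • f) k = c • E.functor.map f k :=
    (hE k).2.map_smul f c
  have map_zero (X Y : A) (k : Fin n) : E.functor.map (0 : X ⟶ Y) k = 0 := by
    simpa using map_add (0 : X ⟶ Y) 0 k
  have map_sum {X Y : A} {ι : Type} (s : Finset ι) (f : ι → (X ⟶ Y)) (k : Fin n) :
      E.functor.map (∑ i ∈ s, f i) k = ∑ i ∈ s, E.functor.map (f i) k := by
    induction s using Finset.induction_on with
    | empty => simp [map_zero]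
    | insert i s hi ih => rw [Finset.sum_insert hi, Finset.sum_insert hi, map_add, ih]
  -- The morphism concentrated in the `k`-th factor, with component `a` there and zero elsewhere.
  let sgl {X Y : A} (k : Fin n) (a : E.functor.obj X k ⟶ E.functor.obj Y k) : X ⟶ Y :=
    E.functor.preimage (Pi.single k a)
  have sgl_same {X Y : A} (k : Fin n) (a : E.functor.obj X k ⟶ E.functor.obj Y k) :
      E.functor.map (sgl k a) k = a := by simp [sgl]
  have sgl_ne {X Y : A} {k j : Fin n} (hj : j ≠ k)
      (a : E.functor.obj X k ⟶ E.functor.obj Y k) : E.functor.map (sgl k a) j = 0 := by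
    simp [sgl, hj]
  have ext {X Y : A} {f g : X ⟶ Y} (h : ∀ k, E.functor.map f k = E.functor.map g k) : f = g :=
    E.functor.map_injective (funext h)
  -- The factors that survive: those on which `P` does not kill every identity. The quotient will be
  -- `Vectᵐ` with `m` the number of these.
  let S : Set (Fin n) := {k | ∃ X : A, P.map (sgl k (𝟙 (E.functor.obj X k)) : X ⟶ X) ≠ 0}
  let m := Fintype.card S
  let ι : Fin m → Fin n := fun i => ((Fintype.equivFin S).symm i).1
  have ι_inj : Function.Injective ι :=
    Subtype.val_injective.comp (Fintype.equivFin S).symm.injective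
  have ι_mem (i : Fin m) : ι i ∈ S := ((Fintype.equivFin S).symm i).2
  have ι_surj (k : Fin n) (hk : k ∈ S) : ∃ i, ι i = k :=
    ⟨Fintype.equivFin S ⟨k, hk⟩, by simp [ι]⟩
  let R₀ : (Fin n → FGModuleCat.{u} F) ⥤ (Fin m → FGModuleCat.{u} F) :=
    Pi.comap (fun _ => FGModuleCat.{u} F) ι
  have : R₀.Full := ⟨fun {X Y} g => by
    let f : ∀ k, X k ⟶ Y k := ∑ i, Pi.single (ι i) (g i)
    refine ⟨f, funext fun i' => ?_⟩
    change (∑ i, Pi.single (ι i) (g i) : ∀ k, X k ⟶ Y k) (ι i') = g i'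
    rw [Finset.sum_apply, Finset.sum_eq_single i']
    · simp
    · intro i _ hi
      exact Pi.single_eq_of_ne (fun e => hi (ι_inj e).symm) _
    · simp⟩
  have : R₀.EssSurj := ⟨fun Y => by
    -- The objects placed in the factors outside `S` are arbitrary, since `R₀` forgets them.
    refine ⟨Function.extend ι Y (fun _ => FGModuleCat.of F PUnit), ⟨eqToIso ?_⟩⟩
    funext i
    change Function.extend ι Y (fun _ => FGModuleCat.of F PUnit) (ι i) = Y i
    exact ι_inj.extend_apply Y _ i⟩
  have ker {X Y : A} (f : X ⟶ Y) : P.map f = 0 ↔ ∀ i, E.functor.map f (ι i) = 0 := by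
    constructor
    · intro hf i
      by_contra hne
      obtain ⟨X₀, hX₀⟩ := ι_mem i
      -- A nonzero component in a surviving factor generates the identity of that factor at `X₀`. If
      -- `P` killed `f` it would kill this identity too, against the choice of `X₀`.
      obtain ⟨r, a, b, hab⟩ := FGModuleCat.exists_sum_comp_comp _ hne (E.functor.obj X₀ (ι i))
      refine hX₀ ?_
      have : sgl (ι i) (𝟙 (E.functor.obj X₀ (ι i))) =
          ∑ j, sgl (ι i) (a j) ≫ f ≫ sgl (ι i) (b j) := by
        refine ext fun k => ?_
        rw [map_sum]
        by_cases hk : k = ι i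
        · subst hk
          rw [sgl_same, ← hab]
          refine Finset.sum_congr rfl fun j _ => ?_
          rw [Functor.map_comp, Functor.map_comp, Pi.comp_apply, Pi.comp_apply, sgl_same, sgl_same]
        · rw [sgl_ne hk]
          refine (Finset.sum_eq_zero fun j _ => ?_).symm
          rw [Functor.map_comp, Pi.comp_apply, sgl_ne hk, Limits.zero_comp]
      rw [this, Functor.map_sum]
      exact Finset.sum_eq_zero fun j _ => by simp [hf]
    · intro hf
      -- Decomposition of `f` into its components: those in surviving factors vanish by assumption,
      -- the others pass through an identity that `P` kills.
      have : f = ∑ k, f ≫ sgl k (𝟙 (E.functor.obj Y k)) := by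
        refine ext fun k => ?_
        rw [map_sum, Finset.sum_eq_single k]
        · rw [Functor.map_comp, Pi.comp_apply, sgl_same, Category.comp_id]
        · intro j _ hj
          rw [Functor.map_comp, Pi.comp_apply, sgl_ne hj.symm, Limits.comp_zero]
        · simp
      rw [this, Functor.map_sum]
      refine Finset.sum_eq_zero fun k _ => ?_
      by_cases hk : k ∈ S
      · obtain ⟨i, rfl⟩ := ι_surj k hk
        have : f ≫ sgl (ι i) (𝟙 (E.functor.obj Y (ι i))) = 0 := by
          refine ext fun j => ?_
          rw [map_zero, Functor.map_comp, Pi.comp_apply]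
          by_cases hj : j = ι i
          · subst hj
            rw [hf, Limits.zero_comp]
          · rw [sgl_ne hj, Limits.comp_zero]
        rw [this, P.map_zero]
      · have : P.map (sgl k (𝟙 (E.functor.obj Y k))) = 0 := by
          by_contra h
          exact hk ⟨Y, h⟩
        rw [Functor.map_comp, this, Limits.comp_zero]
  have key {X Y : A} (f g : X ⟶ Y) :
      P.map f = P.map g ↔ (E.functor ⋙ R₀).map f = (E.functor ⋙ R₀).map g := by
    have h := ker (f - g)
    rw [P.map_sub, sub_eq_zero] at h
    rw [h, funext_iff]
    refine forall_congr' fun i => ?_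
    change _ ↔ E.functor.map f (ι i) = E.functor.map g (ι i)
    have e := map_add (f - g) g (ι i)
    rw [sub_add_cancel] at e
    rw [e]
    simp
  let G : B ⥤ (Fin m → FGModuleCat.{u} F) :=
    P.factorThrough (E.functor ⋙ R₀) fun f g => (key f g).1
  have : G.IsEquivalence := P.isEquivalence_factorThrough (E.functor ⋙ R₀) key
  refine ⟨m, G.asEquivalence, fun k => ⟨⟨fun {X Y f g} => ?_⟩, ⟨fun {X Y} f c => ?_⟩⟩⟩
  · change G.map (f + g) k = G.map f k + G.map g k
    -- The chosen lift of a sum need not be the sum of the lifts, but both have the same image under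
    -- `P`, hence under `E.functor ⋙ R₀`, whose components are additive.
    have e := (key (P.preimage ((P.objObjPreimageIso X).hom ≫ (f + g) ≫
        (P.objObjPreimageIso Y).inv))
      (P.preimage ((P.objObjPreimageIso X).hom ≫ f ≫ (P.objObjPreimageIso Y).inv) +
        P.preimage ((P.objObjPreimageIso X).hom ≫ g ≫ (P.objObjPreimageIso Y).inv))).1
      (by simp [P.map_add])
    exact (congrFun e k).trans (map_add _ _ _)
  · change G.map (c • f) k = c • G.map f k
    have e := (key (P.preimage ((P.objObjPreimageIso X).hom ≫ (c • f) ≫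
        (P.objObjPreimageIso Y).inv))
      (c • P.preimage ((P.objObjPreimageIso X).hom ≫ f ≫ (P.objObjPreimageIso Y).inv))).1
      (by simp [P.map_smul])
    exact (congrFun e k).trans (map_smul _ _ _)

/-- If `End(X)` is nonzero and maps injectively under a linear functor out of a category equivalent
to `Vect`, then that functor is faithful. -/
theorem IsEquivVect.faithful {F : Type u} [Field F] [Preadditive A] [Linear F A]
    [Preadditive B] (hA : IsEquivVect F A) (P : A ⥤ B) [P.Additive] (X : A) (hX : 𝟙 X ≠ 0)
    (hP : ∀ f : X ⟶ X, P.map f = 0 → f = 0) : P.Faithful := by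
  obtain ⟨E, hE, -⟩ := hA
  refine ⟨fun {Y Z} f g h => ?_⟩
  rw [← sub_eq_zero]
  by_contra hne
  have hne' : E.functor.map (f - g) ≠ 0 := fun e =>
    hne (E.functor.map_injective (by rw [e, E.functor.map_zero]))
  -- A nonzero `f - g` killed by `P` would generate `𝟙 X`, so `P` would kill `𝟙 X`, contrary to
  -- injectivity on `End(X)`.
  obtain ⟨r, a, b, hab⟩ := FGModuleCat.exists_sum_comp_comp _ hne' (E.functor.obj X)
  have e : 𝟙 X = ∑ j, E.functor.preimage (a j) ≫ (f - g) ≫ E.functor.preimage (b j) := by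
    refine E.functor.map_injective ?_
    rw [E.functor.map_id, Functor.map_sum, ← hab]
    simp
  refine hX (hP _ ?_)
  rw [e, Functor.map_sum]
  refine Finset.sum_eq_zero fun j _ => ?_
  rw [Functor.map_comp, Functor.map_comp, P.map_sub, h, sub_self]
  simp

theorem IsEquivVect.of_full_faithful {F : Type u} [Field F] [Preadditive A] [Linear F A]
    [Preadditive B] [Linear F B] (hA : IsEquivVect F A) (P : A ⥤ B) [P.Full] [P.Faithful]
    [P.EssSurj] [P.Additive] [P.Linear F] : IsEquivVect F B := by
  obtain ⟨E, hE, hE'⟩ := hA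
  have : P.IsEquivalence := { }
  have : P.asEquivalence.functor.Additive := inferInstanceAs P.Additive
  have : P.asEquivalence.functor.Linear F := inferInstanceAs (P.Linear F)
  have : P.asEquivalence.symm.functor.Additive :=
    inferInstanceAs P.asEquivalence.inverse.Additive
  have : P.asEquivalence.symm.functor.Linear F :=
    inferInstanceAs (P.asEquivalence.inverse.Linear F)
  exact ⟨P.asEquivalence.symm.trans E,
    inferInstanceAs (P.asEquivalence.inverse ⋙ E.functor).Additive,
    inferInstanceAs ((P.asEquivalence.inverse ⋙ E.functor).Linear F)⟩

end TwoVectorSpaceQuotients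

/-! ### Duality data at the unit object -/

namespace SemistrictSpherical

variable {O : Type u₁} {M : Type u₂} {N : Type u₃} (C : SemistrictSpherical O M N)

-- Dualise `I ⊗ I* = I*` and use `I** = I`.
@[simp] theorem star₀_I : C.star₀ C.I = C.I := by
  have h := C.star₀_tensor C.I (C.star₀ C.I)
  simpa using h.symm

-- The formula for `i_{I ⊗ I}` makes `i_I` idempotent, and `T_I = 1` has source `i_I e_I`; an
-- idempotent with a right inverse is the identity.
@[simp] theorem i_I : C.i C.I = C.id₁ C.I := by
  have hT := congrArg C.src C.isDuality.T_I
  have hi := C.isDuality.tensor_i C.I C.I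
  have he := C.isDuality.e_star₀ C.I
  have hd : C.dom (C.e C.I) = C.I := by simp
  have hc : C.cod (C.i C.I) = C.I := by simp
  simp only [star₀_I, C.I_tensor, C.rt₁_I, C.I_lt₁, C.src_T, C.src_id₂] at hT hi he
  have e := C.comp_assoc (C.i C.I) (C.i C.I) (C.e C.I) (by simp) (by simp)
  rw [← hi, hT] at e
  simpa using e.symm

-- The same argument one level up: the unit is idempotent because `1_A 1_A = 1_A`, and the triangle
-- identity gives it a right inverse.
@[simp] theorem η_id₁ (A : O) : C.η (C.id₁ A) = C.id₂ (C.id₁ A) := by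
  have h := C.triangle (C.id₁ A)
  have h' := C.isDuality.η_comp (C.id₁ A) (C.id₁ A) (by simp)
  simp only [star₁_id₁, C.comp_id₁_of_eq (C.cod_id₁ A)] at h'
  simp at h h'
  have e := C.vcomp_assoc (C.η (C.id₁ A)) (C.η (C.id₁ A)) (C.ε (C.id₁ A)) (by simp) (by simp)
  rw [← h', h] at e
  simpa using e.symm

theorem pair_id₂_unit {α : N} (hs : C.src α = C.id₁ C.I) (ht : C.tgt α = C.id₁ C.I) :
    C.pair α (C.id₂ (C.id₁ C.I)) = α := by
  have he : C.e C.I = C.id₁ C.I := by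
    have h := C.isDuality.e_star₀ C.I
    rwa [star₀_I, i_I, star₁_id₁] at h
  simp (maxDischargeDepth := 9) [DualityData.pair, DualityData.capR, DualityData.cupR,
    DualityData.rtr₂, hs, ht, he]

end SemistrictSpherical

/-! ### The quotient `C/J`: linearity, non-degeneracy and the unit -/

namespace VectLinearSpherical

open CategoryTheory

variable {F : Type u} [Field F] {O : Type u₁} {M : Type u₂} {N : Type u₃}
  (C : VectLinearSpherical F O M N)

/-- The projection `Hom_C(A, B) ⥤ Hom_{C/J}(A, B)`. -/
noncomputable def projFunctor (A B : O) :
    C.toStrict2Cat.Hom A B ⥤ C.quotSpherical.toStrict2Cat.Hom A B where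
  obj f := ⟨f.1, f.2⟩
  map α := ⟨C.proj α.1, (C.src_rep α.1).trans α.2.1, (C.tgt_rep α.1).trans α.2.2⟩
  map_id _ := rfl
  map_comp α β := Subtype.ext (C.quotCat_vcomp (α.2.2.trans β.2.1.symm)).symm

theorem projFunctor_full (A B : O) : (C.projFunctor A B).Full :=
  ⟨fun g => ⟨⟨C.rep g.1, g.2.1, g.2.2⟩, Subtype.ext (C.proj_rep g.1)⟩⟩

theorem projFunctor_essSurj (A B : O) : (C.projFunctor A B).EssSurj :=
  ⟨fun X => ⟨⟨X.1, X.2⟩, ⟨Iso.refl X⟩⟩⟩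

theorem projFunctor_additive (A B : O) :
    letI := C.lin.preadditive A B
    letI : Preadditive (C.quotSpherical.toStrict2Cat.Hom A B) := C.quotLin.preadditive A B
    (C.projFunctor A B).Additive :=
  letI := C.lin.preadditive A B
  letI : Preadditive (C.quotSpherical.toStrict2Cat.Hom A B) := C.quotLin.preadditive A B
  ⟨fun {_ _ α β} => Subtype.ext (C.proj_add_rep
    ⟨α.2.1.trans β.2.1.symm, α.2.2.trans β.2.2.symm⟩).symm⟩

theorem projFunctor_linear (A B : O) :
    letI := C.lin.preadditive A B
    letI := C.lin.linear A B
    letI : Preadditive (C.quotSpherical.toStrict2Cat.Hom A B) := C.quotLin.preadditive A B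
    letI : Linear F (C.quotSpherical.toStrict2Cat.Hom A B) := C.quotLin.linear A B
    (C.projFunctor A B).Linear F :=
  letI := C.lin.preadditive A B
  letI := C.lin.linear A B
  letI : Preadditive (C.quotSpherical.toStrict2Cat.Hom A B) := C.quotLin.preadditive A B
  letI : Linear F (C.quotSpherical.toStrict2Cat.Hom A B) := C.quotLin.linear A B
  ⟨fun α c => Subtype.ext (C.proj_smul_rep c α.1).symm⟩

/-- The Vect-linear spherical 2-category `C/J`. -/
noncomputable def quot : VectLinearSpherical F O M C.QuotCell where
  toSemistrictSpherical := C.quotSpherical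
  lin := C.quotLin
  isTwoVectorSpace A B :=
    @IsTwoVectorSpace.of_full _ _ _ _ F _ (C.lin.preadditive A B) (C.lin.linear A B)
      (C.quotLin.preadditive A B) (C.quotLin.linear A B) (C.isTwoVectorSpace A B)
      (C.projFunctor A B) (C.projFunctor_full A B) (C.projFunctor_essSurj A B)
      (C.projFunctor_additive A B) (C.projFunctor_linear A B)

theorem quot_isQuotient : C.IsQuotient C.quot where
  dom_eq := rfl
  cod_eq := rfl
  id₁_eq := rfl
  comp_eq := rfl
  I_eq := rfl
  tensor_eq := rfl
  lt₁_eq := rfl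
  rt₁_eq := rfl
  star₀_eq := rfl
  star₁_eq := rfl
  i_eq := rfl
  e_eq := rfl
  src_proj := C.src_rep
  tgt_proj := C.tgt_rep
  proj_eq_proj _ _ := C.proj_eq_proj
  id₂_eq _ := rfl
  vcomp_proj _ _ := C.quotCat_vcomp
  hcomp_proj _ _ := C.quotCat_hcomp
  lt₂_proj := C.quotMonoidal_lt₂
  rt₂_proj := C.quotMonoidal_rt₂
  ten_eq _ _ := rfl
  tenInv_eq _ _ := rfl
  star₂_proj := C.quotData_star₂
  η_eq _ := rfl
  ε_eq _ := rfl
  T_eq _ := rfl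
  φ_eq _ := rfl
  σ_eq _ _ := rfl
  zero_eq _ _ _ _ := rfl
  add_proj _ _ := C.proj_add_rep
  smul_proj := C.proj_smul_rep

/-- The projection is injective on `2End(1_I)`. -/
theorem proj_unit_injective {α β : N} (hs : C.src α = C.id₁ C.I) (ht : C.tgt α = C.id₁ C.I)
    (h : C.proj α = C.proj β) : α = β := by
  have h' := C.jRel_iff.1 (C.proj_eq_proj.1 h)
  -- Pairing with the identity of `1_I` returns the 2-morphism, so equivalent elements of
  -- `2End(1_I)` are equal.
  have e := h'.2 (C.id₂ (C.id₁ C.I)) (by simp [ht]) (by simp [hs])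
  rwa [C.pair_id₂_unit hs ht, C.pair_id₂_unit (h'.1.1.symm.trans hs) (h'.1.2.symm.trans ht)] at e

theorem quot_pair {α β : N} (h : C.tgt α = C.src β) (h' : C.tgt β = C.src α) :
    C.quotData.pair (C.proj α) (C.proj β) = C.proj (C.pair α β) := by
  have hd : C.cod (C.src β) = C.cod (C.src α) := by rw [← h]; simp
  have hd' : C.dom (C.src β) = C.dom (C.src α) := by rw [← h]; simp
  simp (maxDischargeDepth := 9) [DualityData.pair, DualityData.capR, DualityData.cupR,
    DualityData.rtr₂, h, h', hd, hd']

/-- The vanishing is assumed only for classes of pairings, but these lie in `2End(1_I)`, where the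
projection is injective; hence the pairings already vanish in `C`. -/
theorem proj_eq_zero {α : N} (h : ∀ β, C.src β = C.tgt α → C.tgt β = C.src α →
    C.proj (C.pair α β) = C.proj (C.lin.zero (C.id₁ C.I) (C.id₁ C.I))) :
    C.proj α = C.proj (C.lin.zero (C.src α) (C.tgt α)) := by
  refine C.proj_eq ⟨⟨(C.lin.src_zero _ _ (by simp) (by simp)).symm,
    (C.lin.tgt_zero _ _ (by simp) (by simp)).symm⟩, fun γ hs ht => ?_⟩
  rw [C.pair_zero (by simp) (by simp) hs ht]
  exact C.proj_unit_injective (C.src_pair hs ht) (C.tgt_pair hs ht) (h γ hs ht)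

theorem quot_isNondegenerate : C.quot.IsNondegenerate where
  left := by
    refine C.forall_quotCell.2 fun α h => ?_
    change C.proj α = C.proj (C.lin.zero (C.src (C.rep (C.proj α))) (C.tgt (C.rep (C.proj α))))
    rw [src_rep, tgt_rep]
    refine C.proj_eq_zero fun β hs ht => ?_
    rw [← C.quot_pair hs.symm ht]
    exact h (C.proj β) ((C.src_rep β).trans (hs.trans (C.tgt_rep α).symm))
      ((C.tgt_rep β).trans (ht.trans (C.src_rep α).symm))
  right := by
    refine C.forall_quotCell.2 fun α h => ?_
    change C.proj α = C.proj (C.lin.zero (C.src (C.rep (C.proj α))) (C.tgt (C.rep (C.proj α))))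
    rw [src_rep, tgt_rep]
    refine C.proj_eq_zero fun β hs ht => ?_
    -- Symmetry of the pairing makes its right kernel equal to its left kernel.
    rw [C.pair_comm hs.symm ht, ← C.quot_pair ht hs.symm]
    exact h (C.proj β) ((C.src_rep β).trans (hs.trans (C.tgt_rep α).symm))
      ((C.tgt_rep β).trans (ht.trans (C.src_rep α).symm))

theorem quot_unitIsVect (h : C.UnitIsVect) : C.quot.UnitIsVect := by
  obtain ⟨h₁, h₂⟩ := h
  constructor
  · let X : C.toStrict2Cat.Hom C.I C.I := ⟨C.id₁ C.I, C.dom_id₁ _, C.cod_id₁ _⟩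
    have : (C.projFunctor C.I C.I).Faithful := by
      refine @IsEquivVect.faithful _ _ _ _ F _ (C.lin.preadditive C.I C.I)
        (C.lin.linear C.I C.I) (C.quotLin.preadditive C.I C.I) h₁ (C.projFunctor C.I C.I)
        (C.projFunctor_additive C.I C.I) X (fun e => ?_) fun α hα => ?_
      · have e' : C.id₂ (C.id₁ C.I) = C.lin.zero (C.id₁ C.I) (C.id₁ C.I) := congrArg Subtype.val e
        obtain ⟨c, -, hc⟩ := h₂ (C.id₂ (C.id₁ C.I)) (C.src_id₂ _) (C.tgt_id₂ _)
        -- If the identity of `1_I` were zero, both scalars `1` and `0` would represent it, against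
        -- uniqueness.
        have h1 := hc 1 (C.lin.one_smul _).symm
        have h0 := hc 0 (by simp only [C.zero_smul, C.src_id₂, C.tgt_id₂]; exact e')
        exact one_ne_zero (h1.trans h0.symm)
      · exact Subtype.ext (C.proj_unit_injective α.2.1 α.2.2 (congrArg Subtype.val hα))
    exact @IsEquivVect.of_full_faithful _ _ _ _ F _ (C.lin.preadditive C.I C.I)
      (C.lin.linear C.I C.I) (C.quotLin.preadditive C.I C.I) (C.quotLin.linear C.I C.I) h₁
      (C.projFunctor C.I C.I) (C.projFunctor_full C.I C.I) this (C.projFunctor_essSurj C.I C.I)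
      (C.projFunctor_additive C.I C.I) (C.projFunctor_linear C.I C.I)
  · refine C.forall_quotCell.2 fun α hs ht => ?_
    replace hs : C.src α = C.id₁ C.I := (C.src_rep α).symm.trans hs
    replace ht : C.tgt α = C.id₁ C.I := (C.tgt_rep α).symm.trans ht
    obtain ⟨c, hc, hc'⟩ := h₂ α hs ht
    refine ⟨c, ?_, fun d hd => hc' d ?_⟩
    · rw [hc]
      exact (C.proj_smul_rep c _).symm
    · exact C.proj_unit_injective hs ht (hd.trans (C.proj_smul_rep d _))

end VectLinearSpherical

theorem lemma2p19 {F : Type u} [Field F] {O : Type u₁} {M : Type u₂} {N : Type u₃}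
    (C : VectLinearSpherical F O M N) :
    ∃ Q : VectLinearSpherical F O M C.QuotCell,
      C.IsQuotient Q ∧ Q.IsNondegenerate ∧ (C.UnitIsVect → Q.UnitIsVect) :=
  ⟨C.quot, C.quot_isQuotient, C.quot_isNondegenerate, C.quot_unitIsVect⟩
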